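/- Let $k$ be an algebraically closed field and let $\mathcal A$ be a $k$-linear Ext-finite hereditary abelian category with Serre duality: all $\operatorname{Ext}^n(A,B)$ are finite-dimensional, $\operatorname{Ext}^2(-,-)=0$, and there is an additive autoequivalence $\mathbb S$ of $D^b\mathcal A$ with isomorphisms $\operatorname{Hom}(X,Z)\cong\operatorname{Hom}(Z,\mathbb SX)^*$ natural in $X$ and $Z$. Write $\mathcal A[0]\subset D^b\mathcal A$ for the full subcategory of the objects isomorphic to a stalk complex $A[0]$ with $A\in\mathcal A$. An object $Y\in D^b\mathcal A$ is generalized $1$-spherical if $\operatorname{Hom}(Y,Y[i])=0$ for $i\neq 0,1$, the ring $\operatorname{End}(Y)$ is semi-simple, and $\mathbb SY\cong Y[1]$; it is minimal $1$-spherical if it is moreover nonzero and no nonzero proper direct summand of it is generalized $1$-spherical. With $E=\operatorname{End}(Y)$, the twists $T_Y$ and $T_Y^*$ are given on objects $Z\in D^b\mathcal A$, up to isomorphism, by the triangles $$\operatorname{RHom}(Y,Z)\otimes_E Y\to Z\to T_YZ\to(\operatorname{RHom}(Y,Z)\otimes_E Y)[1],$$ $$T_Y^*Z\to Z\to\operatorname{RHom}(Z,Y)^*\otimes_E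 Y\to T_Y^*Z[1]$$ on the evaluation and the coevaluation map, and $T_Y^{-n}:=(T_Y^*)^n$ for $n>0$. Let $Y\in\mathcal A$ be an object such that $Y[0]$ is minimal $1$-spherical; below we write $Y$ and $A$ also for $Y[0]$ and $A[0]$. The tube of $Y$ is the full subcategory of $\mathcal A$ of the objects having a finite filtration whose subquotients are direct summands of $Y$. The following are equivalent: 1. $Y$ is a semi-simple object of $\mathcal A$. 2. If $A,B\in\mathcal A$ are indecomposable with $\operatorname{Hom}(A,Y)\neq0$ and $\operatorname{Hom}(Y,B)\neq0$, then at least one of $A$ and $B$ lies in the tube of $Y$. 3. For every $A\in\mathcal A$ with $\operatorname{Hom}(A,Y)\neq0$ and $\operatorname{Hom}(Y,A)=0$, we have $T_Y^iA\in\mathcal A[0]$ for all $i\in\mathbb Z$. 4. For every $A\in\mathcal A$ with $\operatorname{Hom}(Y,A)\neq0$ and $\operatorname{Hom}(A,Y)=0$, we have $T_Y^iA\in\mathcal A[0]$ for all $i\in\mathbb Z$. Furthermore, all four properties hold if one of the following holds: (a) there is an object $A\in\mathcal A$ with $\operatorname{Hom}(A,Y)\neq0$, $\operatorname{Hom}(Y,A)=0$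 and $T_Y^iA\in\mathcal A[0]$ for all $i\in\mathbb Z$; (b) there is an object $A\in\mathcal A$ with $\operatorname{Hom}(Y,A)\neq0$, $\operatorname{Hom}(A,Y)=0$ and $T_Y^iA\in\mathcal A[0]$ for all $i\in\mathbb Z$. -/

import Mathlib

open CategoryTheory CategoryTheory.Limits CategoryTheory.Pretriangulated

universe w v u

namespace SphericalTube

/-! ### Direct summands and semi-simple objects -/

section Basic

attribute [local instance] Abelian.hasFiniteBiproducts

variable {C : Type u} [Category.{v} C]

/-- `X` is a direct summand of `Y`. -/
def IsDirectSummand [HasZeroMorphisms C] [HasBinaryBiproducts C] (X Y : C) : Prop :=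
  ∃ W : C, Nonempty (Y ≅ X ⊞ W)

/-- `Y` is semi-simple: it is a finite (possibly empty) direct sum of simple objects. -/
def IsSemisimpleObject [Abelian C] (Y : C) : Prop :=
  ∃ (n : ℕ) (s : Fin n → C), (∀ i, Simple (s i)) ∧ Nonempty (Y ≅ ⨁ s)

/-- The tube of an object `Y` of an abelian category: the objects `A` having a finite filtration
`0 = A₀ ⊆ A₁ ⊆ ⋯ ⊆ Aₘ = A` all of whose subquotients are direct summands of `Y`. -/
inductive InTube [Abelian C] (Y : C) : C → Prop
  | zero (A : C) (hA : IsZero A) : InTube Y A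
  | extension (E : ShortComplex C) (hE : E.ShortExact) (h₁ : InTube Y E.X₁)
      (h₃ : IsDirectSummand E.X₃ Y) : InTube Y E.X₂

variable (C)

/-- `Ext²(-,-) = 0`. -/
def IsHereditary [Abelian C] [HasExt.{w} C] : Prop :=
  ∀ A B : C, Subsingleton (Abelian.Ext.{w} A B 2)

/-- `dim_k Extⁿ(A,B) < ∞` for all `A`, `B` and `n ≥ 0`. -/
def IsExtFinite (k : Type*) [Field k] [Abelian C] [Linear k C] [HasExt.{w} C] : Prop :=
  ∀ (A B : C) (n : ℕ), Module.Finite k (Abelian.Ext.{w} A B n)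

end Basic

/-! ### Serre functors, spherical objects and twists in a triangulated category -/

/-- A Serre functor: an additive autoequivalence `𝕊` with isomorphisms
`Hom(X,Y) ≅ Hom(Y,𝕊X)^*` of vector spaces, natural in `X` and in `Y`. -/
structure SerreFunctor (k : Type*) [Field k] (D : Type u) [Category.{v} D] [Preadditive D]
    [Linear k D] where
  equiv : D ≌ D
  additive : equiv.functor.Additive
  duality (X Y : D) : (X ⟶ Y) ≃ₗ[k] Module.Dual k (Y ⟶ equiv.functor.obj X)
  natural_left {X' X Y : D} (a : X' ⟶ X) (f : X ⟶ Y) (g : Y ⟶ equiv.functor.obj X') :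
    duality X' Y (a ≫ f) g = duality X Y f (g ≫ equiv.functor.map a)
  natural_right {X Y Y' : D} (f : X ⟶ Y) (b : Y ⟶ Y') (g : Y' ⟶ equiv.functor.obj X) :
    duality X Y' (f ≫ b) g = duality X Y f (b ≫ g)

section Triangulated

variable {D : Type u} [Category.{v} D] [Preadditive D] [HasZeroObject D] [HasShift D ℤ]
  [∀ n : ℤ, (shiftFunctor D n).Additive] [Pretriangulated D]

/-- `Y` is generalized `n`-spherical with respect to the Serre functor `S`. -/
structure IsGeneralizedSpherical {k : Type*} [Field k] [Linear k D] (S : SerreFunctor k D)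
    (n : ℤ) (Y : D) : Prop where
  hom_shift_eq_zero (i : ℤ) (h₀ : i ≠ 0) (hn : i ≠ n) : Subsingleton (Y ⟶ Y⟦i⟧)
  end_semisimple : IsSemisimpleRing (End Y)
  serre_iso : Nonempty (S.equiv.functor.obj Y ≅ Y⟦n⟧)

/-- `Y` is minimal `n`-spherical: it is a nonzero generalized `n`-spherical object none of whose
nontrivial (that is, nonzero and proper) direct summands is generalized `n`-spherical. -/
structure IsMinimalSpherical {k : Type*} [Field k] [Linear k D] (S : SerreFunctor k D)
    (n : ℤ) (Y : D) : Prop where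
  spherical : IsGeneralizedSpherical S n Y
  nonzero : ¬ IsZero Y
  minimal (Z W : D) (e : Y ≅ Z ⊞ W) (hZ : IsGeneralizedSpherical S n Z) : IsZero Z ∨ IsZero W

/-- `P`, with the maps `u n : Hom(X[n],Z) → Hom(X[n],P)`, is `RHom(X,Z) ⊗_A X`, where
`A = End X` (identified with `End X[n]`) is semi-simple. As `A` is semi-simple,
`RHom(X,Z) ⊗_A X = ⨁ₙ Hom(X[n],Z) ⊗_A X[n]`, and `Hom(X[n],Z) ⊗_A X[n]` is the object with
`Hom(Hom(X[n],Z) ⊗_A X[n], W) = Hom_A(Hom(X[n],Z), Hom(X[n],W))` (morphisms of right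
`A`-modules). -/
def IsEvalTensor (X Z P : D)
    (u : ∀ n : ℤ, (X⟦n⟧ ⟶ Z) →ₗ[(End (X⟦n⟧))ᵐᵒᵖ] (X⟦n⟧ ⟶ P)) : Prop :=
  ∀ (W : D) (φ : ∀ n : ℤ, (X⟦n⟧ ⟶ Z) →ₗ[(End (X⟦n⟧))ᵐᵒᵖ] (X⟦n⟧ ⟶ W)),
    ∃! g : P ⟶ W, ∀ (n : ℤ) (f : X⟦n⟧ ⟶ Z), u n f ≫ g = φ n f

/-- `Z'` is (isomorphic to) `T_X Z`: there is a triangle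
`RHom(X,Z) ⊗_A X ⟶ Z ⟶ Z' ⟶ (RHom(X,Z) ⊗_A X)[1]` whose first map is the evaluation. -/
def IsTwist (X Z Z' : D) : Prop :=
  ∃ (P : D) (u : ∀ n : ℤ, (X⟦n⟧ ⟶ Z) →ₗ[(End (X⟦n⟧))ᵐᵒᵖ] (X⟦n⟧ ⟶ P)) (ev : P ⟶ Z)
    (i : Z ⟶ Z') (δ : Z' ⟶ P⟦(1 : ℤ)⟧),
    IsEvalTensor X Z P u ∧ (∀ (n : ℤ) (f : X⟦n⟧ ⟶ Z), u n f ≫ ev = f) ∧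
      Triangle.mk ev i δ ∈ distTriang D

/-- `P`, with the maps `u n : Hom(Z,X[n]) → Hom(P,X[n])`, is `RHom(Z,X)^* ⊗_A X`, where
`A = End X` (identified with `End X[n]`) is semi-simple. As `A` is semi-simple,
`RHom(Z,X)^* ⊗_A X = ⨁ₙ Hom(Z,X[n])^* ⊗_A X[n]`, and `Hom(Z,X[n])^* ⊗_A X[n]` is the object with
`Hom(W, Hom(Z,X[n])^* ⊗_A X[n]) = Hom_A(Hom(Z,X[n]), Hom(W,X[n]))` (morphisms of left
`A`-modules). -/
def IsCoevalTensor (X Z P : D)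
    (u : ∀ n : ℤ, (Z ⟶ X⟦n⟧) →ₗ[End (X⟦n⟧)] (P ⟶ X⟦n⟧)) : Prop :=
  ∀ (W : D) (φ : ∀ n : ℤ, (Z ⟶ X⟦n⟧) →ₗ[End (X⟦n⟧)] (W ⟶ X⟦n⟧)),
    ∃! g : W ⟶ P, ∀ (n : ℤ) (f : Z ⟶ X⟦n⟧), g ≫ u n f = φ n f

/-- `Z'` is (isomorphic to) `T^*_X Z`: there is a triangle
`Z' ⟶ Z ⟶ RHom(Z,X)^* ⊗_A X ⟶ Z'[1]` whose second map is the coevaluation. -/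
def IsCotwist (X Z Z' : D) : Prop :=
  ∃ (P : D) (u : ∀ n : ℤ, (Z ⟶ X⟦n⟧) →ₗ[End (X⟦n⟧)] (P ⟶ X⟦n⟧)) (p : Z' ⟶ Z)
    (coev : Z ⟶ P) (δ : P ⟶ Z'⟦(1 : ℤ)⟧),
    IsCoevalTensor X Z P u ∧ (∀ (n : ℤ) (f : Z ⟶ X⟦n⟧), coev ≫ u n f = f) ∧
      Triangle.mk p coev δ ∈ distTriang D

/-- The twist `T_X Z` is determined up to isomorphism. -/
theorem IsTwist.unique {X Z Z₁ Z₂ : D} (h₁ : IsTwist X Z Z₁) (h₂ : IsTwist X Z Z₂) :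
    Nonempty (Z₁ ≅ Z₂) := by
  obtain ⟨P, u, ev, i, δ, hu, hev, hT⟩ := h₁
  obtain ⟨P', u', ev', i', δ', hu', hev', hT'⟩ := h₂
  obtain ⟨a, ha, -⟩ := hu P' u'
  obtain ⟨b, hb, -⟩ := hu' P u
  have hab : a ≫ b = 𝟙 P := (hu P u).unique
    (fun n f => by rw [← Category.assoc, ha, hb]) (fun n f => by rw [Category.comp_id])
  have hba : b ≫ a = 𝟙 P' := (hu' P' u').unique
    (fun n f => by rw [← Category.assoc, hb, ha]) (fun n f => by rw [Category.comp_id])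
  have hae : a ≫ ev' = ev := (hu Z (fun _ => LinearMap.id)).unique
    (fun n f => by rw [← Category.assoc, ha, hev']; rfl) (fun n f => by rw [hev]; rfl)
  exact ⟨Triangle.π₃.mapIso (isoTriangleOfIso₁₂ _ _ hT hT' ⟨a, b, hab, hba⟩ (Iso.refl Z)
    (show ev ≫ 𝟙 Z = a ≫ ev' by rw [hae, Category.comp_id]))⟩

/-- The twist `T^*_X Z` is determined up to isomorphism. -/
theorem IsCotwist.unique {X Z Z₁ Z₂ : D} (h₁ : IsCotwist X Z Z₁) (h₂ : IsCotwist X Z Z₂) :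
    Nonempty (Z₁ ≅ Z₂) := by
  obtain ⟨P, u, p, ev, δ, hu, hev, hT⟩ := h₁
  obtain ⟨P', u', p', ev', δ', hu', hev', hT'⟩ := h₂
  obtain ⟨a, ha, -⟩ := hu P' u'
  obtain ⟨b, hb, -⟩ := hu' P u
  have hab : a ≫ b = 𝟙 P' := (hu' P' u').unique
    (fun n f => by rw [Category.assoc, hb, ha]) (fun n f => by rw [Category.id_comp])
  have hba : b ≫ a = 𝟙 P := (hu P u).unique
    (fun n f => by rw [Category.assoc, ha, hb]) (fun n f => by rw [Category.id_comp])
  have hae : ev' ≫ a = ev := (hu Z (fun _ => LinearMap.id)).unique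
    (fun n f => by rw [Category.assoc, ha, hev']; rfl) (fun n f => by rw [hev]; rfl)
  have hT₁ := rot_of_distTriang _ hT
  have hT₂ := rot_of_distTriang _ hT'
  have e : Z₁⟦(1 : ℤ)⟧ ≅ Z₂⟦(1 : ℤ)⟧ :=
    Triangle.π₃.mapIso (isoTriangleOfIso₁₂ _ _ hT₁ hT₂ (Iso.refl Z) ⟨b, a, hba, hab⟩
      (show ev ≫ b = 𝟙 Z ≫ ev' by
        rw [← hae, Category.assoc, hab, Category.comp_id, Category.id_comp]))
  exact ⟨(shiftFunctor D (1 : ℤ)).preimageIso e⟩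

/-- `Z i` is (isomorphic to) `T_X^i A` for every integer `i`, where `T_X^{-n} = (T^*_X)^n` for
`n > 0`. -/
structure IsTwistOrbit (X A : D) (Z : ℤ → D) : Prop where
  zero : Nonempty (Z 0 ≅ A)
  succ (n : ℕ) : IsTwist X (Z n) (Z (n + 1))
  pred (n : ℕ) : IsCotwist X (Z (-n)) (Z (-n - 1))

end Triangulated

/-! ### The bounded derived category -/

section Derived

variable (𝒜 : Type u) [Category.{v} 𝒜] [Abelian 𝒜] [HasDerivedCategory.{w} 𝒜]

/-- The bounded derived category `D^b 𝒜`. -/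
abbrev Db := (DerivedCategory.TStructure.t (C := 𝒜)).bounded.FullSubcategory

variable {𝒜}

theorem bounded_single (A : 𝒜) :
    (DerivedCategory.TStructure.t (C := 𝒜)).bounded
      ((DerivedCategory.singleFunctor 𝒜 0).obj A) :=
  ⟨⟨0, (inferInstance : ((DerivedCategory.singleFunctor 𝒜 0).obj A).IsGE 0)⟩,
    ⟨0, (inferInstance : ((DerivedCategory.singleFunctor 𝒜 0).obj A).IsLE 0)⟩⟩

variable (𝒜) in
/-- The embedding `𝒜 ⥤ D^b 𝒜`, sending `A` to the stalk complex `A[0]`. -/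
noncomputable def stalk : 𝒜 ⥤ Db 𝒜 :=
  ObjectProperty.lift _ (DerivedCategory.singleFunctor 𝒜 0) bounded_single

/-- The subcategory `𝒜[0]` of `D^b 𝒜`. -/
def InDegreeZero (Z : Db 𝒜) : Prop := ∃ B : 𝒜, Nonempty (Z ≅ (stalk 𝒜).obj B)

/-- `T_Y^i A` lies in `𝒜[0]` for all `i ∈ ℤ`. -/
def TwistsInDegreeZero (Y A : 𝒜) : Prop :=
  ∃ Z : ℤ → Db 𝒜, IsTwistOrbit ((stalk 𝒜).obj Y) ((stalk 𝒜).obj A) Z ∧ ∀ i, InDegreeZero (Z i)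

/-- `Hom(A[0],Y[0]) ≠ 0` and `Hom(Y[0],A[0]) = 0`. -/
def MapsOnlyInto (A Y : 𝒜) : Prop :=
  Nontrivial ((stalk 𝒜).obj A ⟶ (stalk 𝒜).obj Y) ∧
    Subsingleton ((stalk 𝒜).obj Y ⟶ (stalk 𝒜).obj A)

/-- `Hom(Y[0],A[0]) ≠ 0` and `Hom(A[0],Y[0]) = 0`. -/
def MapsOnlyFrom (A Y : 𝒜) : Prop :=
  Nontrivial ((stalk 𝒜).obj Y ⟶ (stalk 𝒜).obj A) ∧
    Subsingleton ((stalk 𝒜).obj A ⟶ (stalk 𝒜).obj Y)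

/-- Whenever `A`, `B` are indecomposable, `A` maps nontrivially to `Y` and `Y` maps nontrivially
to `B`, at least one of `A` and `B` lies in the tube of `Y`. -/
def TubeIsExtremal (Y : 𝒜) : Prop :=
  ∀ A B : 𝒜, Indecomposable A → Indecomposable B →
    Nontrivial ((stalk 𝒜).obj A ⟶ (stalk 𝒜).obj Y) →
    Nontrivial ((stalk 𝒜).obj Y ⟶ (stalk 𝒜).obj B) → InTube Y A ∨ InTube Y B

end Derived

end SphericalTube

set_option linter.unusedSectionVars false

/-! All four conditions are shown to be equivalent to one statement: the indecomposable summands of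
`Y` are simple.

A semi-simple endomorphism ring is von Neumann regular, so a nonzero morphism between indecomposable
summands of `Y` is an isomorphism. Thus `Y` is a finite sum of bricks X_a that are pairwise
isomorphic or orthogonal. The isomorphism 𝕊Y ≅ Y[1] matches them up, 𝕊X_a ≅ X_{next a}[1]. An orbit
of `next` spans a spherical summand, so minimality leaves a single orbit of isomorphism classes
(`exists_brickDecomposition`). Serre duality then pairs Ext¹(X_a, A) with Hom(A, X_{next a}), and
Hom(X_a, A) with Ext¹(A, X_{next a}).

If Hom(Y,A) = 0, then RHom(Y,A) sits in degree 1 and T_Y A is a universal extension of an object of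
add Y by A; it always lies in 𝒜. Moreover T_Y^* A is the cocone of the universal map A → P with P in
add Y, and it lies in 𝒜 once that map is epi. Simplicity of the bricks makes it epi
(`eq_zero_of_epi`), and both operations preserve Hom(Y,-) = 0, so the whole orbit stays in 𝒜. The
case Hom(A,Y) = 0 is dual (`eq_zero_of_mono`).

Conversely, a non-simple brick X_j has a proper nonzero subobject K, and with Q = X_j/K one gets
Hom(Y,K) = 0 and Hom(Q,Y) = 0. Along an orbit A_n = (T_Y^*)^n A inside 𝒜 the number dim Hom(A_n, Q)
never grows, and it drops whenever A_n maps nontrivially to X_j. Each step moves the target brick by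
`next`, so this happens infinitely often, which is absurd (`simple_of_isCotwist`; dually
`simple_of_isTwist`). Hence a single orbit inside 𝒜 forces simplicity; this is (a) and (b), and K
and Q themselves are test objects for conditions 3 and 4.

For condition 2, summands of K and Q contradict it when X_j is not simple. If the bricks are simple
and A, C are indecomposables outside the tube, no morphism from a brick to an iterated extension of
bricks factors nontrivially through A, and dually for C (`noPath_of_not_inTube`). This allows ever
longer iterated extensions U of bricks to be built as quotients of A with dim Hom(U,C) unbounded,
although Hom(U,C) embeds in Hom(A,C). -/

namespace SphericalTube

/-! ### Regular elements and idempotents in rings. -/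

section Algebra

/-- A semi-simple ring is von Neumann regular. -/
theorem exists_mul_mul_eq_self_of_isSemisimpleRing {R : Type*} [Ring R] [IsSemisimpleRing R]
    (f : R) : ∃ g : R, f * g * f = f := by
  obtain ⟨C, hC⟩ := exists_isCompl (Submodule.span R {f})
  obtain ⟨a, ha, b, hb, hab⟩ := Submodule.mem_sup.1
    (hC.sup_eq_top ▸ Submodule.mem_top : (1 : R) ∈ Submodule.span R {f} ⊔ C)
  obtain ⟨g, rfl⟩ := Submodule.mem_span_singleton.1 ha
  -- Here 1 = gf + b with b in the complement C of the left ideal Rf, so fb lies both in C and in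
  -- Rf.
  have h : f * b = f - f * (g • f) := by rw [← sub_eq_of_eq_add' hab.symm]; noncomm_ring
  have h0 : f * b = 0 := by
    refine (Submodule.disjoint_def.1 hC.disjoint) _ ?_ (C.smul_mem f hb)
    rw [h]
    exact Submodule.sub_mem _ (Submodule.mem_span_singleton_self f)
      (Submodule.smul_mem _ f ha)
  refine ⟨g, ?_⟩
  rw [h0] at h
  rw [mul_assoc]
  exact (sub_eq_zero.1 h.symm).symm

/-- In a finite-dimensional algebra without nontrivial idempotents, every element is a unit or
nilpotent. -/
theorem isUnit_or_isNilpotent_of_finite {k R : Type*} [Field k] [Ring R] [Algebra k R]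
    [Module.Finite k R] (hR : ∀ e : R, e * e = e → e = 0 ∨ e = 1) (x : R) :
    IsUnit x ∨ IsNilpotent x := by
  open Polynomial in
  have hx : IsIntegral k x := Algebra.IsIntegral.isIntegral x
  obtain ⟨q, hq, hcop⟩ := Polynomial.exists_eq_pow_rootMultiplicity_mul_and_not_dvd
    (minpoly k x) (minpoly.ne_zero hx) 0
  -- The minimal polynomial is X^(a-1) q with q prime to X. The extra 1 keeps a positive when x is
  -- already a unit, so that x^(a-1) can serve in the inverse below.
  set a := rootMultiplicity 0 (minpoly k x) + 1 with ha
  simp only [map_zero, sub_zero] at hq hcop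
  obtain ⟨c, d, hcd⟩ : IsCoprime ((X : k[X]) ^ a) q :=
    IsCoprime.pow_left ((Polynomial.irreducible_X).coprime_iff_not_dvd.2 hcop)
  have h0 : x ^ a * aeval x q = 0 := by
    have := minpoly.aeval k x
    rw [hq, map_mul, map_pow, aeval_X] at this
    rw [ha, pow_succ', mul_assoc, this, mul_zero]
  have h1 : aeval x c * x ^ a + aeval x d * aeval x q = 1 := by
    simpa using congrArg (aeval x) hcd
  have hcomm : ∀ p r : k[X], aeval x p * aeval x r = aeval x r * aeval x p := fun p r => by
    rw [← map_mul, mul_comm, map_mul]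
  have hX : aeval x c * x = x * aeval x c := by simpa using hcomm c X
  -- Fitting idempotent: it and its complement d(x)q(x) have product zero, because x^a q(x) = 0. The
  -- value 0 gives x^a = 0, the value 1 an inverse of x.
  have hidem : (aeval x c * x ^ a) * (aeval x c * x ^ a) = aeval x c * x ^ a := by
    have : aeval x c * x ^ a * (aeval x d * aeval x q) = 0 := by
      rw [hcomm d q, mul_assoc, ← mul_assoc (x ^ a), h0, zero_mul, mul_zero]
    calc _ = aeval x c * x ^ a * (aeval x c * x ^ a + aeval x d * aeval x q) := by
            rw [mul_add, this, add_zero]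
      _ = _ := by rw [h1, mul_one]
  rcases hR _ hidem with h | h
  · right
    refine ⟨a, ?_⟩
    rw [h, zero_add] at h1
    calc x ^ a = x ^ a * (aeval x d * aeval x q) := by rw [h1, mul_one]
      _ = 0 := by rw [hcomm d q, ← mul_assoc, h0, zero_mul]
  · left
    have h2 : aeval x c * x ^ (a - 1) * x = 1 := by
      rw [mul_assoc, ← pow_succ, show a - 1 + 1 = a by omega, h]
    refine isUnit_iff_exists.2 ⟨aeval x c * x ^ (a - 1), ?_, h2⟩
    rw [← mul_assoc, ← hX, mul_assoc, ← pow_succ', pow_succ, ← mul_assoc, h2]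

end Algebra

/-! ### Krull–Schmidt decompositions in abelian categories. -/

section Indecomposables

variable {𝒜 : Type u} [Category.{v} 𝒜] [Abelian 𝒜]

/-- Idempotents in an abelian category split, and so do their complements. -/
theorem exists_iso_biprod_of_idem {A : 𝒜} (e : A ⟶ A) (he : e ≫ e = e) :
    ∃ (Z W : 𝒜) (φ : A ≅ Z ⊞ W), φ.hom ≫ biprod.fst ≫ biprod.inl ≫ φ.inv = e := by
  let i := kernel.ι e
  let j := kernel.ι (𝟙 A - e)
  have hi : i ≫ e = 0 := kernel.condition e
  have hj : j ≫ e = j := by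
    have := kernel.condition (𝟙 A - e)
    rw [Preadditive.comp_sub, Category.comp_id] at this
    exact (sub_eq_zero.1 this).symm
  let p : A ⟶ kernel (𝟙 A - e) := kernel.lift _ e (by simp [he])
  let q : A ⟶ kernel e := kernel.lift _ (𝟙 A - e) (by simp [he])
  have hp : p ≫ j = e := kernel.lift_ι _ _ _
  have hq : q ≫ i = 𝟙 A - e := kernel.lift_ι _ _ _
  have hjp : j ≫ p = 𝟙 _ := by
    rw [← cancel_mono j, Category.assoc, hp, hj, Category.id_comp]
  have hip : i ≫ p = 0 := by
    rw [← cancel_mono j, Category.assoc, hp, hi, zero_comp]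
  have hjq : j ≫ q = 0 := by
    rw [← cancel_mono i, Category.assoc, hq, Preadditive.comp_sub, hj, Category.comp_id, sub_self,
      zero_comp]
  have hiq : i ≫ q = 𝟙 _ := by
    rw [← cancel_mono i, Category.assoc, hq, Preadditive.comp_sub, hi, Category.comp_id, sub_zero,
      Category.id_comp]
  refine ⟨kernel (𝟙 A - e), kernel e, ⟨biprod.lift p q, biprod.desc j i, ?_, ?_⟩, ?_⟩
  · rw [biprod.lift_desc, hp, hq]; abel
  · ext <;> simp [hjp, hip, hjq, hiq]
  · simp [hp]

/-- The idempotent endomorphisms of an indecomposable object are trivial. -/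
theorem idem_eq_zero_or_id {A : 𝒜} (hA : Indecomposable A) (e : A ⟶ A) (he : e ≫ e = e) :
    e = 0 ∨ e = 𝟙 A := by
  obtain ⟨Z, W, φ, hφ⟩ := exists_iso_biprod_of_idem e he
  rcases hA.2 Z W φ with h | h
  · left; rw [← hφ, h.eq_of_tgt (biprod.fst : Z ⊞ W ⟶ Z) 0]; simp
  · right
    have : (biprod.fst : Z ⊞ W ⟶ Z) ≫ biprod.inl = 𝟙 _ := by
      rw [← biprod.total, h.eq_of_tgt (biprod.snd : Z ⊞ W ⟶ W) 0]; simp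
    rw [← hφ, ← Category.assoc biprod.fst, this]; simp

/-- A splitting of `Y` as a finite direct sum of objects `X a`. -/
structure Splitting (Y : 𝒜) where
  J : Type
  [fintype : Fintype J]
  [decEq : DecidableEq J]
  X : J → 𝒜
  ι (a : J) : X a ⟶ Y
  π (a : J) : Y ⟶ X a
  ι_π (a : J) : ι a ≫ π a = 𝟙 (X a)
  ι_π_ne (a b : J) (h : a ≠ b) : ι a ≫ π b = 0
  total : ∑ a, π a ≫ ι a = 𝟙 Y

attribute [instance] Splitting.fintype Splitting.decEq

namespace Splitting

variable {Y : 𝒜} (s : Splitting Y)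

theorem exists_π_ne_zero {Z : 𝒜} {f : Z ⟶ Y} (hf : f ≠ 0) : ∃ a, f ≫ s.π a ≠ 0 := by
  by_contra! h
  apply hf
  rw [← Category.comp_id f, ← s.total, Preadditive.comp_sum]
  exact Finset.sum_eq_zero fun a _ => by rw [← Category.assoc, h, zero_comp]

theorem exists_ι_ne_zero {Z : 𝒜} {f : Y ⟶ Z} (hf : f ≠ 0) : ∃ a, s.ι a ≫ f ≠ 0 := by
  by_contra! h
  apply hf
  rw [← Category.id_comp f, ← s.total, Preadditive.sum_comp]
  exact Finset.sum_eq_zero fun a _ => by rw [Category.assoc, h, comp_zero]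

/-- The splitting of a zero object. -/
def ofIsZero (h : IsZero Y) : Splitting Y where
  J := Empty
  X := Empty.elim
  ι a := a.elim
  π a := a.elim
  ι_π a := a.elim
  ι_π_ne a := a.elim
  total := h.eq_of_src _ _

/-- The splitting of `Y` with one summand. -/
def refl (Y : 𝒜) : Splitting Y where
  J := Unit
  X _ := Y
  ι _ := 𝟙 Y
  π _ := 𝟙 Y
  ι_π _ := by simp
  ι_π_ne a b h := (h rfl).elim
  total := by simp

/-- Splittings of two direct summands combine. -/
noncomputable def biprod {Z W : 𝒜} (φ : Y ≅ Z ⊞ W) (s : Splitting Z) (t : Splitting W) :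
    Splitting Y where
  J := s.J ⊕ t.J
  X := Sum.elim s.X t.X
  ι := fun
    | .inl a => s.ι a ≫ biprod.inl ≫ φ.inv
    | .inr a => t.ι a ≫ biprod.inr ≫ φ.inv
  π := fun
    | .inl a => φ.hom ≫ biprod.fst ≫ s.π a
    | .inr a => φ.hom ≫ biprod.snd ≫ t.π a
  ι_π := by rintro (a | a) <;> simp [s.ι_π, t.ι_π]
  ι_π_ne := by
    rintro (a | a) (b | b) h
    · change (s.ι a ≫ biprod.inl ≫ φ.inv) ≫ φ.hom ≫ biprod.fst ≫ s.π b = 0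
      simpa using s.ι_π_ne a b fun h' => h (h' ▸ rfl)
    · change (s.ι a ≫ biprod.inl ≫ φ.inv) ≫ φ.hom ≫ biprod.snd ≫ t.π b = 0
      simp
    · change (t.ι a ≫ biprod.inr ≫ φ.inv) ≫ φ.hom ≫ biprod.fst ≫ s.π b = 0
      simp
    · change (t.ι a ≫ biprod.inr ≫ φ.inv) ≫ φ.hom ≫ biprod.snd ≫ t.π b = 0
      simpa using t.ι_π_ne a b fun h' => h (h' ▸ rfl)
  total := by
    have h₁ : ∑ a, (φ.hom ≫ biprod.fst ≫ s.π a) ≫ s.ι a ≫ biprod.inl ≫ φ.inv =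
        φ.hom ≫ biprod.fst ≫ (∑ a, s.π a ≫ s.ι a) ≫ biprod.inl ≫ φ.inv := by
      simp [Preadditive.sum_comp, Preadditive.comp_sum]
    have h₂ : ∑ a, (φ.hom ≫ biprod.snd ≫ t.π a) ≫ t.ι a ≫ biprod.inr ≫ φ.inv =
        φ.hom ≫ biprod.snd ≫ (∑ a, t.π a ≫ t.ι a) ≫ biprod.inr ≫ φ.inv := by
      simp [Preadditive.sum_comp, Preadditive.comp_sum]
    rw [Fintype.sum_sum_type]
    refine (congrArg₂ (· + ·) h₁ h₂).trans ?_
    rw [s.total, t.total, Category.id_comp, Category.id_comp, ← Preadditive.comp_add,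
      ← Category.assoc biprod.fst, ← Category.assoc biprod.snd, ← Preadditive.add_comp,
      biprod.total, Category.id_comp, φ.hom_inv_id]

end Splitting

variable {k : Type*} [Field k] [Linear k 𝒜]

/-- Extension by zero embeds End Z in End A and misses the projection to W. This is the measure on
which decomposition into indecomposables terminates. -/
theorem finrank_end_lt_of_iso_biprod {A Z W : 𝒜} [Module.Finite k (A ⟶ A)] (φ : A ≅ Z ⊞ W)
    (hW : ¬ IsZero W) : Module.finrank k (Z ⟶ Z) < Module.finrank k (A ⟶ A) := by
  let T : (Z ⟶ Z) →ₗ[k] (A ⟶ A) :=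
    (Linear.rightComp k A (biprod.inl ≫ φ.inv)).comp (Linear.leftComp k Z (φ.hom ≫ biprod.fst))
  have hT : ∀ f, T f = φ.hom ≫ biprod.fst ≫ f ≫ biprod.inl ≫ φ.inv := fun f => by simp [T]
  have hinj : Function.Injective T := by
    intro f g hfg
    rw [hT, hT] at hfg
    have := congrArg (fun h => biprod.inl ≫ φ.inv ≫ h ≫ φ.hom ≫ biprod.fst) hfg
    simpa using this
  have hne : LinearMap.range T ≠ ⊤ := by
    intro h
    obtain ⟨f, hf⟩ := LinearMap.range_eq_top.1 h (φ.hom ≫ biprod.snd ≫ biprod.inr ≫ φ.inv)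
    apply hW
    rw [IsZero.iff_id_eq_zero]
    have := congrArg (fun h => biprod.inr ≫ φ.inv ≫ h ≫ φ.hom ≫ biprod.snd) hf
    rw [hT] at this
    simpa using this.symm
  rw [← LinearMap.finrank_range_of_inj hinj]
  exact Submodule.finrank_lt hne

/-- In an abelian category with finite-dimensional endomorphism rings every object is a finite
direct sum of indecomposable objects. -/
theorem exists_splitting_indecomposable [hfin : ∀ A : 𝒜, Module.Finite k (A ⟶ A)] (A : 𝒜) :
    ∃ s : Splitting A, ∀ a, Indecomposable (s.X a) := by
  induction hn : Module.finrank k (A ⟶ A) using Nat.strong_induction_on generalizing A with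
  | _ n ih =>
    by_cases h0 : IsZero A
    · exact ⟨.ofIsZero h0, fun a => a.elim⟩
    by_cases hA : Indecomposable A
    · exact ⟨.refl A, fun _ => hA⟩
    obtain ⟨Z, W, φ, hZ, hW⟩ : ∃ (Z W : 𝒜) (_ : A ≅ Z ⊞ W), ¬ IsZero Z ∧ ¬ IsZero W := by
      by_contra! h
      exact hA ⟨h0, fun Z W φ => or_iff_not_imp_left.2 fun hZ => h Z W φ hZ⟩
    obtain ⟨s, hs⟩ := ih _ (hn ▸ finrank_end_lt_of_iso_biprod (k := k) φ hW) Z rfl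
    obtain ⟨t, ht⟩ := ih _ (hn ▸ finrank_end_lt_of_iso_biprod (k := k)
      (φ ≪≫ biprod.braiding Z W) hZ) W rfl
    exact ⟨.biprod φ s t, by rintro (a | a); exacts [hs a, ht a]⟩

/-- An endomorphism of an indecomposable object is an isomorphism or nilpotent. -/
theorem isIso_or_isNilpotent {A : 𝒜} [Module.Finite k (A ⟶ A)] (hA : Indecomposable A)
    (f : End A) : IsIso (f : A ⟶ A) ∨ IsNilpotent f := by
  have : Module.Finite k (End A) := ‹Module.Finite k (A ⟶ A)›
  rcases isUnit_or_isNilpotent_of_finite (k := k) (R := End A)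
    (fun e he => idem_eq_zero_or_id hA e he) f with h | h
  · left; exact (isUnit_iff_isIso f).1 h
  · exact .inr h

end Indecomposables

end SphericalTube

/-! ### Serre duality, exact triangles and the heart. -/

namespace SphericalTube

theorem subsingleton_hom_iff {C : Type*} [Category C] [HasZeroMorphisms C] {A B : C} :
    Subsingleton (A ⟶ B) ↔ ∀ f : A ⟶ B, f = 0 :=
  ⟨fun _ _ => Subsingleton.elim _ _, fun h => ⟨fun f g => (h f).trans (h g).symm⟩⟩

theorem nontrivial_hom_iff {C : Type*} [Category C] [HasZeroMorphisms C] {A B : C} :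
    Nontrivial (A ⟶ B) ↔ ∃ f : A ⟶ B, f ≠ 0 :=
  nontrivial_iff_exists_ne 0

section ShiftedHom

variable {D : Type*} [Category D] [Preadditive D] [HasShift D ℤ]

/-- `Hom(A[n],B) ≅ Hom(A,B[m])` if `n + m = 0`. -/
noncomputable def shiftHomEquiv (n m : ℤ) (h : n + m = 0) (A B : D) :
    (A⟦n⟧ ⟶ B) ≃ (A ⟶ B⟦m⟧) :=
  (shiftEquiv' D n m h).toAdjunction.homEquiv A B

end ShiftedHom

section Serre

variable {k : Type*} [Field k] {D : Type*} [Category D] [Preadditive D] [Linear k D]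
  (S : SerreFunctor k D) {X X' : D} (φ : S.equiv.functor.obj X ≅ X')

include φ in
-- By naturality the functional attached to δ ≫ g takes at u the value of the functional of δ at g ≫
-- u. It is therefore enough to test g against maps to 𝕊X.
theorem SerreFunctor.comp_eq_zero_of_left {V B : D} (δ : X ⟶ V) (g : V ⟶ B)
    (h : ∀ u : B ⟶ X', g ≫ u = 0) : δ ≫ g = 0 := by
  apply (S.duality X B).injective
  ext u
  rw [S.natural_right, map_zero, LinearMap.zero_apply]
  have : g ≫ u = 0 := by
    rw [← cancel_mono φ.hom, Category.assoc, h, zero_comp]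
  rw [this, map_zero]

include φ in
-- Every functional on Hom(A, 𝕊X) comes from some u : X ⟶ A, and its value at f ≫ δ is that of u ≫ f
-- at δ. Vectors are separated by functionals.
theorem SerreFunctor.comp_eq_zero_of_right {A Q : D} (f : A ⟶ Q) (δ : Q ⟶ X')
    (h : ∀ u : X ⟶ A, u ≫ f = 0) : f ≫ δ = 0 := by
  rw [← cancel_mono φ.inv, zero_comp, Category.assoc]
  refine (Module.forall_dual_apply_eq_zero_iff k _).1 fun ξ => ?_
  obtain ⟨u, rfl⟩ := (S.duality X A).surjective ξ
  rw [← S.natural_right, h, map_zero, LinearMap.zero_apply]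

include φ in
theorem SerreFunctor.subsingleton_iff (Z : D) : Subsingleton (X ⟶ Z) ↔ Subsingleton (Z ⟶ X') := by
  rw [subsingleton_hom_iff, subsingleton_hom_iff]
  constructor
  · intro h f
    have := S.comp_eq_zero_of_right φ (𝟙 Z) f fun u => by rw [h u, zero_comp]
    simpa using this
  · intro h f
    have := S.comp_eq_zero_of_left φ f (𝟙 Z) fun u => by rw [h u, comp_zero]
    simpa using this

end Serre

variable {𝒜 : Type u} [Category.{v} 𝒜] [Abelian 𝒜]
  {D : Type*} [Category D] [Preadditive D] [HasZeroObject D] [HasShift D ℤ]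
  [∀ n : ℤ, (shiftFunctor D n).Additive] [Pretriangulated D]

section Triangles

variable {A B C : D} {f : A ⟶ B} {g : B ⟶ C} {h : C ⟶ A⟦(1 : ℤ)⟧}
  (hT : Triangle.mk f g h ∈ distTriang D)

include hT

theorem exists_comp_mor₁ {X : D} (x : X ⟶ B) (hx : x ≫ g = 0) : ∃ y : X ⟶ A, y ≫ f = x := by
  obtain ⟨y, hy⟩ := Triangle.coyoneda_exact₂ _ hT x hx
  exact ⟨y, hy.symm⟩

theorem exists_comp_mor₂ {X : D} (x : X ⟶ C) (hx : x ≫ h = 0) : ∃ y : X ⟶ B, y ≫ g = x := by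
  obtain ⟨y, hy⟩ := Triangle.coyoneda_exact₃ _ hT x hx
  exact ⟨y, hy.symm⟩

theorem exists_mor₃_comp {X : D} (x : C ⟶ X) (hx : g ≫ x = 0) :
    ∃ y : A⟦(1 : ℤ)⟧ ⟶ X, h ≫ y = x := by
  obtain ⟨y, hy⟩ := Triangle.yoneda_exact₃ _ hT x hx
  exact ⟨y, hy.symm⟩

theorem exists_mor₁_comp {X : D} (x : A ⟶ X) (hx : h ≫ x⟦(1 : ℤ)⟧' = 0) :
    ∃ y : B ⟶ X, f ≫ y = x := by
  obtain ⟨y, hy⟩ : ∃ y : B⟦(1 : ℤ)⟧ ⟶ X⟦(1 : ℤ)⟧, x⟦(1 : ℤ)⟧' = (-f⟦(1 : ℤ)⟧') ≫ y :=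
    Triangle.yoneda_exact₂ _ (rot_of_distTriang _ (rot_of_distTriang _ hT)) (x⟦(1 : ℤ)⟧') hx
  refine ⟨-(shiftFunctor D (1 : ℤ)).preimage y, (shiftFunctor D (1 : ℤ)).map_injective ?_⟩
  rw [hy, Preadditive.comp_neg, Functor.map_neg, Functor.map_comp, Functor.map_preimage,
    Preadditive.neg_comp]

/-- On the heart there are no maps from X to C[-1], so this is what makes the first map of a
triangle of stalk objects a monomorphism. -/
theorem exists_factor_shift_neg_one {X : D} (x : X ⟶ A) (hx : x ≫ f = 0) :
    ∃ (y : X ⟶ C⟦(-1 : ℤ)⟧) (m : C⟦(-1 : ℤ)⟧ ⟶ A), y ≫ m = x := by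
  obtain ⟨y, hy⟩ := Triangle.coyoneda_exact₂ _ (inv_rot_of_distTriang _ hT) x hx
  exact ⟨y, _, hy.symm⟩

theorem distinguished_of_iso {A' B' C' : D} (a : A ≅ A') (b : B ≅ B') (c : C ≅ C')
    {f' : A' ⟶ B'} {g' : B' ⟶ C'} {h' : C' ⟶ A'⟦(1 : ℤ)⟧} (hf : a.hom ≫ f' = f ≫ b.hom)
    (hg : b.hom ≫ g' = g ≫ c.hom) (hh : c.hom ≫ h' = h ≫ a.hom⟦(1 : ℤ)⟧') :
    Triangle.mk f' g' h' ∈ distTriang D :=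
  isomorphic_distinguished _ hT _
    (Iso.symm (Triangle.isoMk (Triangle.mk f g h) (Triangle.mk f' g' h') a b c hf.symm hg.symm
      hh.symm))

end Triangles

/-- The properties of the embedding of an abelian category in its bounded derived category which
are used below. -/
structure IsHeartEmbedding (F : 𝒜 ⥤ D) : Prop where
  hom_neg (A B : 𝒜) (n : ℤ) (hn : n < 0) (f : F.obj A ⟶ (F.obj B)⟦n⟧) : f = 0
  exists_triangle (E : ShortComplex 𝒜) (hE : E.ShortExact) :
    ∃ δ : F.obj E.X₃ ⟶ (F.obj E.X₁)⟦(1 : ℤ)⟧, Triangle.mk (F.map E.f) (F.map E.g) δ ∈ distTriang D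
  exists_obj {A B : 𝒜} {Z : D} (f : F.obj A ⟶ Z) (g : Z ⟶ F.obj B)
    (δ : F.obj B ⟶ (F.obj A)⟦(1 : ℤ)⟧) (h : Triangle.mk f g δ ∈ distTriang D) :
    ∃ C : 𝒜, Nonempty (Z ≅ F.obj C)

namespace IsHeartEmbedding

variable {F : 𝒜 ⥤ D} (hF : IsHeartEmbedding F)

include hF

theorem map_eq_zero_of_shift {A B : 𝒜} (f : (F.obj A)⟦(1 : ℤ)⟧ ⟶ F.obj B) : f = 0 := by
  apply (shiftHomEquiv (D := D) 1 (-1) (by norm_num) _ _).injective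
  rw [hF.hom_neg _ _ _ (by norm_num) (shiftHomEquiv _ _ _ _ _ f),
    hF.hom_neg _ _ _ (by norm_num) (shiftHomEquiv _ _ _ _ _ 0)]

variable [F.Full] [F.Faithful] [F.Additive]

/-- A distinguished triangle on objects of the heart is a short exact sequence. -/
theorem shortExact_of_distinguished {A B C : 𝒜} {f : A ⟶ B} {g : B ⟶ C}
    {δ : F.obj C ⟶ (F.obj A)⟦(1 : ℤ)⟧} (h : Triangle.mk (F.map f) (F.map g) δ ∈ distTriang D) :
    ∃ w : f ≫ g = 0, (ShortComplex.mk f g w).ShortExact := by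
  have w : f ≫ g = 0 := F.map_injective (by
    rw [F.map_comp, F.map_zero]; exact comp_distTriang_mor_zero₁₂ _ h)
  have hmono : Mono f := Preadditive.mono_of_cancel_zero f fun {Z} x hx => by
    obtain ⟨y, m, hy⟩ := exists_factor_shift_neg_one h (F.map x)
      (by rw [← F.map_comp, hx, F.map_zero])
    apply F.map_injective
    rw [← hy, F.map_zero, hF.hom_neg _ _ _ (by norm_num) y, zero_comp]
  have hepi : Epi g := Preadditive.epi_of_cancel_zero g fun {Z} x hx => by
    obtain ⟨y, hy⟩ := exists_mor₃_comp h (F.map x) (by rw [← F.map_comp, hx, F.map_zero])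
    apply F.map_injective
    rw [← hy, F.map_zero, hF.map_eq_zero_of_shift y, comp_zero]
  refine ⟨w, { exact := ?_, mono_f := hmono, epi_g := hepi }⟩
  refine ShortComplex.exact_of_f_is_kernel _ (KernelFork.IsLimit.ofι' f w fun {Z} x hx => ?_)
  have := exists_comp_mor₁ h (F.map x) (by rw [← F.map_comp, hx, F.map_zero])
  exact ⟨F.preimage this.choose, F.map_injective (by
    rw [F.map_comp, F.map_preimage]; exact this.choose_spec)⟩

/-- Every class in `Hom(C[0],A[1])` is the class of an extension. -/
theorem exists_extension {A C : 𝒜} (δ : F.obj C ⟶ (F.obj A)⟦(1 : ℤ)⟧) :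
    ∃ (B : 𝒜) (f : A ⟶ B) (g : B ⟶ C) (w : f ≫ g = 0),
      (ShortComplex.mk f g w).ShortExact ∧ Triangle.mk (F.map f) (F.map g) δ ∈ distTriang D := by
  obtain ⟨Z, f, g, h⟩ := distinguished_cocone_triangle₂ δ
  obtain ⟨B, ⟨e⟩⟩ := hF.exists_obj f g δ h
  have h' : Triangle.mk (F.map (F.preimage (f ≫ e.hom))) (F.map (F.preimage (e.inv ≫ g))) δ ∈
      distTriang D :=
    distinguished_of_iso h (Iso.refl _) e (Iso.refl _) (by simp) (by simp) (by simp)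
  obtain ⟨w, hw⟩ := hF.shortExact_of_distinguished h'
  exact ⟨B, _, _, w, hw, h'⟩

end IsHeartEmbedding

end SphericalTube

/-! ### Bricks and the decomposition of a minimal spherical object. -/

namespace SphericalTube

section Bricks

variable {𝒜 : Type u} [Category.{v} 𝒜] [Abelian 𝒜]

/-- A quasi-inverse in End Y, compressed to the two summands, gives g' with f ≫ g' ≫ f = f. Both
composites of f and g' are nonzero idempotents of indecomposables, hence identities. -/
theorem isIso_of_ne_zero_of_regular {Y : 𝒜} (hY : ∀ f : Y ⟶ Y, ∃ g : Y ⟶ Y, f ≫ g ≫ f = f)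
    (s : Splitting Y) {a b : s.J} (ha : Indecomposable (s.X a)) (hb : Indecomposable (s.X b))
    (f : s.X a ⟶ s.X b) (hf : f ≠ 0) : IsIso f := by
  obtain ⟨g, hg⟩ := hY (s.π a ≫ f ≫ s.ι b)
  have h : f ≫ (s.ι b ≫ g ≫ s.π a) ≫ f = f := by
    have := congrArg (fun x => s.ι a ≫ x ≫ s.π b) hg
    simpa only [Category.assoc, s.ι_π, Category.comp_id, reassoc_of% (s.ι_π a)] using this
  generalize s.ι b ≫ g ≫ s.π a = g' at h
  have h₁ : f ≫ g' = 𝟙 _ := by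
    refine (idem_eq_zero_or_id ha (f ≫ g') ?_).resolve_left fun h0 => hf ?_
    · simpa only [Category.assoc] using congrArg (fun x => x ≫ g') h
    · rw [← h, ← Category.assoc, h0, zero_comp]
  have h₂ : g' ≫ f = 𝟙 _ := by
    refine (idem_eq_zero_or_id hb (g' ≫ f) ?_).resolve_left fun h0 => hf ?_
    · simpa only [Category.assoc] using congrArg (fun x => g' ≫ x) h
    · rw [← h, h0, comp_zero]
  exact ⟨g', h₁, h₂⟩

namespace Splitting

variable {Y : 𝒜} (s : Splitting Y)

theorem hom_ext_map {C : Type*} [Category C] [Preadditive C] {G H : 𝒜 ⥤ C} [G.Additive]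
    [H.Additive] {f g : G.obj Y ⟶ H.obj Y}
    (h : ∀ a b, G.map (s.ι a) ≫ f ≫ H.map (s.π b) = G.map (s.ι a) ≫ g ≫ H.map (s.π b)) :
    f = g := by
  have key : ∀ x : G.obj Y ⟶ H.obj Y, x = ∑ a, ∑ b, G.map (s.π a) ≫
      (G.map (s.ι a) ≫ x ≫ H.map (s.π b)) ≫ H.map (s.ι b) := fun x => by
    have h₁ : ∑ b, H.map (s.π b) ≫ H.map (s.ι b) = 𝟙 _ := by
      simp_rw [← H.map_comp]; rw [← H.map_sum, s.total, H.map_id]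
    have h₂ : ∑ b, G.map (s.π b) ≫ G.map (s.ι b) = 𝟙 _ := by
      simp_rw [← G.map_comp]; rw [← G.map_sum, s.total, G.map_id]
    simp_rw [Category.assoc, ← Preadditive.comp_sum, h₁, Category.comp_id,
      ← Category.assoc, ← Preadditive.sum_comp, h₂, Category.id_comp]
  rw [key f, key g]
  simp_rw [h]

open Classical in
/-- The idempotent of `Y` with image the direct sum of the `X a`, `a ∈ O`. -/
noncomputable def proj (O : Set s.J) : Y ⟶ Y :=
  ∑ a ∈ Finset.univ.filter (· ∈ O), s.π a ≫ s.ι a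

theorem ι_proj_of_mem {O : Set s.J} {a : s.J} (ha : a ∈ O) : s.ι a ≫ s.proj O = s.ι a := by
  classical
  rw [proj, Preadditive.comp_sum, Finset.sum_eq_single a]
  · rw [← Category.assoc, s.ι_π, Category.id_comp]
  · intro b _ hb
    rw [← Category.assoc, s.ι_π_ne a b (Ne.symm hb), zero_comp]
  · intro h
    exact (h (by simpa using ha)).elim

theorem ι_proj_of_notMem {O : Set s.J} {a : s.J} (ha : a ∉ O) : s.ι a ≫ s.proj O = 0 := by
  classical
  rw [proj, Preadditive.comp_sum]
  refine Finset.sum_eq_zero fun b hb => ?_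
  have : a ≠ b := by rintro rfl; exact ha (by simpa using hb)
  rw [← Category.assoc, s.ι_π_ne a b this, zero_comp]

theorem proj_π_of_mem {O : Set s.J} {a : s.J} (ha : a ∈ O) : s.proj O ≫ s.π a = s.π a := by
  classical
  rw [proj, Preadditive.sum_comp, Finset.sum_eq_single a]
  · rw [Category.assoc, s.ι_π, Category.comp_id]
  · intro b _ hb
    rw [Category.assoc, s.ι_π_ne b a hb, comp_zero]
  · intro h
    exact (h (by simpa using ha)).elim

theorem proj_π_of_notMem {O : Set s.J} {a : s.J} (ha : a ∉ O) : s.proj O ≫ s.π a = 0 := by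
  classical
  rw [proj, Preadditive.sum_comp]
  refine Finset.sum_eq_zero fun b hb => ?_
  have : b ≠ a := by rintro rfl; exact ha (by simpa using hb)
  rw [Category.assoc, s.ι_π_ne b a this, comp_zero]

theorem proj_comp_proj (O : Set s.J) : s.proj O ≫ s.proj O = s.proj O := by
  classical
  conv_lhs => enter [1]; rw [proj]
  rw [Preadditive.sum_comp]
  refine Finset.sum_congr rfl fun a ha => ?_
  rw [Category.assoc, s.ι_proj_of_mem (by simpa using ha)]

/-- A morphism with no components between the two parts of a splitting commutes with the
projection. -/
theorem map_proj_comm {C : Type*} [Category C] [Preadditive C] {G H : 𝒜 ⥤ C} [G.Additive]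
    [H.Additive] (O : Set s.J) (f : G.obj Y ⟶ H.obj Y)
    (h : ∀ a b, G.map (s.ι a) ≫ f ≫ H.map (s.π b) ≠ 0 → (a ∈ O ↔ b ∈ O)) :
    G.map (s.proj O) ≫ f = f ≫ H.map (s.proj O) := by
  apply s.hom_ext_map
  intro a b
  have e₁ : G.map (s.ι a) ≫ (G.map (s.proj O) ≫ f) ≫ H.map (s.π b) =
      G.map (s.ι a ≫ s.proj O) ≫ f ≫ H.map (s.π b) := by simp
  have e₂ : G.map (s.ι a) ≫ (f ≫ H.map (s.proj O)) ≫ H.map (s.π b) =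
      G.map (s.ι a) ≫ f ≫ H.map (s.proj O ≫ s.π b) := by simp
  rw [e₁, e₂]
  by_cases h0 : G.map (s.ι a) ≫ f ≫ H.map (s.π b) = 0
  · by_cases ha : a ∈ O <;> by_cases hb : b ∈ O <;>
      simp [s.ι_proj_of_mem, s.ι_proj_of_notMem, s.proj_π_of_mem, s.proj_π_of_notMem, ha, hb, h0]
  · by_cases ha : a ∈ O
    · rw [s.ι_proj_of_mem ha, s.proj_π_of_mem ((h a b h0).1 ha)]
    · rw [s.ι_proj_of_notMem ha, s.proj_π_of_notMem (fun hb => ha ((h a b h0).2 hb)),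
        G.map_zero, H.map_zero, zero_comp, comp_zero, comp_zero]

variable (hbrick : ∀ (a b) (f : s.X a ⟶ s.X b), f ≠ 0 → IsIso f)
  (hne : ∀ a, ¬ IsZero (s.X a))

include hbrick hne in
/-- An isomorphism between the images of `Y` under two fully faithful functors matches the
summands up to isomorphism. -/
theorem exists_iso_of_iso {C : Type*} [Category C] [Preadditive C] {G H : 𝒜 ⥤ C} [G.Additive]
    [H.Additive] [G.Full] [G.Faithful] [H.Full] [H.Faithful] (φ : G.obj Y ≅ H.obj Y) (a : s.J) :
    ∃ b, Nonempty (G.obj (s.X a) ≅ H.obj (s.X b)) := by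
  have hiso : ∀ (a b : s.J) (f : s.X a ⟶ s.X b), f ≠ 0 → IsIso f := hbrick
  -- The identity of the a-th summand is the sum over b of its passages through the b-th summand of
  -- the target, so one passage is nonzero; bricks make it invertible.
  obtain ⟨b, hb⟩ : ∃ b, (G.map (s.ι a) ≫ φ.hom ≫ H.map (s.π b)) ≫
      (H.map (s.ι b) ≫ φ.inv ≫ G.map (s.π a)) ≠ 0 := by
    by_contra! h
    apply hne a
    rw [IsZero.iff_id_eq_zero]
    apply G.map_injective
    rw [G.map_zero, ← s.ι_π a, G.map_comp, ← Category.id_comp (G.map (s.π a)), ← φ.hom_inv_id,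
      ← Category.comp_id φ.hom, ← H.map_id, ← s.total, H.map_sum]
    simp only [Preadditive.sum_comp, Preadditive.comp_sum, H.map_comp]
    refine Finset.sum_eq_zero fun b _ => ?_
    simpa only [Category.assoc] using h b
  generalize G.map (s.ι a) ≫ φ.hom ≫ H.map (s.π b) = u at hb
  generalize H.map (s.ι b) ≫ φ.inv ≫ G.map (s.π a) = v at hb
  have h₁ : IsIso (u ≫ v) := by
    obtain ⟨f, hf⟩ := G.map_surjective (u ≫ v)
    have : IsIso f := hiso _ _ f (by rintro rfl; exact hb (by rw [← hf, G.map_zero]))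
    rw [← hf]; infer_instance
  have h₂ : v ≫ u ≠ 0 := fun h0 => hb (by
    rw [← cancel_epi (u ≫ v), comp_zero, Category.assoc, ← Category.assoc v, h0, zero_comp,
      comp_zero])
  have h₃ : IsIso (v ≫ u) := by
    obtain ⟨f, hf⟩ := H.map_surjective (v ≫ u)
    have : IsIso f := hiso _ _ f (by rintro rfl; exact h₂ (by rw [← hf, H.map_zero]))
    rw [← hf]; infer_instance
  have e₁ : u ≫ v ≫ inv (u ≫ v) = 𝟙 _ := by rw [← Category.assoc, IsIso.hom_inv_id]
  have e₂ : (inv (v ≫ u) ≫ v) ≫ u = 𝟙 _ := by rw [Category.assoc, IsIso.inv_hom_id]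
  have e₃ : inv (v ≫ u) ≫ v = v ≫ inv (u ≫ v) := by
    rw [← Category.comp_id (inv (v ≫ u) ≫ v), ← e₁, ← Category.assoc, e₂, Category.id_comp]
  exact ⟨b, ⟨⟨u, v ≫ inv (u ≫ v), e₁, by rw [← e₃, e₂]⟩⟩⟩

end Splitting

end Bricks

variable {k : Type*} [Field k] {𝒜 : Type u} [Category.{v} 𝒜] [Abelian 𝒜]
  {D : Type*} [Category D] [Preadditive D] [Linear k D]

instance (S : SerreFunctor k D) : S.equiv.functor.Additive := S.additive

variable [HasZeroObject D] [HasShift D ℤ]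
  [∀ n : ℤ, (shiftFunctor D n).Additive] [Pretriangulated D]

/-- A splitting of `Y` into pairwise isomorphic or orthogonal bricks, permuted transitively by the
Serre functor (up to a shift). -/
structure BrickDecomposition (F : 𝒜 ⥤ D) (S : SerreFunctor k D) (Y : 𝒜) extends Splitting Y where
  isIso_of_ne_zero {a b : J} (f : X a ⟶ X b) (hf : f ≠ 0) : IsIso f
  not_isZero (a : J) : ¬ IsZero (X a)
  next : J → J
  serre (a : J) : S.equiv.functor.obj (F.obj (X a)) ≅ (F.obj (X (next a)))⟦(1 : ℤ)⟧
  transitive (a b : J) : ∃ m : ℕ, Nonempty (X (next^[m] a) ≅ X b)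

/-- Centrality of the idempotent r ≫ i makes compression to Z a surjective ring homomorphism, so
semi-simplicity descends. Compatibility with φ lets the isomorphism 𝕊Y ≅ Y[1] restrict to Z. -/
theorem isGeneralizedSpherical_of_retract {F : 𝒜 ⥤ D} [F.Full] [F.Faithful]
    {S : SerreFunctor k D} {Y Z : 𝒜} (hY : IsGeneralizedSpherical S 1 (F.obj Y)) (i : Z ⟶ Y)
    (r : Y ⟶ Z) (hir : i ≫ r = 𝟙 Z) (hcomm : ∀ f : Y ⟶ Y, (r ≫ i) ≫ f = f ≫ r ≫ i)
    (φ : S.equiv.functor.obj (F.obj Y) ≅ (F.obj Y)⟦(1 : ℤ)⟧)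
    (hφ : S.equiv.functor.map (F.map (r ≫ i)) ≫ φ.hom = φ.hom ≫ (F.map (r ≫ i))⟦(1 : ℤ)⟧') :
    IsGeneralizedSpherical S 1 (F.obj Z) where
  hom_shift_eq_zero n h₀ h₁ := by
    rw [subsingleton_hom_iff]
    intro f
    have := hY.hom_shift_eq_zero n h₀ h₁
    have h : f = F.map i ≫ (F.map r ≫ f ≫ (F.map i)⟦n⟧') ≫ (F.map r)⟦n⟧' := by
      simp only [Category.assoc, ← Functor.map_comp, hir]
      rw [F.map_id, CategoryTheory.Functor.map_id, Category.comp_id, ← Category.assoc,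
        ← F.map_comp, hir, F.map_id, Category.id_comp]
    rw [h, Subsingleton.elim (F.map r ≫ f ≫ (F.map i)⟦n⟧') 0, zero_comp, comp_zero]
  end_semisimple := by
    have := hY.end_semisimple
    have hi : F.map i ≫ F.map r = 𝟙 _ := by rw [← F.map_comp, hir, F.map_id]
    have hc : ∀ f : F.obj Y ⟶ F.obj Y, F.map r ≫ F.map i ≫ f = f ≫ F.map r ≫ F.map i := fun f => by
      obtain ⟨f, rfl⟩ := F.map_surjective f
      simpa only [F.map_comp, Category.assoc] using congrArg F.map (hcomm f)
    let T : End (F.obj Y) →+* End (F.obj Z) :=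
      { toFun := fun f => F.map i ≫ f ≫ F.map r
        map_one' := by
          change F.map i ≫ 𝟙 _ ≫ F.map r = 𝟙 _
          rw [Category.id_comp, hi]
        map_mul' := fun f g => by
          change F.map i ≫ (g ≫ f) ≫ F.map r = (F.map i ≫ g ≫ F.map r) ≫ F.map i ≫ f ≫ F.map r
          have h : F.map i ≫ F.map r ≫ F.map i = F.map i := by
            rw [← Category.assoc, hi, Category.id_comp]
          calc _ = (F.map i ≫ F.map r ≫ F.map i) ≫ g ≫ f ≫ F.map r := by
                rw [h]; simp only [Category.assoc]
            _ = F.map i ≫ (F.map r ≫ F.map i ≫ g) ≫ f ≫ F.map r := by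
                simp only [Category.assoc]
            _ = _ := by rw [hc g]; simp only [Category.assoc]
        map_zero' := by
          change F.map i ≫ (0 : F.obj Y ⟶ F.obj Y) ≫ F.map r = 0
          simp
        map_add' := fun f g => by
          change F.map i ≫ ((f : F.obj Y ⟶ F.obj Y) + g) ≫ F.map r = _
          rw [Preadditive.add_comp, Preadditive.comp_add] }
    refine T.isSemisimpleRing_of_surjective fun f => ⟨F.map r ≫ f ≫ F.map i, ?_⟩
    change F.map i ≫ (F.map r ≫ f ≫ F.map i) ≫ F.map r = f
    simp only [Category.assoc, hi]
    rw [← Category.assoc, hi, Category.id_comp, Category.comp_id]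
  serre_iso := by
    let G := S.equiv.functor
    have hi : F.map i ≫ F.map r = 𝟙 _ := by rw [← F.map_comp, hir, F.map_id]
    have hφ' : (F.map (r ≫ i))⟦(1 : ℤ)⟧' ≫ φ.inv = φ.inv ≫ G.map (F.map (r ≫ i)) := by
      rw [← cancel_epi φ.hom, ← Category.assoc, ← hφ, Category.assoc, φ.hom_inv_id,
        Category.comp_id, φ.hom_inv_id_assoc]
    have h : i ≫ r ≫ i = i := by rw [← Category.assoc, hir, Category.id_comp]
    refine ⟨⟨G.map (F.map i) ≫ φ.hom ≫ (F.map r)⟦(1 : ℤ)⟧',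
      (F.map i)⟦(1 : ℤ)⟧' ≫ φ.inv ≫ G.map (F.map r), ?_, ?_⟩⟩
    · calc _ = G.map (F.map i) ≫ (φ.hom ≫ (F.map (r ≫ i))⟦(1 : ℤ)⟧') ≫ φ.inv ≫
            G.map (F.map r) := by simp only [Category.assoc, Functor.map_comp]
        _ = G.map (F.map (i ≫ (r ≫ i) ≫ r)) := by
            rw [← hφ]; simp only [G, Category.assoc, Functor.map_comp, φ.hom_inv_id_assoc]
        _ = _ := by
            rw [Category.assoc, hir, Category.comp_id, hir, F.map_id, G.map_id]
    · calc _ = (F.map i)⟦(1 : ℤ)⟧' ≫ (φ.inv ≫ G.map (F.map (r ≫ i))) ≫ φ.hom ≫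
            (F.map r)⟦(1 : ℤ)⟧' := by simp only [Category.assoc, Functor.map_comp]
        _ = (F.map (i ≫ (r ≫ i) ≫ r))⟦(1 : ℤ)⟧' := by
            rw [← hφ']; simp only [Category.assoc, Functor.map_comp, φ.inv_hom_id_assoc]
        _ = _ := by
            rw [Category.assoc, hir, Category.comp_id, hir, F.map_id]
            exact CategoryTheory.Functor.map_id _ _

section

variable {F : 𝒜 ⥤ D} [F.Full] [F.Faithful] {S : SerreFunctor k D} {Y : 𝒜}

theorem exists_regular_of_end_semisimple (h : IsSemisimpleRing (End (F.obj Y))) (f : Y ⟶ Y) :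
    ∃ g : Y ⟶ Y, f ≫ g ≫ f = f := by
  obtain ⟨g, hg⟩ := exists_mul_mul_eq_self_of_isSemisimpleRing (R := End (F.obj Y)) (F.map f)
  refine ⟨F.preimage g, F.map_injective ?_⟩
  rw [F.map_comp, F.map_comp, F.map_preimage]
  exact hg

variable [F.Additive] [Linear k 𝒜] [∀ A : 𝒜, Module.Finite k (A ⟶ A)]

/-- A minimal 1-spherical object decomposes into bricks permuted transitively by the Serre
functor. -/
theorem exists_brickDecomposition (hY : IsMinimalSpherical S 1 (F.obj Y)) :
    Nonempty (BrickDecomposition F S Y) := by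
  obtain ⟨s, hs⟩ := exists_splitting_indecomposable (k := k) Y
  have hbrick : ∀ (a b) (f : s.X a ⟶ s.X b), f ≠ 0 → IsIso f := fun a b =>
    isIso_of_ne_zero_of_regular (exists_regular_of_end_semisimple hY.spherical.end_semisimple) s
      (hs a) (hs b)
  have hne : ∀ a, ¬ IsZero (s.X a) := fun a => (hs a).1
  obtain ⟨φ⟩ := hY.spherical.serre_iso
  let G : 𝒜 ⥤ D := F ⋙ S.equiv.functor
  let H : 𝒜 ⥤ D := F ⋙ shiftFunctor D (1 : ℤ)
  have hnext := s.exists_iso_of_iso hbrick hne (G := G) (H := H) φ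
  choose next hnext using hnext
  let e : ∀ a, G.obj (s.X a) ≅ H.obj (s.X (next a)) := fun a => (hnext a).some
  -- Thus `next` is well defined and injective on isomorphism classes of bricks.
  have hiso : ∀ a b, Nonempty (s.X a ≅ s.X b) ↔ Nonempty (s.X (next a) ≅ s.X (next b)) :=
    fun a b => ⟨fun ⟨f⟩ => ⟨H.preimageIso ((e a).symm ≪≫ G.mapIso f ≪≫ e b)⟩,
      fun ⟨f⟩ => ⟨G.preimageIso (e a ≪≫ H.mapIso f ≪≫ (e b).symm)⟩⟩
  have hiter : ∀ (m : ℕ) (a b), Nonempty (s.X (next^[m] a) ≅ s.X (next^[m] b)) →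
      Nonempty (s.X a ≅ s.X b) := by
    intro m
    induction m with
    | zero => exact fun a b h => h
    | succ m ih => exact fun a b h => (hiso a b).2 (ih _ _ h)
  refine ⟨{ s with
    isIso_of_ne_zero := fun f hf => hbrick _ _ f hf
    not_isZero := hne
    next := next
    serre := e
    transitive := fun a₀ => ?_ }⟩
  let O : Set s.J := {b | ∃ m : ℕ, Nonempty (s.X (next^[m] a₀) ≅ s.X b)}
  -- Pigeonhole and injectivity make the class of X a₀ periodic. The forward orbit O is therefore
  -- also closed under going back along `next`.
  obtain ⟨p, hp⟩ : ∃ p : ℕ, Nonempty (s.X a₀ ≅ s.X (next^[p + 1] a₀)) := by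
    obtain ⟨i, j, hij, h⟩ : ∃ i j : ℕ, i < j ∧ next^[i] a₀ = next^[j] a₀ := by
      obtain ⟨i, j, hij, h⟩ := Finite.exists_ne_map_eq_of_infinite (fun m : ℕ => next^[m] a₀)
      rcases lt_or_gt_of_ne hij with h' | h'
      exacts [⟨i, j, h', h⟩, ⟨j, i, h', h.symm⟩]
    obtain ⟨p, rfl⟩ := Nat.exists_eq_add_of_lt hij
    refine ⟨p, hiter i _ _ ?_⟩
    rw [← Function.iterate_add_apply, ← add_assoc, ← h]
    exact ⟨Iso.refl _⟩
  have hO : ∀ b, b ∈ O ↔ next b ∈ O := by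
    intro b
    constructor
    · rintro ⟨m, hm⟩
      refine ⟨m + 1, ?_⟩
      rw [Function.iterate_succ_apply']
      exact (hiso _ _).1 hm
    · rintro ⟨m, ⟨hm⟩⟩
      rcases m with _ | m
      · refine ⟨p, (hiso _ _).2 ?_⟩
        rw [← Function.iterate_succ_apply' next]
        exact ⟨hp.some.symm ≪≫ hm⟩
      · refine ⟨m, (hiso _ _).2 ?_⟩
        rw [← Function.iterate_succ_apply' next]
        exact ⟨hm⟩
  have hOiso : ∀ a b, Nonempty (s.X a ≅ s.X b) → (a ∈ O ↔ b ∈ O) := fun a b ⟨f⟩ =>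
    ⟨fun ⟨m, ⟨h⟩⟩ => ⟨m, ⟨h ≪≫ f⟩⟩, fun ⟨m, ⟨h⟩⟩ => ⟨m, ⟨h ≪≫ f.symm⟩⟩⟩
  obtain ⟨Z, W, ψ, hψ⟩ := exists_iso_biprod_of_idem (s.proj O) (s.proj_comp_proj O)
  have hri : (ψ.hom ≫ biprod.fst) ≫ biprod.inl ≫ ψ.inv = s.proj O := by
    rw [Category.assoc, hψ]
  -- A nonzero map between bricks is an isomorphism and O is closed under isomorphism, so no map
  -- mixes the two parts. As O is stable under `next` in both directions, φ does not mix them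
  -- either.
  have hZ : IsGeneralizedSpherical S 1 (F.obj Z) := by
    refine isGeneralizedSpherical_of_retract hY.spherical (biprod.inl ≫ ψ.inv)
      (ψ.hom ≫ biprod.fst) (by simp) ?_ φ ?_
    · intro f
      rw [hri]
      refine s.map_proj_comm (G := 𝟭 𝒜) (H := 𝟭 𝒜) O f fun a b h => hOiso a b ?_
      have := hbrick a b (s.ι a ≫ f ≫ s.π b) h
      exact ⟨asIso (s.ι a ≫ f ≫ s.π b)⟩
    · rw [hri]
      refine s.map_proj_comm (G := G) (H := H) O φ.hom fun a b h => (hO a).trans (hOiso _ _ ?_)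
      let f := H.preimage ((e a).inv ≫ G.map (s.ι a) ≫ φ.hom ≫ H.map (s.π b))
      have hf : f ≠ 0 := fun h0 => by
        apply h
        rw [← cancel_epi (e a).inv, comp_zero, ← H.map_zero, ← h0, H.map_preimage]
      have := hbrick _ _ f hf
      exact ⟨asIso f⟩
  have hzero : ∀ {A : 𝒜}, IsZero (F.obj A) → IsZero A := fun h => by
    rw [IsZero.iff_id_eq_zero]
    exact F.map_injective (h.eq_of_src _ _)
  intro b
  change b ∈ O
  by_contra hb
  have := preservesBinaryBiproducts_of_preservesBiproducts F
  rcases hY.minimal (F.obj Z) (F.obj W) (F.mapIso ψ ≪≫ F.mapBiprod Z W) hZ with h | h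
  · apply hne a₀
    rw [IsZero.iff_id_eq_zero, ← s.ι_π a₀,
      ← s.ι_proj_of_mem (O := O) (a := a₀) ⟨0, ⟨Iso.refl _⟩⟩, ← hri,
      (hzero h).eq_of_src (biprod.inl ≫ ψ.inv : Z ⟶ Y) 0]
    simp
  · apply hne b
    have h1 : s.proj O = 𝟙 Y := by
      have : (biprod.fst : Z ⊞ W ⟶ Z) ≫ biprod.inl = 𝟙 _ := by
        rw [← biprod.total, (hzero h).eq_of_tgt (biprod.snd : Z ⊞ W ⟶ W) 0]; simp
      rw [← hψ, ← Category.assoc biprod.fst, this]; simp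
    have h2 := s.ι_proj_of_notMem hb
    rw [h1, Category.comp_id] at h2
    rw [IsZero.iff_id_eq_zero, ← s.ι_π b, h2, zero_comp]

end

end SphericalTube

/-! ### The additive closure of an object and twists as cones of universal maps. -/

namespace SphericalTube

section InAdd

variable {C : Type*} [Category C] [Preadditive C]

/-- `P` is a direct summand of a finite direct sum of copies of `X`. -/
def InAdd (X P : C) : Prop :=
  ∃ (n : ℕ) (ι : Fin n → (P ⟶ X)) (ρ : Fin n → (X ⟶ P)), 𝟙 P = ∑ a, ι a ≫ ρ a

theorem InAdd.map {X P : C} (h : InAdd X P) {C' : Type*} [Category C'] [Preadditive C']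
    (G : C ⥤ C') [G.Additive] : InAdd (G.obj X) (G.obj P) := by
  obtain ⟨n, ι, ρ, h⟩ := h
  refine ⟨n, fun a => G.map (ι a), fun a => G.map (ρ a), ?_⟩
  simp_rw [← G.map_comp]
  rw [← G.map_sum, ← h, G.map_id]

theorem InAdd.of_retract {X P P' : C} (h : InAdd X P) (i : P' ⟶ P) (r : P ⟶ P')
    (hir : i ≫ r = 𝟙 P') : InAdd X P' := by
  obtain ⟨n, ι, ρ, h⟩ := h
  refine ⟨n, fun a => i ≫ ι a, fun a => ρ a ≫ r, ?_⟩
  calc 𝟙 P' = i ≫ 𝟙 P ≫ r := by rw [Category.id_comp, hir]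
    _ = _ := by rw [h]; simp only [Preadditive.comp_sum, Preadditive.sum_comp, Category.assoc]

theorem InAdd.exists_comp_ne_zero {X P Z : C} (h : InAdd X P) {f : P ⟶ Z} (hf : f ≠ 0) :
    ∃ ρ : X ⟶ P, ρ ≫ f ≠ 0 := by
  obtain ⟨n, ι, ρ, h⟩ := h
  by_contra! h0
  apply hf
  rw [← Category.id_comp f, h, Preadditive.sum_comp]
  exact Finset.sum_eq_zero fun a _ => by rw [Category.assoc, h0, comp_zero]

theorem InAdd.exists_comp_ne_zero' {X P Z : C} (h : InAdd X P) {f : Z ⟶ P} (hf : f ≠ 0) :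
    ∃ ι : P ⟶ X, f ≫ ι ≠ 0 := by
  obtain ⟨n, ι, ρ, h⟩ := h
  by_contra! h0
  apply hf
  rw [← Category.comp_id f, h, Preadditive.comp_sum]
  exact Finset.sum_eq_zero fun a _ => by rw [← Category.assoc, h0, zero_comp]

theorem inAdd_biproduct [HasFiniteBiproducts C] (X : C) (n : ℕ) : InAdd X (⨁ fun _ : Fin n => X) :=
  ⟨n, biproduct.π _, biproduct.ι _, biproduct.total.symm⟩

end InAdd

section Complement

variable {𝒜 : Type u} [Category.{v} 𝒜] [Abelian 𝒜]

/-- The complement of a split epimorphism. -/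
theorem exists_complement {P X : 𝒜} (f : P ⟶ X) (s : X ⟶ P) (h : s ≫ f = 𝟙 X) :
    ∃ (P' : 𝒜) (i : P' ⟶ P) (r : P ⟶ P'), i ≫ r = 𝟙 P' ∧ f ≫ s + r ≫ i = 𝟙 P ∧ i ≫ f = 0 ∧
      s ≫ r = 0 := by
  have hr : kernel.lift f (𝟙 P - f ≫ s) (by simp [h]) ≫ kernel.ι f = 𝟙 P - f ≫ s :=
    kernel.lift_ι _ _ _
  refine ⟨kernel f, kernel.ι f, kernel.lift f (𝟙 P - f ≫ s) (by simp [h]), ?_, ?_,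
    kernel.condition f, ?_⟩
  · rw [← cancel_mono (kernel.ι f), Category.assoc, hr]
    simp
  · rw [hr]; abel
  · rw [← cancel_mono (kernel.ι f), Category.assoc, hr]
    simp [reassoc_of% h]

variable {k : Type*} [Field k] [Linear k 𝒜] {P P' X Z : 𝒜} {i : P' ⟶ P} {r : P ⟶ P'}
  (hir : i ≫ r = 𝟙 P')

include hir

theorem finrank_hom_lt_of_retract [Module.Finite k (P ⟶ Z)] {s : X ⟶ P} (hsr : s ≫ r = 0)
    {x : P ⟶ Z} (hx : s ≫ x ≠ 0) : Module.finrank k (P' ⟶ Z) < Module.finrank k (P ⟶ Z) := by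
  let T : (P' ⟶ Z) →ₗ[k] (P ⟶ Z) := Linear.leftComp k Z r
  have hT : Function.Injective T := fun x y hxy => by
    have : i ≫ r ≫ x = i ≫ r ≫ y := congrArg (i ≫ ·) hxy
    simpa only [← Category.assoc, hir, Category.id_comp] using this
  rw [← LinearMap.finrank_range_of_inj hT]
  refine Submodule.finrank_lt fun htop => ?_
  obtain ⟨y, rfl⟩ := LinearMap.range_eq_top.1 htop x
  exact hx (by rw [show T y = r ≫ y from rfl, ← Category.assoc, hsr, zero_comp])

theorem finrank_hom_lt_of_retract' [Module.Finite k (Z ⟶ P)] {f : P ⟶ X} (hif : i ≫ f = 0)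
    {x : Z ⟶ P} (hx : x ≫ f ≠ 0) : Module.finrank k (Z ⟶ P') < Module.finrank k (Z ⟶ P) := by
  let T : (Z ⟶ P') →ₗ[k] (Z ⟶ P) := Linear.rightComp k Z i
  have hT : Function.Injective T := fun x y hxy => by
    have : (x ≫ i) ≫ r = (y ≫ i) ≫ r := congrArg (· ≫ r) hxy
    simpa only [Category.assoc, hir, Category.comp_id] using this
  rw [← LinearMap.finrank_range_of_inj hT]
  refine Submodule.finrank_lt fun htop => ?_
  obtain ⟨y, rfl⟩ := LinearMap.range_eq_top.1 htop x
  exact hx (by rw [show T y = y ≫ i from rfl, Category.assoc, hif, comp_zero])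

end Complement

section Twists

variable {D : Type*} [Category D] [Preadditive D] [HasZeroObject D] [HasShift D ℤ]
  [∀ n : ℤ, (shiftFunctor D n).Additive] [Pretriangulated D]

/-- When the maps from Z to shifts of X live in one degree m, the coevaluation target is an object Q
of add X[m] through which all maps Z ⟶ X[m] factor uniquely. A map into Q is rebuilt from its values
on the finitely many coordinates c ≫ ι a. -/
theorem isCotwist_of_bijective {X Z Q Z' : D} (m : ℤ) (hQ : InAdd (X⟦m⟧) Q) (c : Z ⟶ Q)
    (hc : Function.Bijective fun h : Q ⟶ X⟦m⟧ => c ≫ h)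
    (hz : ∀ n ≠ m, Subsingleton (Z ⟶ X⟦n⟧)) {p : Z' ⟶ Z} {δ : Q ⟶ Z'⟦(1 : ℤ)⟧}
    (hT : Triangle.mk p c δ ∈ distTriang D) : IsCotwist X Z Z' := by
  have hu : ∀ n : ℤ, ∃ u : (Z ⟶ X⟦n⟧) →ₗ[End (X⟦n⟧)] (Q ⟶ X⟦n⟧), ∀ f, c ≫ u f = f := by
    intro n
    by_cases hn : n = m
    · subst hn
      let T : (Q ⟶ X⟦n⟧) →ₗ[End (X⟦n⟧)] (Z ⟶ X⟦n⟧) :=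
        { toFun := fun h => c ≫ h
          map_add' := fun _ _ => Preadditive.comp_add _ _ _ _ _ _
          map_smul' := fun r h => (Category.assoc c h r).symm }
      let e := LinearEquiv.ofBijective T hc
      exact ⟨e.symm.toLinearMap, fun f => e.apply_symm_apply f⟩
    · have := hz n hn
      exact ⟨0, fun f => Subsingleton.elim _ _⟩
  choose u hu using hu
  refine ⟨Q, u, p, c, δ, ?_, hu, hT⟩
  intro W φ
  obtain ⟨N, ι, ρ, hsum⟩ := hQ
  have huc : ∀ h : Q ⟶ X⟦m⟧, u m (c ≫ h) = h := fun h => hc.1 (hu m (c ≫ h))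
  refine ⟨∑ a, φ m (c ≫ ι a) ≫ ρ a, ?_, ?_⟩
  · intro n f
    by_cases hn : n = m
    · subst hn
      obtain ⟨h, rfl⟩ := hc.2 f
      change _ ≫ u n (c ≫ h) = φ n (c ≫ h)
      rw [huc]
      have hh : c ≫ h = ∑ a, (show End (X⟦n⟧) from ρ a ≫ h) • (c ≫ ι a) := by
        conv_lhs => rw [← Category.id_comp h, hsum]
        rw [Preadditive.sum_comp, Preadditive.comp_sum]
        refine Finset.sum_congr rfl fun a _ => ?_
        rw [End.smul_right]
        simp only [Category.assoc]
      rw [hh, map_sum, Preadditive.sum_comp]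
      refine Finset.sum_congr rfl fun a _ => ?_
      rw [map_smul, End.smul_right]
      simp only [Category.assoc]
    · have := hz n hn
      rw [Subsingleton.elim f 0, map_zero, map_zero, comp_zero]
  · intro g hg
    rw [← Category.comp_id g, hsum, Preadditive.comp_sum]
    refine Finset.sum_congr rfl fun a _ => ?_
    rw [← Category.assoc, ← hg m, huc]

theorem isTwist_of_bijective {X Z Q Z' : D} (m : ℤ) (hQ : InAdd (X⟦m⟧) Q) (c : Q ⟶ Z)
    (hc : Function.Bijective fun h : X⟦m⟧ ⟶ Q => h ≫ c)
    (hz : ∀ n ≠ m, Subsingleton (X⟦n⟧ ⟶ Z)) {i : Z ⟶ Z'} {δ : Z' ⟶ Q⟦(1 : ℤ)⟧}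
    (hT : Triangle.mk c i δ ∈ distTriang D) : IsTwist X Z Z' := by
  have hu : ∀ n : ℤ, ∃ u : (X⟦n⟧ ⟶ Z) →ₗ[(End (X⟦n⟧))ᵐᵒᵖ] (X⟦n⟧ ⟶ Q), ∀ f, u f ≫ c = f := by
    intro n
    by_cases hn : n = m
    · subst hn
      let T : (X⟦n⟧ ⟶ Q) →ₗ[(End (X⟦n⟧))ᵐᵒᵖ] (X⟦n⟧ ⟶ Z) :=
        { toFun := fun h => h ≫ c
          map_add' := fun _ _ => Preadditive.add_comp _ _ _ _ _ _
          map_smul' := fun r h => Category.assoc r.unop h c }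
      let e := LinearEquiv.ofBijective T hc
      exact ⟨e.symm.toLinearMap, fun f => e.apply_symm_apply f⟩
    · have := hz n hn
      exact ⟨0, fun f => Subsingleton.elim _ _⟩
  choose u hu using hu
  refine ⟨Q, u, c, i, δ, ?_, hu, hT⟩
  intro W φ
  obtain ⟨N, ι, ρ, hsum⟩ := hQ
  have huc : ∀ h : X⟦m⟧ ⟶ Q, u m (h ≫ c) = h := fun h => hc.1 (hu m (h ≫ c))
  refine ⟨∑ a, ι a ≫ φ m (ρ a ≫ c), ?_, ?_⟩
  · intro n f
    by_cases hn : n = m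
    · subst hn
      obtain ⟨h, rfl⟩ := hc.2 f
      change u n (h ≫ c) ≫ _ = φ n (h ≫ c)
      rw [huc]
      have hh : h ≫ c = ∑ a, MulOpposite.op (show End (X⟦n⟧) from h ≫ ι a) • (ρ a ≫ c) := by
        conv_lhs => rw [← Category.comp_id h, hsum]
        rw [Preadditive.comp_sum, Preadditive.sum_comp]
        refine Finset.sum_congr rfl fun a _ => ?_
        rw [End.smul_left]
        simp only [Category.assoc, MulOpposite.unop_op]
      rw [hh, map_sum, Preadditive.comp_sum]
      refine Finset.sum_congr rfl fun a _ => ?_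
      rw [map_smul, End.smul_left]
      simp only [Category.assoc, MulOpposite.unop_op]
    · have := hz n hn
      rw [Subsingleton.elim f 0, map_zero, map_zero, zero_comp]
  · intro g hg
    rw [← Category.id_comp g, hsum, Preadditive.sum_comp]
    refine Finset.sum_congr rfl fun a _ => ?_
    rw [Category.assoc, ← hg m, huc]

end Twists

section Approximation

variable {k : Type*} [Field k] {𝒜 : Type u} [Category.{v} 𝒜] [Abelian 𝒜]
  {D : Type*} [Category D] [Preadditive D] [Linear k D]
  [HasZeroObject D] [HasShift D ℤ]
  [∀ n : ℤ, (shiftFunctor D n).Additive] [Pretriangulated D]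
  {F : 𝒜 ⥤ D} {S : SerreFunctor k D} {Y : 𝒜}

namespace BrickDecomposition

variable (B : BrickDecomposition F S Y)

theorem id_ne_zero (a : B.J) : 𝟙 (B.X a) ≠ 0 :=
  fun h => B.not_isZero a ((IsZero.iff_id_eq_zero _).2 h)

theorem ι_ne_zero (a : B.J) : B.ι a ≠ 0 := fun h =>
  B.id_ne_zero a (by rw [← B.ι_π, h, zero_comp])

theorem π_ne_zero (a : B.J) : B.π a ≠ 0 := fun h =>
  B.id_ne_zero a (by rw [← B.ι_π, h, comp_zero])

/-- Some component from a brick of `Y` through P is nonzero, hence invertible; it splits f. -/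
theorem exists_section {P : 𝒜} (hP : InAdd Y P) {a : B.J} {f : P ⟶ B.X a} (hf : f ≠ 0) :
    ∃ s : B.X a ⟶ P, s ≫ f = 𝟙 _ := by
  obtain ⟨ρ, hρ⟩ := hP.exists_comp_ne_zero hf
  obtain ⟨b, hb⟩ := B.exists_ι_ne_zero hρ
  have := B.isIso_of_ne_zero _ hb
  exact ⟨inv (B.ι b ≫ ρ ≫ f) ≫ B.ι b ≫ ρ, by simp only [Category.assoc, IsIso.inv_hom_id]⟩

theorem exists_retraction {P : 𝒜} (hP : InAdd Y P) {a : B.J} {f : B.X a ⟶ P} (hf : f ≠ 0) :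
    ∃ r : P ⟶ B.X a, f ≫ r = 𝟙 _ := by
  obtain ⟨ρ, hρ⟩ := hP.exists_comp_ne_zero' hf
  obtain ⟨b, hb⟩ := B.exists_π_ne_zero hρ
  have := B.isIso_of_ne_zero _ hb
  exact ⟨ρ ≫ B.π b ≫ inv ((f ≫ ρ) ≫ B.π b), by
    rw [← Category.assoc, ← Category.assoc, IsIso.hom_inv_id]⟩

variable [Linear k 𝒜] [∀ A B : 𝒜, Module.Finite k (A ⟶ B)] {C : Type*} [Category C]
  [Preadditive C] [Linear k C] (G : 𝒜 ⥤ C) [G.Additive] [G.Linear k]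

include B in
/-- The universal morphism from `Z` to the additive closure of `Y`. -/
theorem exists_bijective_comp (Z : C) [Module.Finite k (Z ⟶ G.obj Y)] :
    ∃ (P : 𝒜) (c : Z ⟶ G.obj P), InAdd Y P ∧ Function.Bijective fun h : P ⟶ Y => c ≫ G.map h := by
  -- Minimise a non-unique factorisation: a nonzero h killed by c has a nonzero component to a
  -- brick, which splits off P. The map c lives on the complement, and dim Hom(P,Y) drops.
  have key : ∀ (n : ℕ) (P : 𝒜) (c : Z ⟶ G.obj P), InAdd Y P →
      (Function.Surjective fun h : P ⟶ Y => c ≫ G.map h) → Module.finrank k (P ⟶ Y) = n →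
      ∃ (P : 𝒜) (c : Z ⟶ G.obj P), InAdd Y P ∧
        Function.Bijective fun h : P ⟶ Y => c ≫ G.map h := by
    intro n
    induction n using Nat.strong_induction_on with
    | _ n ih =>
      intro P c hP hsurj hn
      by_cases hinj : Function.Injective fun h : P ⟶ Y => c ≫ G.map h
      · exact ⟨P, c, hP, hinj, hsurj⟩
      obtain ⟨h, hh, hch⟩ : ∃ h : P ⟶ Y, h ≠ 0 ∧ c ≫ G.map h = 0 := by
        simp only [Function.Injective, not_forall] at hinj
        obtain ⟨h, h', e, hne⟩ := hinj
        exact ⟨h - h', sub_ne_zero.2 hne, by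
          rw [G.map_sub, Preadditive.comp_sub, sub_eq_zero]; exact e⟩
      obtain ⟨a, ha⟩ := B.exists_π_ne_zero hh
      obtain ⟨s, hs⟩ := B.exists_section hP ha
      obtain ⟨P', i, r, hir, hsum, hif, hsr⟩ := exists_complement (h ≫ B.π a) s hs
      have hc : (c ≫ G.map r) ≫ G.map i = c := by
        have : c ≫ G.map ((h ≫ B.π a) ≫ s) = 0 := by
          rw [Category.assoc, G.map_comp, ← Category.assoc, hch, zero_comp]
        rw [Category.assoc, ← G.map_comp, eq_sub_of_add_eq' hsum, G.map_sub, Preadditive.comp_sub,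
          this, G.map_id, Category.comp_id, sub_zero]
      refine ih _ ?_ P' (c ≫ G.map r) (hP.of_retract i r hir) ?_ rfl
      · refine hn ▸ finrank_hom_lt_of_retract hir hsr (x := (h ≫ B.π a) ≫ B.ι a) ?_
        rw [← Category.assoc, hs, Category.id_comp]
        exact B.ι_ne_zero a
      · intro y
        obtain ⟨x, rfl⟩ := hsurj y
        exact ⟨i ≫ x, by
          change (c ≫ G.map r) ≫ G.map (i ≫ x) = c ≫ G.map x
          rw [G.map_comp, ← Category.assoc, hc]⟩
  obtain ⟨n, f, hf⟩ := Module.Finite.exists_fin (R := k) (M := Z ⟶ G.obj Y)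
  have := Abelian.hasFiniteBiproducts (C := 𝒜)
  let c : Z ⟶ G.obj (⨁ fun _ : Fin n => Y) := ∑ a, f a ≫ G.map (biproduct.ι (fun _ : Fin n => Y) a)
  have hc : ∀ a, c ≫ G.map (biproduct.π (fun _ : Fin n => Y) a) = f a := fun a => by
    rw [Preadditive.sum_comp, Finset.sum_eq_single a]
    · rw [Category.assoc, ← G.map_comp, biproduct.ι_π_self, G.map_id, Category.comp_id]
    · intro b _ hb
      rw [Category.assoc, ← G.map_comp, biproduct.ι_π_ne _ hb, G.map_zero, comp_zero]
    · simp
  refine key _ (⨁ fun _ : Fin n => Y) c (inAdd_biproduct Y n) ?_ rfl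
  intro y
  have hy : y ∈ Submodule.span k (Set.range f) := hf ▸ Submodule.mem_top
  obtain ⟨t, rfl⟩ := (Submodule.mem_span_range_iff_exists_fun k).1 hy
  refine ⟨∑ a, t a • biproduct.π (fun _ : Fin n => Y) a, ?_⟩
  change c ≫ G.map _ = _
  rw [G.map_sum, Preadditive.comp_sum]
  refine Finset.sum_congr rfl fun a _ => ?_
  rw [G.map_smul, Linear.comp_smul, hc]

include B in
/-- The universal morphism from the additive closure of `Y` to `Z`. -/
theorem exists_bijective_comp' (Z : C) [Module.Finite k (G.obj Y ⟶ Z)] :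
    ∃ (P : 𝒜) (c : G.obj P ⟶ Z), InAdd Y P ∧ Function.Bijective fun h : Y ⟶ P => G.map h ≫ c := by
  have key : ∀ (n : ℕ) (P : 𝒜) (c : G.obj P ⟶ Z), InAdd Y P →
      (Function.Surjective fun h : Y ⟶ P => G.map h ≫ c) → Module.finrank k (Y ⟶ P) = n →
      ∃ (P : 𝒜) (c : G.obj P ⟶ Z), InAdd Y P ∧
        Function.Bijective fun h : Y ⟶ P => G.map h ≫ c := by
    intro n
    induction n using Nat.strong_induction_on with
    | _ n ih =>
      intro P c hP hsurj hn
      by_cases hinj : Function.Injective fun h : Y ⟶ P => G.map h ≫ c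
      · exact ⟨P, c, hP, hinj, hsurj⟩
      obtain ⟨h, hh, hch⟩ : ∃ h : Y ⟶ P, h ≠ 0 ∧ G.map h ≫ c = 0 := by
        simp only [Function.Injective, not_forall] at hinj
        obtain ⟨h, h', e, hne⟩ := hinj
        exact ⟨h - h', sub_ne_zero.2 hne, by
          rw [G.map_sub, Preadditive.sub_comp, sub_eq_zero]; exact e⟩
      obtain ⟨a, ha⟩ := B.exists_ι_ne_zero hh
      obtain ⟨s, hs⟩ := B.exists_retraction hP ha
      obtain ⟨P', i, r, hir, hsum, hif, hsr⟩ := exists_complement s (B.ι a ≫ h) hs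
      have hc : G.map r ≫ G.map i ≫ c = c := by
        have : G.map (s ≫ B.ι a ≫ h) ≫ c = 0 := by
          rw [G.map_comp, G.map_comp, Category.assoc, Category.assoc, hch, comp_zero, comp_zero]
        rw [← Category.assoc, ← G.map_comp, eq_sub_of_add_eq' hsum, G.map_sub, Preadditive.sub_comp,
          this, G.map_id, Category.id_comp, sub_zero]
      refine ih _ ?_ P' (G.map i ≫ c) (hP.of_retract i r hir) ?_ rfl
      · refine hn ▸ finrank_hom_lt_of_retract' hir hif (x := B.π a ≫ B.ι a ≫ h) ?_
        rw [Category.assoc, hs, Category.comp_id]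
        exact B.π_ne_zero a
      · intro y
        obtain ⟨x, rfl⟩ := hsurj y
        exact ⟨x ≫ r, by
          change G.map (x ≫ r) ≫ G.map i ≫ c = G.map x ≫ c
          rw [G.map_comp, Category.assoc, hc]⟩
  obtain ⟨n, f, hf⟩ := Module.Finite.exists_fin (R := k) (M := G.obj Y ⟶ Z)
  have := Abelian.hasFiniteBiproducts (C := 𝒜)
  let c : G.obj (⨁ fun _ : Fin n => Y) ⟶ Z := ∑ a, G.map (biproduct.π (fun _ : Fin n => Y) a) ≫ f a
  have hc : ∀ a, G.map (biproduct.ι (fun _ : Fin n => Y) a) ≫ c = f a := fun a => by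
    rw [Preadditive.comp_sum, Finset.sum_eq_single a]
    · rw [← Category.assoc, ← G.map_comp, biproduct.ι_π_self, G.map_id, Category.id_comp]
    · intro b _ hb
      rw [← Category.assoc, ← G.map_comp, biproduct.ι_π_ne _ (Ne.symm hb), G.map_zero, zero_comp]
    · simp
  refine key _ (⨁ fun _ : Fin n => Y) c (inAdd_biproduct Y n) ?_ rfl
  intro y
  have hy : y ∈ Submodule.span k (Set.range f) := hf ▸ Submodule.mem_top
  obtain ⟨t, rfl⟩ := (Submodule.mem_span_range_iff_exists_fun k).1 hy
  refine ⟨∑ a, t a • biproduct.ι (fun _ : Fin n => Y) a, ?_⟩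
  change G.map _ ≫ c = _
  rw [G.map_sum, Preadditive.sum_comp]
  refine Finset.sum_congr rfl fun a _ => ?_
  rw [G.map_smul, Linear.smul_comp, hc]

end BrickDecomposition

end Approximation

end SphericalTube

/-! ### Transport along isomorphisms, vanishing of Hom-spaces, quotients of add Y. -/

namespace SphericalTube

section Transport

variable {C : Type*} [Category C] [Preadditive C]

theorem InAdd.of_iso {X X' P : C} (h : InAdd X P) (e : X ≅ X') : InAdd X' P := by
  obtain ⟨n, ι, ρ, h⟩ := h
  exact ⟨n, fun a => ι a ≫ e.hom, fun a => e.inv ≫ ρ a, by simp [h]⟩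

variable {D : Type*} [Category D] [Preadditive D] [HasZeroObject D] [HasShift D ℤ]
  [∀ n : ℤ, (shiftFunctor D n).Additive] [Pretriangulated D]

theorem IsCotwist.of_iso {X Z Z' Z₀ Z₀' : D} (h : IsCotwist X Z Z') (e : Z ≅ Z₀) (e' : Z' ≅ Z₀') :
    IsCotwist X Z₀ Z₀' := by
  obtain ⟨P, u, p, c, δ, hu, hc, hT⟩ := h
  let E : ∀ n : ℤ, (Z₀ ⟶ X⟦n⟧) →ₗ[End (X⟦n⟧)] (Z ⟶ X⟦n⟧) := fun n =>
    { toFun := fun f => e.hom ≫ f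
      map_add' := fun _ _ => Preadditive.comp_add _ _ _ _ _ _
      map_smul' := fun r f => (Category.assoc e.hom f r).symm }
  let E' : ∀ n : ℤ, (Z ⟶ X⟦n⟧) →ₗ[End (X⟦n⟧)] (Z₀ ⟶ X⟦n⟧) := fun n =>
    { toFun := fun f => e.inv ≫ f
      map_add' := fun _ _ => Preadditive.comp_add _ _ _ _ _ _
      map_smul' := fun r f => (Category.assoc e.inv f r).symm }
  have hE : ∀ n f, E n f = e.hom ≫ f := fun _ _ => rfl
  have hE' : ∀ n f, E' n f = e.inv ≫ f := fun _ _ => rfl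
  refine ⟨P, fun n => (u n).comp (E n), e'.inv ≫ p ≫ e.hom, e.inv ≫ c, δ ≫ e'.hom⟦(1 : ℤ)⟧', ?_,
    ?_, distinguished_of_iso hT e' e (Iso.refl P) (by simp) (by simp) (by simp)⟩
  · intro W φ
    obtain ⟨g, hg, huniq⟩ := hu W fun n => (φ n).comp (E' n)
    refine ⟨g, fun n f => ?_, fun g' hg' => huniq g' fun n f => ?_⟩
    · simp only [LinearMap.comp_apply, hg, hE, hE', e.inv_hom_id_assoc]
    · rw [LinearMap.comp_apply, ← hg', LinearMap.comp_apply, hE, hE', e.hom_inv_id_assoc]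
  · intro n f
    rw [LinearMap.comp_apply, Category.assoc, hc, hE, e.inv_hom_id_assoc]

theorem IsTwist.of_iso {X Z Z' Z₀ Z₀' : D} (h : IsTwist X Z Z') (e : Z ≅ Z₀) (e' : Z' ≅ Z₀') :
    IsTwist X Z₀ Z₀' := by
  obtain ⟨P, u, c, i, δ, hu, hc, hT⟩ := h
  let E : ∀ n : ℤ, (X⟦n⟧ ⟶ Z₀) →ₗ[(End (X⟦n⟧))ᵐᵒᵖ] (X⟦n⟧ ⟶ Z) := fun n =>
    { toFun := fun f => f ≫ e.inv
      map_add' := fun _ _ => Preadditive.add_comp _ _ _ _ _ _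
      map_smul' := fun r f => Category.assoc r.unop f e.inv }
  let E' : ∀ n : ℤ, (X⟦n⟧ ⟶ Z) →ₗ[(End (X⟦n⟧))ᵐᵒᵖ] (X⟦n⟧ ⟶ Z₀) := fun n =>
    { toFun := fun f => f ≫ e.hom
      map_add' := fun _ _ => Preadditive.add_comp _ _ _ _ _ _
      map_smul' := fun r f => Category.assoc r.unop f e.hom }
  have hE : ∀ n f, E n f = f ≫ e.inv := fun _ _ => rfl
  have hE' : ∀ n f, E' n f = f ≫ e.hom := fun _ _ => rfl
  refine ⟨P, fun n => (u n).comp (E n), c ≫ e.hom, e.inv ≫ i ≫ e'.hom, e'.inv ≫ δ, ?_,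
    ?_, distinguished_of_iso hT (Iso.refl P) e e' (by simp) (by simp) (by simp)⟩
  · intro W φ
    obtain ⟨g, hg, huniq⟩ := hu W fun n => (φ n).comp (E' n)
    refine ⟨g, fun n f => ?_, fun g' hg' => huniq g' fun n f => ?_⟩
    · simp only [LinearMap.comp_apply, hg, hE, hE', Category.assoc, e.inv_hom_id, Category.comp_id]
    · rw [LinearMap.comp_apply, ← hg', LinearMap.comp_apply, hE, hE', Category.assoc, e.hom_inv_id,
        Category.comp_id]
  · intro n f
    rw [LinearMap.comp_apply, ← Category.assoc, hc, hE, Category.assoc, e.inv_hom_id,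
      Category.comp_id]

end Transport

variable {k : Type*} [Field k] {𝒜 : Type u} [Category.{v} 𝒜] [Abelian 𝒜]
  {D : Type*} [Category D] [Preadditive D] [Linear k D] [HasZeroObject D] [HasShift D ℤ]
  [∀ n : ℤ, (shiftFunctor D n).Additive] [Pretriangulated D]
  {F : 𝒜 ⥤ D} {S : SerreFunctor k D} {Y : 𝒜}

section Vanishing

variable [F.Full] [F.Faithful] [F.Additive]

theorem subsingleton_map_iff {A B : 𝒜} :
    Subsingleton (F.obj A ⟶ F.obj B) ↔ Subsingleton (A ⟶ B) :=
  (Functor.FullyFaithful.ofFullyFaithful F).homEquiv.subsingleton_congr.symm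

theorem subsingleton_map_shift_iff {A B : 𝒜} (n : ℤ) :
    Subsingleton ((F.obj A)⟦n⟧ ⟶ (F.obj B)⟦n⟧) ↔ Subsingleton (A ⟶ B) :=
  subsingleton_map_iff (F := F ⋙ shiftFunctor D n)

variable {X X' : 𝒜} (e : S.equiv.functor.obj (F.obj X) ≅ (F.obj X')⟦(1 : ℤ)⟧)

include e

theorem subsingleton_hom_shift_right_iff (A : 𝒜) :
    Subsingleton (F.obj A ⟶ (F.obj X')⟦(1 : ℤ)⟧) ↔ Subsingleton (X ⟶ A) := by
  rw [← subsingleton_map_iff (F := F), S.subsingleton_iff e]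

theorem subsingleton_hom_shift_left_iff (A : 𝒜) :
    Subsingleton (F.obj X ⟶ (F.obj A)⟦(1 : ℤ)⟧) ↔ Subsingleton (A ⟶ X') := by
  rw [S.subsingleton_iff e, subsingleton_map_shift_iff]

theorem comp_shift_eq_zero {V A : 𝒜} (δ : F.obj X ⟶ (F.obj V)⟦(1 : ℤ)⟧) (g : V ⟶ A)
    (h : ∀ u : A ⟶ X', g ≫ u = 0) : δ ≫ (F.map g)⟦(1 : ℤ)⟧' = 0 := by
  refine S.comp_eq_zero_of_left e δ _ fun u => ?_
  obtain ⟨u, rfl⟩ := (F ⋙ shiftFunctor D (1 : ℤ)).map_surjective u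
  change (F ⋙ shiftFunctor D (1 : ℤ)).map g ≫ _ = 0
  rw [← Functor.map_comp, h, Functor.map_zero]

theorem map_comp_eq_zero {A Q : 𝒜} (f : A ⟶ Q) (δ : F.obj Q ⟶ (F.obj X')⟦(1 : ℤ)⟧)
    (h : ∀ u : X ⟶ A, u ≫ f = 0) : F.map f ≫ δ = 0 := by
  refine S.comp_eq_zero_of_right e _ δ fun u => ?_
  obtain ⟨u, rfl⟩ := F.map_surjective u
  rw [← Functor.map_comp, h, Functor.map_zero]

omit [F.Full] [F.Faithful] [F.Additive] in
-- Serre duality turns this space into the dual of Hom(X, A[1-n]), which is a negative extension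
-- group.
theorem subsingleton_hom_shift_of_two_le (hF : IsHeartEmbedding F) (A : 𝒜) (n : ℤ) (hn : 2 ≤ n) :
    Subsingleton (F.obj A ⟶ (F.obj X')⟦n⟧) := by
  have h : Subsingleton (F.obj X ⟶ (F.obj A)⟦1 - n⟧) :=
    subsingleton_hom_iff.2 (hF.hom_neg _ _ _ (by omega))
  rw [S.subsingleton_iff e, (shiftHomEquiv (1 - n) (n - 1) (by omega) _ _).subsingleton_congr] at h
  exact (((shiftFunctorAdd' D 1 (n - 1) n (by omega)).app (F.obj X')).homToEquiv
    (Z := F.obj A)).subsingleton_congr.2 h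

omit [F.Full] [F.Faithful] [F.Additive] in
theorem subsingleton_shift_hom_of_le (hF : IsHeartEmbedding F) (A : 𝒜) (n : ℤ) (hn : n ≤ -2) :
    Subsingleton ((F.obj X)⟦n⟧ ⟶ F.obj A) := by
  rw [(shiftHomEquiv n (-n) (by omega) _ _).subsingleton_congr, S.subsingleton_iff e,
    (shiftHomEquiv (-n) n (by omega) _ _).subsingleton_congr]
  refine (((shiftFunctorAdd' D 1 n (1 + n) rfl).app (F.obj X')).homToEquiv
    (Z := F.obj A)).subsingleton_congr.1 ?_
  exact subsingleton_hom_iff.2 (hF.hom_neg _ _ _ (by omega))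

omit [F.Full] [F.Faithful] [F.Additive] e in
theorem subsingleton_shift_hom_of_pos (hF : IsHeartEmbedding F) (A : 𝒜) (n : ℤ) (hn : 0 < n) :
    Subsingleton ((F.obj X)⟦n⟧ ⟶ F.obj A) := by
  rw [(shiftHomEquiv n (-n) (by omega) _ _).subsingleton_congr]
  exact subsingleton_hom_iff.2 (hF.hom_neg _ _ _ (by omega))

theorem subsingleton_shift_neg_one_iff (A : 𝒜) :
    Subsingleton ((F.obj X)⟦(-1 : ℤ)⟧ ⟶ F.obj A) ↔ Subsingleton (A ⟶ X') := by
  rw [(shiftHomEquiv (-1) 1 (by norm_num) _ _).subsingleton_congr,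
    subsingleton_hom_shift_left_iff e]

end Vanishing

namespace BrickDecomposition

variable (B : BrickDecomposition F S Y)

/-- If the bricks are simple, a nonzero quotient of an object of the additive closure of `Y` maps
nontrivially to `Y`. -/
theorem eq_zero_of_epi [Linear k 𝒜] [∀ A B : 𝒜, Module.Finite k (A ⟶ B)]
    (hs : ∀ a, Simple (B.X a)) {P Q : 𝒜} (hP : InAdd Y P) (q : P ⟶ Q) [Epi q]
    (hQ : Subsingleton (Q ⟶ Y)) : q = 0 := by
  induction hn : Module.finrank k (P ⟶ Y) using Nat.strong_induction_on generalizing P with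
  | _ n ih =>
    by_cases hK : kernel.ι q = 0
    · have : Mono q := Preadditive.mono_of_kernel_zero hK
      have : IsIso q := isIso_of_mono_of_epi q
      by_contra hq
      have hid : 𝟙 P ≠ 0 := fun h => hq (by rw [← Category.id_comp q, h, zero_comp])
      obtain ⟨ι, hι⟩ := hP.exists_comp_ne_zero' hid
      apply hι
      rw [Category.id_comp, ← IsIso.hom_inv_id_assoc q ι, Subsingleton.elim (inv q ≫ ι) 0,
        comp_zero]
    · obtain ⟨ι, hι⟩ := hP.exists_comp_ne_zero' hK
      obtain ⟨a, ha⟩ := B.exists_π_ne_zero hι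
      have := hs a
      have hepi : Epi (kernel.ι q ≫ ι ≫ B.π a) := epi_of_nonzero_to_simple (by
        simpa only [Category.assoc] using ha)
      have hf : ι ≫ B.π a ≠ 0 := fun h => ha (by rw [Category.assoc, h, comp_zero])
      obtain ⟨s, hs'⟩ := B.exists_section hP hf
      obtain ⟨P', i, r, hir, hsum, hif, hsr⟩ := exists_complement _ s hs'
      -- If t vanishes on the image of the complement P', then q ≫ t factors through the split-off
      -- brick. The kernel of q already surjects onto that simple brick, so q ≫ t = 0. Hence P'
      -- still surjects onto Q.
      have hfac : ∀ {T : 𝒜} (t : Q ⟶ T), i ≫ q ≫ t = 0 → q ≫ t = 0 := fun {T} t ht => by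
        have h₁ : q ≫ t = (ι ≫ B.π a) ≫ s ≫ q ≫ t := by
          calc q ≫ t = ((ι ≫ B.π a) ≫ s + r ≫ i) ≫ q ≫ t := by rw [hsum, Category.id_comp]
            _ = _ := by rw [Preadditive.add_comp, Category.assoc r, ht, comp_zero, add_zero,
                  Category.assoc (ι ≫ B.π a)]
        have h₂ : (kernel.ι q ≫ ι ≫ B.π a) ≫ s ≫ q ≫ t = 0 := by
          rw [Category.assoc, ← h₁, kernel.condition_assoc, zero_comp]
        rw [h₁, zero_of_epi_comp _ h₂, comp_zero]
      have hepi' : Epi (i ≫ q) := Preadditive.epi_of_cancel_zero _ fun t ht =>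
        zero_of_epi_comp q (hfac t (by simpa using ht))
      have h0 : i ≫ q = 0 := by
        refine ih _ ?_ (hP.of_retract i r hir) (i ≫ q) rfl
        refine hn ▸ finrank_hom_lt_of_retract hir hsr (x := (ι ≫ B.π a) ≫ B.ι a) ?_
        rw [← Category.assoc, hs', Category.id_comp]
        exact B.ι_ne_zero a
      simpa using hfac (𝟙 Q) (by simpa using h0)

/-- If the bricks are simple, a nonzero subobject of an object of the additive closure of `Y`
receives a nonzero morphism from `Y`. -/
theorem eq_zero_of_mono [Linear k 𝒜] [∀ A B : 𝒜, Module.Finite k (A ⟶ B)]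
    (hs : ∀ a, Simple (B.X a)) {P Q : 𝒜} (hP : InAdd Y P) (q : Q ⟶ P) [Mono q]
    (hQ : Subsingleton (Y ⟶ Q)) : q = 0 := by
  induction hn : Module.finrank k (Y ⟶ P) using Nat.strong_induction_on generalizing P with
  | _ n ih =>
    by_cases hK : cokernel.π q = 0
    · have : Epi q := Preadditive.epi_of_cokernel_zero hK
      have : IsIso q := isIso_of_mono_of_epi q
      by_contra hq
      have hid : 𝟙 P ≠ 0 := fun h => hq (by rw [← Category.comp_id q, h, comp_zero])
      obtain ⟨ι, hι⟩ := hP.exists_comp_ne_zero hid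
      apply hι
      rw [Category.comp_id, ← Category.comp_id ι, ← IsIso.inv_hom_id q, ← Category.assoc,
        Subsingleton.elim (ι ≫ inv q) 0, zero_comp]
    · obtain ⟨ι, hι⟩ := hP.exists_comp_ne_zero hK
      obtain ⟨a, ha⟩ := B.exists_ι_ne_zero hι
      have := hs a
      have hmono : Mono ((B.ι a ≫ ι) ≫ cokernel.π q) := mono_of_nonzero_from_simple (by
        simpa only [Category.assoc] using ha)
      have hf : B.ι a ≫ ι ≠ 0 := fun h => ha (by rw [← Category.assoc, h, zero_comp])
      obtain ⟨s, hs'⟩ := B.exists_retraction hP hf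
      obtain ⟨P', i, r, hir, hsum, hif, hsr⟩ := exists_complement s (B.ι a ≫ ι) hs'
      have hfac : ∀ {T : 𝒜} (t : T ⟶ Q), t ≫ q ≫ r = 0 → t ≫ q = 0 := fun {T} t ht => by
        have h₁ : t ≫ q = (t ≫ q ≫ s) ≫ B.ι a ≫ ι := by
          calc t ≫ q = (t ≫ q) ≫ (s ≫ B.ι a ≫ ι + r ≫ i) := by rw [hsum, Category.comp_id]
            _ = (t ≫ q ≫ s) ≫ B.ι a ≫ ι + (t ≫ q ≫ r) ≫ i := by
              rw [Preadditive.comp_add]; simp only [Category.assoc]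
            _ = _ := by rw [ht, zero_comp, add_zero]
        have h₂ : (t ≫ q ≫ s) ≫ (B.ι a ≫ ι) ≫ cokernel.π q = 0 := by
          rw [← Category.assoc, ← h₁, Category.assoc, cokernel.condition, comp_zero]
        rw [h₁, zero_of_comp_mono _ h₂, zero_comp]
      have hmono' : Mono (q ≫ r) := Preadditive.mono_of_cancel_zero _ fun t ht =>
        zero_of_comp_mono q (hfac t ht)
      have h0 : q ≫ r = 0 := by
        refine ih _ ?_ (hP.of_retract i r hir) (q ≫ r) rfl
        refine hn ▸ finrank_hom_lt_of_retract' hir hif (x := B.π a ≫ B.ι a ≫ ι) ?_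
        rw [Category.assoc, hs', Category.comp_id]
        exact B.π_ne_zero a
      simpa using hfac (𝟙 Q) (by simpa using h0)

end BrickDecomposition

end SphericalTube

/-! ### Twists of stalk objects and their orbits. -/

namespace SphericalTube

variable {k : Type*} [Field k] {𝒜 : Type u} [Category.{v} 𝒜] [Abelian 𝒜]
  {D : Type*} [Category D] [Preadditive D] [Linear k D] [HasZeroObject D] [HasShift D ℤ]
  [∀ n : ℤ, (shiftFunctor D n).Additive] [Pretriangulated D]
  {F : 𝒜 ⥤ D} {S : SerreFunctor k D} {Y : 𝒜}

section HeartTwists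

variable [F.Full] [F.Faithful] [F.Additive] (hF : IsHeartEmbedding F)
  (φ : S.equiv.functor.obj (F.obj Y) ≅ (F.obj Y)⟦(1 : ℤ)⟧)

include hF φ

/-- If `Hom(Y,A) = 0`, the cotwist of `A` is the cocone of the universal map `A → P`. -/
theorem isCotwist_map {A P : 𝒜} (hA : Subsingleton (Y ⟶ A)) (hP : InAdd Y P) {c : A ⟶ P}
    (hc : Function.Bijective fun h : P ⟶ Y => c ≫ h) {Z : D} {p : Z ⟶ F.obj A}
    {δ : F.obj P ⟶ Z⟦(1 : ℤ)⟧} (hT : Triangle.mk p (F.map c) δ ∈ distTriang D) :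
    IsCotwist (F.obj Y) (F.obj A) Z := by
  let e : (F.obj Y)⟦(0 : ℤ)⟧ ≅ F.obj Y := (shiftFunctorZero D ℤ).app (F.obj Y)
  refine isCotwist_of_bijective 0 ((hP.map F).of_iso e.symm) (F.map c) ?_ (fun n hn => ?_) hT
  · refine ⟨fun x y hxy => ?_, fun x => ?_⟩
    · obtain ⟨x', hx⟩ := F.map_surjective (x ≫ e.hom)
      obtain ⟨y', hy⟩ := F.map_surjective (y ≫ e.hom)
      have : c ≫ x' = c ≫ y' := F.map_injective (by
        rw [F.map_comp, F.map_comp, hx, hy]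
        simpa only [Category.assoc] using congrArg (· ≫ e.hom) hxy)
      rw [← cancel_mono e.hom, ← hx, ← hy, hc.1 this]
    · obtain ⟨x', hx⟩ := F.map_surjective (x ≫ e.hom)
      obtain ⟨y, rfl⟩ := hc.2 x'
      refine ⟨F.map y ≫ e.inv, ?_⟩
      change F.map c ≫ F.map y ≫ e.inv = x
      rw [← Category.assoc, ← F.map_comp, hx, Category.assoc, e.hom_inv_id, Category.comp_id]
  · rcases lt_trichotomy n 0 with h | h | h
    · exact subsingleton_hom_iff.2 (hF.hom_neg _ _ _ h)
    · exact (hn h).elim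
    · rcases (show n = 1 ∨ 2 ≤ n by omega) with rfl | h
      · exact (subsingleton_hom_shift_right_iff φ A).2 hA
      · exact subsingleton_hom_shift_of_two_le φ hF A n h

/-- If `Hom(A,Y) = 0`, the twist of `A` is the cone of the universal map `P → A`. -/
theorem isTwist_map {A P : 𝒜} (hA : Subsingleton (A ⟶ Y)) (hP : InAdd Y P) {c : P ⟶ A}
    (hc : Function.Bijective fun h : Y ⟶ P => h ≫ c) {Z : D} {i : F.obj A ⟶ Z}
    {δ : Z ⟶ (F.obj P)⟦(1 : ℤ)⟧} (hT : Triangle.mk (F.map c) i δ ∈ distTriang D) :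
    IsTwist (F.obj Y) (F.obj A) Z := by
  let e : (F.obj Y)⟦(0 : ℤ)⟧ ≅ F.obj Y := (shiftFunctorZero D ℤ).app (F.obj Y)
  refine isTwist_of_bijective 0 ((hP.map F).of_iso e.symm) (F.map c) ?_ (fun n hn => ?_) hT
  · refine ⟨fun x y hxy => ?_, fun x => ?_⟩
    · obtain ⟨x', hx⟩ := F.map_surjective (e.inv ≫ x)
      obtain ⟨y', hy⟩ := F.map_surjective (e.inv ≫ y)
      have : x' ≫ c = y' ≫ c := F.map_injective (by
        rw [F.map_comp, F.map_comp, hx, hy, Category.assoc, Category.assoc]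
        exact congrArg (e.inv ≫ ·) hxy)
      rw [← cancel_epi e.inv, ← hx, ← hy, hc.1 this]
    · obtain ⟨x', hx⟩ := F.map_surjective (e.inv ≫ x)
      obtain ⟨y, rfl⟩ := hc.2 x'
      refine ⟨e.hom ≫ F.map y, ?_⟩
      change (e.hom ≫ F.map y) ≫ F.map c = x
      rw [Category.assoc, ← F.map_comp, hx, e.hom_inv_id_assoc]
  · rcases lt_trichotomy n 0 with h | h | h
    · rcases (show n = -1 ∨ n ≤ -2 by omega) with rfl | h
      · exact (subsingleton_shift_neg_one_iff φ A).2 hA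
      · exact subsingleton_shift_hom_of_le φ hF A n h
    · exact (hn h).elim
    · exact subsingleton_shift_hom_of_pos hF A n h

/-- If `Hom(Y,A) = 0`, the twist of `A` is the universal extension of an object of the additive
closure of `Y` by `A`. -/
theorem isTwist_of_extension {A A' P : 𝒜} (hA : Subsingleton (Y ⟶ A)) (hP : InAdd Y P)
    {δ : F.obj P ⟶ (F.obj A)⟦(1 : ℤ)⟧}
    (hδ : Function.Bijective fun h : Y ⟶ P => F.map h ≫ δ) {f : A ⟶ A'} {g : A' ⟶ P}
    (hT : Triangle.mk (F.map f) (F.map g) δ ∈ distTriang D) :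
    IsTwist (F.obj Y) (F.obj A) (F.obj A') := by
  let η : F.obj A ≅ ((F.obj A)⟦(1 : ℤ)⟧)⟦(-1 : ℤ)⟧ := (shiftEquiv D (1 : ℤ)).unitIso.app (F.obj A)
  let G := F ⋙ shiftFunctor D (-1 : ℤ)
  -- Only Hom(Y, A[1]) survives, so the evaluation starts at P[-1] and its triangle is the inverse
  -- rotation of the extension.
  refine isTwist_of_bijective (-1) (hP.map G) (-(δ⟦(-1 : ℤ)⟧' ≫ η.inv)) ?_ (fun n hn => ?_)
    (inv_rot_of_distTriang _ hT)
  · have key : ∀ h : Y ⟶ P, G.map h ≫ (-(δ⟦(-1 : ℤ)⟧' ≫ η.inv)) =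
        -((F.map h ≫ δ)⟦(-1 : ℤ)⟧' ≫ η.inv) := fun h => by
      rw [Preadditive.comp_neg, Functor.map_comp, Category.assoc]
      rfl
    refine ⟨fun x y hxy => ?_, fun x => ?_⟩
    · obtain ⟨x, rfl⟩ := G.map_surjective x
      obtain ⟨y, rfl⟩ := G.map_surjective y
      have h := (key x).symm.trans (hxy.trans (key y))
      rw [neg_inj, cancel_mono] at h
      rw [hδ.1 ((shiftFunctor D (-1 : ℤ)).map_injective h)]
    · obtain ⟨y, hy⟩ := (shiftFunctor D (-1 : ℤ)).map_surjective (-(x ≫ η.hom))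
      obtain ⟨h, rfl⟩ := hδ.2 y
      refine ⟨G.map h, (key h).trans ?_⟩
      change (shiftFunctor D (-1 : ℤ)).map (F.map h ≫ δ) = _ at hy
      rw [hy, Preadditive.neg_comp, neg_neg, Category.assoc, η.hom_inv_id, Category.comp_id]
  · rcases lt_trichotomy n 0 with h | rfl | h
    · exact subsingleton_shift_hom_of_le φ hF A n (by omega)
    · rw [(shiftHomEquiv 0 0 rfl _ _).subsingleton_congr]
      rw [← subsingleton_map_iff (F := F)] at hA
      exact (((shiftFunctorZero D ℤ).app (F.obj A)).homToEquiv
        (Z := F.obj Y)).subsingleton_congr.2 hA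
    · exact subsingleton_shift_hom_of_pos hF A n h

/-- If `Hom(A,Y) = 0`, the cotwist of `A` is the universal extension of `A` by an object of the
additive closure of `Y`. -/
theorem isCotwist_of_extension {A A' P : 𝒜} (hA : Subsingleton (A ⟶ Y)) (hP : InAdd Y P)
    {δ : F.obj A ⟶ (F.obj P)⟦(1 : ℤ)⟧}
    (hδ : Function.Bijective fun h : P ⟶ Y => δ ≫ (F.map h)⟦(1 : ℤ)⟧') {f : P ⟶ A'} {g : A' ⟶ A}
    (hT : Triangle.mk (F.map f) (F.map g) δ ∈ distTriang D) :
    IsCotwist (F.obj Y) (F.obj A) (F.obj A') := by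
  let G := F ⋙ shiftFunctor D (1 : ℤ)
  refine isCotwist_of_bijective 1 (hP.map G) δ ?_ (fun n hn => ?_) (rot_of_distTriang _ hT)
  · refine ⟨fun x y hxy => ?_, fun x => ?_⟩
    · obtain ⟨x, rfl⟩ := G.map_surjective x
      obtain ⟨y, rfl⟩ := G.map_surjective y
      rw [hδ.1 hxy]
    · obtain ⟨h, rfl⟩ := hδ.2 x
      exact ⟨G.map h, rfl⟩
  · rcases lt_trichotomy n 0 with h | rfl | h
    · exact subsingleton_hom_iff.2 (hF.hom_neg _ _ _ h)
    · rw [← subsingleton_map_iff (F := F)] at hA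
      exact (((shiftFunctorZero D ℤ).app (F.obj Y)).homToEquiv
        (Z := F.obj A)).subsingleton_congr.2 hA
    · exact subsingleton_hom_shift_of_two_le φ hF A n (by omega)

end HeartTwists

namespace BrickDecomposition

variable (B : BrickDecomposition F S Y) [Linear k 𝒜] [∀ A B : 𝒜, Module.Finite k (A ⟶ B)]
  [F.Full] [F.Faithful] [F.Additive] (hF : IsHeartEmbedding F)
  (φ : S.equiv.functor.obj (F.obj Y) ≅ (F.obj Y)⟦(1 : ℤ)⟧)

include B hF φ

/-- The universal extension exists without simplicity. A map from `Y` to A' composes to zero with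
the connecting map of P, so by injectivity it vanishes in P and comes from A, where there is none.
-/
theorem exists_isTwist [F.Linear k] [∀ A B : 𝒜, Module.Finite k (F.obj A ⟶ (F.obj B)⟦(1 : ℤ)⟧)]
    (A : 𝒜) (hA : Subsingleton (Y ⟶ A)) :
    ∃ A' : 𝒜, Subsingleton (Y ⟶ A') ∧ IsTwist (F.obj Y) (F.obj A) (F.obj A') := by
  obtain ⟨P, δ, hP, hδ⟩ := B.exists_bijective_comp' F ((F.obj A)⟦(1 : ℤ)⟧)
  obtain ⟨A', f, g, w, hE, hT⟩ := hF.exists_extension δ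
  refine ⟨A', subsingleton_hom_iff.2 fun x => ?_, isTwist_of_extension hF φ hA hP hδ hT⟩
  have : Mono f := hE.mono_f
  have hx : x ≫ g = 0 := hδ.1 (by
    change F.map (x ≫ g) ≫ δ = F.map 0 ≫ δ
    have h0 : F.map g ≫ δ = 0 := comp_distTriang_mor_zero₂₃ _ hT
    rw [F.map_comp, Category.assoc, h0, comp_zero, F.map_zero, zero_comp])
  obtain ⟨y, hy⟩ := hE.exact.lift' x hx
  rw [← hy, Subsingleton.elim y 0, zero_comp]

theorem exists_isCotwist' [F.Linear k] [∀ n : ℤ, (shiftFunctor D n).Linear k]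
    [∀ A B : 𝒜, Module.Finite k (F.obj A ⟶ (F.obj B)⟦(1 : ℤ)⟧)]
    (A : 𝒜) (hA : Subsingleton (A ⟶ Y)) :
    ∃ A' : 𝒜, Subsingleton (A' ⟶ Y) ∧ IsCotwist (F.obj Y) (F.obj A) (F.obj A') := by
  have : Module.Finite k (F.obj A ⟶ (F ⋙ shiftFunctor D (1 : ℤ)).obj Y) :=
    inferInstanceAs (Module.Finite k (F.obj A ⟶ (F.obj Y)⟦(1 : ℤ)⟧))
  obtain ⟨P, δ, hP, hδ⟩ := B.exists_bijective_comp (F ⋙ shiftFunctor D (1 : ℤ)) (F.obj A)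
  change F.obj A ⟶ (F.obj P)⟦(1 : ℤ)⟧ at δ
  change Function.Bijective fun h : P ⟶ Y => δ ≫ (F.map h)⟦(1 : ℤ)⟧' at hδ
  obtain ⟨A', f, g, w, hE, hT⟩ := hF.exists_extension δ
  refine ⟨A', subsingleton_hom_iff.2 fun x => ?_, isCotwist_of_extension hF φ hA hP hδ hT⟩
  have : Epi g := hE.epi_g
  have hx : f ≫ x = 0 := hδ.1 (by
    change δ ≫ (F.map (f ≫ x))⟦(1 : ℤ)⟧' = δ ≫ (F.map 0)⟦(1 : ℤ)⟧'
    have h0 : δ ≫ (F.map f)⟦(1 : ℤ)⟧' = 0 := comp_distTriang_mor_zero₃₁ _ hT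
    rw [F.map_comp, Functor.map_comp, ← Category.assoc, h0, zero_comp, F.map_zero,
      Functor.map_zero, comp_zero])
  obtain ⟨y, hy⟩ := hE.exact.desc' x hx
  rw [← hy, Subsingleton.elim y 0, comp_zero]

/-- A map from the cokernel of the universal c : A ⟶ P to `Y` vanishes by uniqueness of
factorisation. With simple bricks the cokernel is then zero, and the cotwist is the kernel of c. -/
theorem exists_isCotwist (hs : ∀ a, Simple (B.X a)) (A : 𝒜) (hA : Subsingleton (Y ⟶ A)) :
    ∃ A' : 𝒜, Subsingleton (Y ⟶ A') ∧ IsCotwist (F.obj Y) (F.obj A) (F.obj A') := by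
  obtain ⟨P, c, hP, hc⟩ := B.exists_bijective_comp (𝟭 𝒜) A
  change A ⟶ P at c
  change Function.Bijective fun h : P ⟶ Y => c ≫ h at hc
  have h0 : cokernel.π c = 0 := B.eq_zero_of_epi hs hP _ (subsingleton_hom_iff.2 fun t => by
    rw [← cancel_epi (cokernel.π c), comp_zero]
    exact hc.1 (by simp))
  have : Epi c := Preadditive.epi_of_cokernel_zero h0
  have hE : (ShortComplex.mk (kernel.ι c) c (kernel.condition c)).ShortExact :=
    { exact := ShortComplex.exact_of_f_is_kernel _ (kernelIsKernel c) }
  obtain ⟨δ, hT⟩ := hF.exists_triangle _ hE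
  refine ⟨kernel c, subsingleton_hom_iff.2 fun x => ?_, isCotwist_map hF φ hA hP hc hT⟩
  rw [← cancel_mono (kernel.ι c)]
  exact Subsingleton.elim _ _

theorem exists_isTwist' (hs : ∀ a, Simple (B.X a)) (A : 𝒜) (hA : Subsingleton (A ⟶ Y)) :
    ∃ A' : 𝒜, Subsingleton (A' ⟶ Y) ∧ IsTwist (F.obj Y) (F.obj A) (F.obj A') := by
  obtain ⟨P, c, hP, hc⟩ := B.exists_bijective_comp' (𝟭 𝒜) A
  change P ⟶ A at c
  change Function.Bijective fun h : Y ⟶ P => h ≫ c at hc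
  have h0 : kernel.ι c = 0 := B.eq_zero_of_mono hs hP _ (subsingleton_hom_iff.2 fun t => by
    rw [← cancel_mono (kernel.ι c), zero_comp]
    exact hc.1 (by simp))
  have : Mono c := Preadditive.mono_of_kernel_zero h0
  have hE : (ShortComplex.mk c (cokernel.π c) (cokernel.condition c)).ShortExact :=
    { exact := ShortComplex.exact_of_g_is_cokernel _ (cokernelIsCokernel c) }
  obtain ⟨δ, hT⟩ := hF.exists_triangle _ hE
  refine ⟨cokernel c, subsingleton_hom_iff.2 fun x => ?_, isTwist_map hF φ hA hP hc hT⟩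
  rw [← cancel_epi (cokernel.π c)]
  exact Subsingleton.elim _ _

/-- Uniqueness of the cotwist identifies A' with the cocone of the universal map. As all three terms
lie in the heart, the triangle is a short exact sequence, so c is epi. -/
theorem exists_triangle_of_isCotwist {A A' : 𝒜} (hA : Subsingleton (Y ⟶ A))
    (h : IsCotwist (F.obj Y) (F.obj A) (F.obj A')) :
    ∃ (P : 𝒜) (i : A' ⟶ A) (c : A ⟶ P) (δ : F.obj P ⟶ (F.obj A')⟦(1 : ℤ)⟧), InAdd Y P ∧
      (Function.Bijective fun h : P ⟶ Y => c ≫ h) ∧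
      Triangle.mk (F.map i) (F.map c) δ ∈ distTriang D := by
  obtain ⟨P, c, hP, hc⟩ := B.exists_bijective_comp (𝟭 𝒜) A
  change A ⟶ P at c
  change Function.Bijective fun h : P ⟶ Y => c ≫ h at hc
  obtain ⟨Z, p, δ, hT⟩ := distinguished_cocone_triangle₁ (F.map c)
  obtain ⟨e⟩ := (isCotwist_map hF φ hA hP hc hT).unique h
  refine ⟨P, F.preimage (e.inv ≫ p), c, δ ≫ e.hom⟦(1 : ℤ)⟧', hP, hc, ?_⟩
  exact distinguished_of_iso hT e (Iso.refl _) (Iso.refl _) (by simp) (by simp) (by simp)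

theorem exists_triangle_of_isTwist {A A' : 𝒜} (hA : Subsingleton (A ⟶ Y))
    (h : IsTwist (F.obj Y) (F.obj A) (F.obj A')) :
    ∃ (P : 𝒜) (c : P ⟶ A) (i : A ⟶ A') (δ : F.obj A' ⟶ (F.obj P)⟦(1 : ℤ)⟧), InAdd Y P ∧
      (Function.Bijective fun h : Y ⟶ P => h ≫ c) ∧
      Triangle.mk (F.map c) (F.map i) δ ∈ distTriang D := by
  obtain ⟨P, c, hP, hc⟩ := B.exists_bijective_comp' (𝟭 𝒜) A
  change P ⟶ A at c
  change Function.Bijective fun h : Y ⟶ P => h ≫ c at hc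
  obtain ⟨Z, p, δ, hT⟩ := distinguished_cocone_triangle (F.map c)
  obtain ⟨e⟩ := (isTwist_map hF φ hA hP hc hT).unique h
  refine ⟨P, c, F.preimage (p ≫ e.hom), e.inv ≫ δ, hP, hc, ?_⟩
  exact distinguished_of_iso hT (Iso.refl _) (Iso.refl _) e (by simp) (by simp) (by simp)

end BrickDecomposition

section Orbits

theorem exists_seq {α : Type*} {p : α → Prop} {r : α → α → Prop}
    (h : ∀ a, p a → ∃ b, p b ∧ r a b) (a : α) (ha : p a) :
    ∃ s : ℕ → α, s 0 = a ∧ ∀ n, r (s n) (s (n + 1)) := by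
  choose f hf using h
  let s : ℕ → {a // p a} := fun n => Nat.rec ⟨a, ha⟩ (fun _ x => ⟨f x.1 x.2, (hf x.1 x.2).1⟩) n
  exact ⟨fun n => (s n).1, rfl, fun n => (hf (s n).1 (s n).2).2⟩

omit [Abelian 𝒜] [Linear k D] in
theorem exists_isTwistOrbit (F : 𝒜 ⥤ D) {X : D} {p : 𝒜 → Prop}
    (h₁ : ∀ A, p A → ∃ A', p A' ∧ IsTwist X (F.obj A) (F.obj A'))
    (h₂ : ∀ A, p A → ∃ A', p A' ∧ IsCotwist X (F.obj A) (F.obj A')) (A : 𝒜) (hA : p A) :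
    ∃ Z : ℤ → D, IsTwistOrbit X (F.obj A) Z ∧ ∀ i, ∃ A', Nonempty (Z i ≅ F.obj A') := by
  obtain ⟨s, hs, hs'⟩ := exists_seq h₁ A hA
  obtain ⟨t, ht, ht'⟩ := exists_seq h₂ A hA
  let Z : ℤ → 𝒜 := fun
    | .ofNat n => s n
    | .negSucc n => t (n + 1)
  have hZ : ∀ n : ℕ, Z (-n) = t n := by
    rintro (_ | n)
    · exact hs.trans ht.symm
    · rfl
  have hZ' : ∀ n : ℕ, Z (-n - 1) = t (n + 1) := fun n => by
    rw [← hZ (n + 1), Nat.cast_succ, neg_add, sub_eq_add_neg]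
  refine ⟨fun i => F.obj (Z i), ⟨⟨eqToIso (congrArg F.obj hs)⟩, fun n => hs' n, fun n => ?_⟩,
    fun i => ⟨_, ⟨Iso.refl _⟩⟩⟩
  rw [hZ, hZ']
  exact ht' n

end Orbits

end SphericalTube

/-! ### An orbit inside the heart forces the bricks to be simple. -/

namespace SphericalTube

variable {k : Type*} [Field k] {𝒜 : Type u} [Category.{v} 𝒜] [Abelian 𝒜]
  {D : Type*} [Category D] [Preadditive D] [Linear k D] [HasZeroObject D] [HasShift D ℤ]
  [∀ n : ℤ, (shiftFunctor D n).Additive] [Pretriangulated D]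
  {F : 𝒜 ⥤ D} {S : SerreFunctor k D} {Y : 𝒜}

namespace BrickDecomposition

variable (B : BrickDecomposition F S Y)

theorem exists_mono_of_not_simple {j : B.J} (hj : ¬ Simple (B.X j)) :
    ∃ (K : 𝒜) (κ : K ⟶ B.X j), Mono κ ∧ κ ≠ 0 ∧ ¬ IsIso κ := by
  by_contra! h
  refine hj ⟨fun {K} κ hκ => ⟨fun hi h0 => B.not_isZero j ?_, fun h0 => h K κ hκ h0⟩⟩
  rw [IsZero.iff_id_eq_zero, ← IsIso.inv_hom_id κ, (cancel_epi (inv κ)).2 h0, comp_zero]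

variable {j : B.J} {K : 𝒜} {κ : K ⟶ B.X j} [Mono κ]

/-- A nonzero map from `Y` to K would give a nonzero, hence invertible, map of bricks through κ,
making κ a split epimorphism. -/
theorem subsingleton_hom_of_mono (hκ : ¬ IsIso κ) : Subsingleton (Y ⟶ K) := by
  rw [subsingleton_hom_iff]
  intro f
  by_contra hf
  obtain ⟨a, ha⟩ := B.exists_ι_ne_zero hf
  have hi : (B.ι a ≫ f) ≫ κ ≠ 0 := fun h => ha (zero_of_comp_mono κ h)
  have := B.isIso_of_ne_zero _ hi
  apply hκ
  have : IsSplitEpi κ := IsSplitEpi.mk' ⟨inv ((B.ι a ≫ f) ≫ κ) ≫ B.ι a ≫ f, by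
    rw [Category.assoc, IsIso.inv_hom_id]⟩
  exact isIso_of_mono_of_isSplitEpi κ

theorem subsingleton_hom_of_cokernel (hκ : κ ≠ 0) : Subsingleton (cokernel κ ⟶ Y) := by
  rw [subsingleton_hom_iff]
  intro f
  by_contra hf
  obtain ⟨a, ha⟩ := B.exists_π_ne_zero hf
  have hi : cokernel.π κ ≫ f ≫ B.π a ≠ 0 := fun h => ha (zero_of_epi_comp _ h)
  have := B.isIso_of_ne_zero _ hi
  apply hκ
  rw [← cancel_mono (cokernel.π κ ≫ f ≫ B.π a), zero_comp, cokernel.condition_assoc, zero_comp]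

omit [Linear k D] in
theorem cokernel_π_ne_zero {X : 𝒜} {κ : K ⟶ X} [Mono κ] (hκ : ¬ IsIso κ) : cokernel.π κ ≠ 0 :=
  fun h => hκ (by
    have : Epi κ := Preadditive.epi_of_cokernel_zero h
    exact isIso_of_mono_of_epi κ)

variable [F.Full] [F.Faithful] [F.Additive] {A A' P : 𝒜}

section

variable {i : A' ⟶ A} {c : A ⟶ P} {δ : F.obj P ⟶ (F.obj A')⟦(1 : ℤ)⟧} (hP : InAdd Y P)
  (hc : Function.Bijective fun h : P ⟶ Y => c ≫ h)

include hP hc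

omit [F.Full] [F.Faithful] [F.Additive] [Mono κ] in
theorem exists_factor_of_universal {l : B.J} {f : A ⟶ B.X l} (hf : f ≠ 0) :
    ∃ (h : P ⟶ B.X l) (s : B.X l ⟶ P), c ≫ h = f ∧ s ≫ h = 𝟙 _ := by
  obtain ⟨h, hh⟩ := hc.2 (f ≫ B.ι l)
  change c ≫ h = f ≫ B.ι l at hh
  have e : c ≫ h ≫ B.π l = f := by
    rw [← Category.assoc, hh, Category.assoc, B.ι_π, Category.comp_id]
  obtain ⟨s, hs⟩ := B.exists_section hP (f := h ≫ B.π l) fun h0 => hf (by rw [← e, h0, comp_zero])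
  exact ⟨h ≫ B.π l, s, e, hs⟩

variable (hT : Triangle.mk (F.map i) (F.map c) δ ∈ distTriang D) (hA : Subsingleton (Y ⟶ A))

include hT

omit [Mono κ] in
include hA in
-- Otherwise Ext¹(X_l, A') = 0 by Serre duality, and the inclusion of the brick X_l in P would lift
-- to A, which receives nothing from `Y`.
theorem exists_ne_zero_of_isCotwist_step {l : B.J} (hl : ∃ f : A ⟶ B.X l, f ≠ 0) :
    ∃ f : A' ⟶ B.X (B.next l), f ≠ 0 := by
  obtain ⟨f, hf⟩ := hl
  obtain ⟨h, s, -, hs⟩ := B.exists_factor_of_universal hP hc hf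
  by_contra! h0
  have := (subsingleton_hom_shift_left_iff (B.serre l) A').2 (subsingleton_hom_iff.2 h0)
  obtain ⟨t, ht⟩ := exists_comp_mor₂ hT (F.map s) (Subsingleton.elim _ _)
  obtain ⟨t, rfl⟩ := F.map_surjective t
  have ht0 : t = 0 := by
    rw [← Category.id_comp t, ← B.ι_π, Category.assoc, Subsingleton.elim (B.π l ≫ t) 0, comp_zero]
  apply B.id_ne_zero l
  rw [← hs, F.map_injective (a₁ := s) (a₂ := 0) (by
    rw [← ht, ht0, F.map_zero, zero_comp, F.map_zero]),
    zero_comp]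

variable (hF : IsHeartEmbedding F) (φ : S.equiv.functor.obj (F.obj Y) ≅ (F.obj Y)⟦(1 : ℤ)⟧)
  [Linear k 𝒜] [∀ A B : 𝒜, Module.Finite k (A ⟶ B)] {Q : 𝒜} (hQ : Subsingleton (Q ⟶ Y))

include φ hQ

omit hc [Mono κ] [∀ A B : 𝒜, Module.Finite k (A ⟶ B)] in
-- Hom(Q,Y) = 0 gives Ext¹(Y,Q) = 0 by Serre duality, hence Ext¹(P,Q) = 0, so maps A' ⟶ Q extend to
-- A.
theorem surjective_restriction : Function.Surjective (Linear.leftComp k Q i) := by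
  intro x
  have hx : δ ≫ (F.map x)⟦(1 : ℤ)⟧' = 0 := by
    by_contra h
    obtain ⟨ρ, hρ⟩ := (hP.map F).exists_comp_ne_zero h
    have := (subsingleton_hom_shift_left_iff φ Q).2 hQ
    exact hρ (Subsingleton.elim _ _)
  obtain ⟨y, hy⟩ := exists_mor₁_comp hT (F.map x) hx
  obtain ⟨y, rfl⟩ := F.map_surjective y
  exact ⟨y, F.map_injective (by rw [← hy, ← F.map_comp]; rfl)⟩

omit hc [Mono κ] in
theorem finrank_le_of_isCotwist_step :
    Module.finrank k (A' ⟶ Q) ≤ Module.finrank k (A ⟶ Q) :=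
  LinearMap.finrank_le_finrank_of_surjective (surjective_restriction hP hT φ hQ)

omit [Mono κ] in
include hF in
-- The composite A ⟶ P ⟶ X_j ⟶ Q is nonzero because c is epi, and it dies on A'.
theorem finrank_lt_of_isCotwist_step {p : B.X j ⟶ Q} (hp : p ≠ 0)
    (hA : ∃ f : A ⟶ B.X j, f ≠ 0) :
    Module.finrank k (A' ⟶ Q) < Module.finrank k (A ⟶ Q) := by
  refine lt_of_le_of_ne (finrank_le_of_isCotwist_step hP hT φ hQ) fun h => ?_
  obtain ⟨f, hf⟩ := hA
  obtain ⟨h', s, -, hs⟩ := B.exists_factor_of_universal hP hc hf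
  obtain ⟨w, hE⟩ := hF.shortExact_of_distinguished hT
  have : Epi c := hE.epi_g
  have hinj := (LinearMap.injective_iff_surjective_of_finrank_eq_finrank h.symm).2
    (surjective_restriction (k := k) hP hT φ hQ)
  have h0 : c ≫ h' ≫ p = 0 := hinj (by
    change i ≫ c ≫ h' ≫ p = i ≫ 0
    rw [← Category.assoc, w, zero_comp, comp_zero])
  apply hp
  rw [← Category.id_comp p, ← hs, Category.assoc, zero_of_epi_comp c h0, comp_zero]

end

section

variable {c : P ⟶ A} {i : A ⟶ A'} {δ : F.obj A' ⟶ (F.obj P)⟦(1 : ℤ)⟧} (hP : InAdd Y P)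
  (hc : Function.Bijective fun h : Y ⟶ P => h ≫ c)

include hP hc

omit [F.Full] [F.Faithful] [F.Additive] [Mono κ] in
theorem exists_factor_of_universal' {l : B.J} {f : B.X l ⟶ A} (hf : f ≠ 0) :
    ∃ (h : B.X l ⟶ P) (r : P ⟶ B.X l), h ≫ c = f ∧ h ≫ r = 𝟙 _ := by
  obtain ⟨h, hh⟩ := hc.2 (B.π l ≫ f)
  change h ≫ c = B.π l ≫ f at hh
  have e : (B.ι l ≫ h) ≫ c = f := by
    rw [Category.assoc, hh, ← Category.assoc, B.ι_π, Category.id_comp]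
  obtain ⟨s, hs⟩ := B.exists_retraction hP (f := B.ι l ≫ h) fun h0 =>
    hf (by rw [← e, h0, zero_comp])
  exact ⟨B.ι l ≫ h, s, e, hs⟩

variable (hT : Triangle.mk (F.map c) (F.map i) δ ∈ distTriang D) (hA : Subsingleton (A ⟶ Y))

include hT

omit [Mono κ] in
include hA in
-- Dual to the cotwist step, but the label now moves backwards along `next`.
theorem exists_ne_zero_of_isTwist_step {l : B.J} (hl : ∃ f : B.X (B.next l) ⟶ A, f ≠ 0) :
    ∃ f : B.X l ⟶ A', f ≠ 0 := by
  obtain ⟨f, hf⟩ := hl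
  obtain ⟨h, r, -, hr⟩ := B.exists_factor_of_universal' hP hc hf
  by_contra! h0
  have := (subsingleton_hom_shift_right_iff (B.serre l) A').2 (subsingleton_hom_iff.2 h0)
  obtain ⟨t, ht⟩ := exists_mor₁_comp hT (F.map r) (Subsingleton.elim _ _)
  obtain ⟨t, rfl⟩ := F.map_surjective t
  have ht0 : t = 0 := by
    rw [← Category.comp_id t, ← B.ι_π, ← Category.assoc, Subsingleton.elim (t ≫ B.ι _) 0,
      zero_comp]
  apply B.id_ne_zero (B.next l)
  rw [← hr, F.map_injective (a₁ := r) (a₂ := 0) (by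
    rw [← ht, ht0, F.map_zero, comp_zero, F.map_zero]),
    comp_zero]

variable (hF : IsHeartEmbedding F) (φ : S.equiv.functor.obj (F.obj Y) ≅ (F.obj Y)⟦(1 : ℤ)⟧)
  [Linear k 𝒜] [∀ A B : 𝒜, Module.Finite k (A ⟶ B)] {Q : 𝒜} (hQ : Subsingleton (Y ⟶ Q))

include φ hQ

omit hc [Mono κ] [∀ A B : 𝒜, Module.Finite k (A ⟶ B)] in
theorem surjective_corestriction : Function.Surjective (Linear.rightComp k Q i) := by
  intro x
  have hx : F.map x ≫ δ = 0 := by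
    by_contra h
    obtain ⟨ρ, hρ⟩ := (hP.map (F ⋙ shiftFunctor D (1 : ℤ))).exists_comp_ne_zero' h
    have := (subsingleton_hom_shift_right_iff φ Q).2 hQ
    exact hρ (this.elim _ _)
  obtain ⟨y, hy⟩ := exists_comp_mor₂ hT (F.map x) hx
  obtain ⟨y, rfl⟩ := F.map_surjective y
  exact ⟨y, F.map_injective (by rw [← hy, ← F.map_comp]; rfl)⟩

omit hc [Mono κ] in
theorem finrank_le_of_isTwist_step :
    Module.finrank k (Q ⟶ A') ≤ Module.finrank k (Q ⟶ A) :=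
  LinearMap.finrank_le_finrank_of_surjective (surjective_corestriction hP hT φ hQ)

omit [Mono κ] in
include hF in
theorem finrank_lt_of_isTwist_step {p : Q ⟶ B.X j} (hp : p ≠ 0)
    (hA : ∃ f : B.X j ⟶ A, f ≠ 0) :
    Module.finrank k (Q ⟶ A') < Module.finrank k (Q ⟶ A) := by
  refine lt_of_le_of_ne (finrank_le_of_isTwist_step hP hT φ hQ) fun h => ?_
  obtain ⟨f, hf⟩ := hA
  obtain ⟨h', r, -, hr⟩ := B.exists_factor_of_universal' hP hc hf
  obtain ⟨w, hE⟩ := hF.shortExact_of_distinguished hT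
  have : Mono c := hE.mono_f
  have hinj := (LinearMap.injective_iff_surjective_of_finrank_eq_finrank h.symm).2
    (surjective_corestriction (k := k) hP hT φ hQ)
  have h0 : (p ≫ h') ≫ c = 0 := hinj (by
    change ((p ≫ h') ≫ c) ≫ i = 0 ≫ i
    rw [Category.assoc, w, zero_comp, comp_zero])
  apply hp
  rw [← Category.comp_id p, ← hr, ← Category.assoc, zero_of_comp_mono c h0, zero_comp]

end

end BrickDecomposition

theorem not_forall_exists_lt_of_antitone {d : ℕ → ℕ} (hd : ∀ n, d (n + 1) ≤ d n)
    (h : ∀ n, ∃ m, n ≤ m ∧ d (m + 1) < d m) : False := by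
  have hanti : Antitone d := antitone_nat_of_succ_le hd
  have key : ∀ N n, d n = N → False := by
    intro N
    induction N using Nat.strong_induction_on with
    | _ N ih =>
      intro n hn
      obtain ⟨m, hm, hlt⟩ := h n
      exact ih _ (by have := hanti hm; omega) (m + 1) rfl
  exact key _ 0 rfl

namespace BrickDecomposition

variable (B : BrickDecomposition F S Y) [F.Full] [F.Faithful] [F.Additive]
  (hF : IsHeartEmbedding F) (φ : S.equiv.functor.obj (F.obj Y) ≅ (F.obj Y)⟦(1 : ℤ)⟧)
  [Linear k 𝒜] [∀ A B : 𝒜, Module.Finite k (A ⟶ B)] (A : ℕ → 𝒜)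

include hF φ

theorem simple_of_isCotwist (hA : Subsingleton (Y ⟶ A 0)) (hA' : ∃ f : A 0 ⟶ Y, f ≠ 0)
    (h : ∀ n, IsCotwist (F.obj Y) (F.obj (A n)) (F.obj (A (n + 1)))) (j : B.J) :
    Simple (B.X j) := by
  by_contra hj
  obtain ⟨K, κ, _, hκ, hκ'⟩ := B.exists_mono_of_not_simple hj
  have hQ := B.subsingleton_hom_of_cokernel hκ
  have hp := cokernel_π_ne_zero hκ'
  have hAn : ∀ n, Subsingleton (Y ⟶ A n) := by
    intro n
    induction n with
    | zero => exact hA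
    | succ n ih =>
      obtain ⟨P, i, c, δ, hP, hc, hT⟩ := B.exists_triangle_of_isCotwist hF φ ih (h n)
      obtain ⟨w, hE⟩ := hF.shortExact_of_distinguished hT
      have : Mono i := hE.mono_f
      exact subsingleton_hom_iff.2 fun f => zero_of_comp_mono i (Subsingleton.elim _ _)
  choose P i c δ hP hc hT using fun n => B.exists_triangle_of_isCotwist hF φ (hAn n) (h n)
  obtain ⟨f, hf⟩ := hA'
  obtain ⟨l, hl⟩ := B.exists_π_ne_zero hf
  have hne : ∀ n, ∃ f : A n ⟶ B.X (B.next^[n] l), f ≠ 0 := by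
    intro n
    induction n with
    | zero => exact ⟨_, hl⟩
    | succ n ih =>
      rw [Function.iterate_succ_apply']
      exact B.exists_ne_zero_of_isCotwist_step (hP n) (hc n) (hT n) (hAn n) ih
  refine not_forall_exists_lt_of_antitone (d := fun n => Module.finrank k (A n ⟶ cokernel κ))
    (fun n => finrank_le_of_isCotwist_step (hP n) (hT n) φ hQ) fun n => ?_
  -- After every index n the label returns to the class of j, giving another strict drop.
  obtain ⟨m, ⟨e⟩⟩ := B.transitive (B.next^[n] l) j
  refine ⟨m + n, Nat.le_add_left n m, B.finrank_lt_of_isCotwist_step (hP _) (hc _) (hT _) hF φ hQ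
    hp ?_⟩
  obtain ⟨g, hg⟩ := hne (m + n)
  rw [← Function.iterate_add_apply] at e
  exact ⟨g ≫ e.hom, fun h0 => hg (by rw [← cancel_mono e.hom, h0, zero_comp])⟩

theorem simple_of_isTwist (hA : Subsingleton (A 0 ⟶ Y)) (hA' : ∃ f : Y ⟶ A 0, f ≠ 0)
    (h : ∀ n, IsTwist (F.obj Y) (F.obj (A n)) (F.obj (A (n + 1)))) (j : B.J) :
    Simple (B.X j) := by
  by_contra hj
  obtain ⟨K, κ, _, hκ, hκ'⟩ := B.exists_mono_of_not_simple hj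
  have hK := B.subsingleton_hom_of_mono hκ'
  have hAn : ∀ n, Subsingleton (A n ⟶ Y) := by
    intro n
    induction n with
    | zero => exact hA
    | succ n ih =>
      obtain ⟨P, c, i, δ, hP, hc, hT⟩ := B.exists_triangle_of_isTwist hF φ ih (h n)
      obtain ⟨w, hE⟩ := hF.shortExact_of_distinguished hT
      have : Epi i := hE.epi_g
      exact subsingleton_hom_iff.2 fun f => zero_of_epi_comp i (Subsingleton.elim _ _)
  choose P c i δ hP hc hT using fun n => B.exists_triangle_of_isTwist hF φ (hAn n) (h n)
  have hiter : ∀ m n l, (∃ f : B.X (B.next^[m] l) ⟶ A n, f ≠ 0) →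
      ∃ f : B.X l ⟶ A (n + m), f ≠ 0 := by
    intro m
    induction m with
    | zero => exact fun n l h => h
    | succ m ih =>
      intro n l hl
      rw [Function.iterate_succ_apply'] at hl
      have := ih (n + 1) l (B.exists_ne_zero_of_isTwist_step (hP n) (hc n) (hT n) (hAn n) hl)
      rwa [add_right_comm, add_assoc] at this
  -- Labels move backwards here, so the current label is first written as a forward iterate of the
  -- desired one; `hiter` then undoes the iteration.
  have hmove : ∀ n l l', (∃ f : B.X l ⟶ A n, f ≠ 0) →
      ∃ m, ∃ f : B.X (B.next^[m] l') ⟶ A n, f ≠ 0 := by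
    rintro n l l' ⟨g, hg⟩
    obtain ⟨m, ⟨e⟩⟩ := B.transitive l' l
    exact ⟨m, e.hom ≫ g, fun h0 => hg (by rw [← cancel_epi e.hom, h0, comp_zero])⟩
  obtain ⟨f, hf⟩ := hA'
  obtain ⟨l, hl⟩ := B.exists_ι_ne_zero hf
  have hne : ∀ n, ∃ l, ∃ f : B.X l ⟶ A n, f ≠ 0 := by
    intro n
    induction n with
    | zero => exact ⟨l, _, hl⟩
    | succ n ih =>
      obtain ⟨l, hl⟩ := ih
      obtain ⟨m, hm⟩ := hmove n l (B.next l) hl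
      rw [← Function.iterate_succ_apply, Function.iterate_succ_apply'] at hm
      exact ⟨_, B.exists_ne_zero_of_isTwist_step (hP n) (hc n) (hT n) (hAn n) hm⟩
  refine not_forall_exists_lt_of_antitone (d := fun n => Module.finrank k (K ⟶ A n))
    (fun n => finrank_le_of_isTwist_step (hP n) (hT n) φ hK) fun n => ?_
  obtain ⟨l, hl⟩ := hne n
  obtain ⟨m, hm⟩ := hmove n l j hl
  exact ⟨n + m, Nat.le_add_right n m, B.finrank_lt_of_isTwist_step (hP _) (hc _) (hT _) hF φ hK
    hκ (hiter m n j hm)⟩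

end BrickDecomposition

end SphericalTube

/-! ### Iterated extensions of bricks and the tube. -/

namespace SphericalTube

variable {𝒜 : Type u} [Category.{v} 𝒜] [Abelian 𝒜]

section Extensions

variable {V V' V'' X Q : 𝒜}

/-- If `V'' ⊆ V' ⊆ V`, then `V / V''` is an extension of `V / V'` by `V' / V''`. -/
theorem exists_quotient_extension {i' : V'' ⟶ V'} {q : V' ⟶ X} {w' : i' ≫ q = 0}
    (h' : (ShortComplex.mk i' q w').ShortExact) {i : V' ⟶ V} {p : V ⟶ Q} {w : i ≫ p = 0}
    (h : (ShortComplex.mk i p w).ShortExact) :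
    ∃ (E : 𝒜) (e : V ⟶ E) (κ : X ⟶ E) (r : E ⟶ Q) (w₁ : (i' ≫ i) ≫ e = 0) (w₂ : κ ≫ r = 0),
      (ShortComplex.mk (i' ≫ i) e w₁).ShortExact ∧ (ShortComplex.mk κ r w₂).ShortExact ∧
        e ≫ r = p := by
  have : Mono i' := h'.mono_f
  have : Epi q := h'.epi_g
  have : Mono i := h.mono_f
  have : Epi p := h.epi_g
  let e := cokernel.π (i' ≫ i)
  have hE : (ShortComplex.mk (i' ≫ i) e (cokernel.condition _)).ShortExact :=
    { exact := ShortComplex.exact_of_g_is_cokernel _ (cokernelIsCokernel _) }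
  obtain ⟨κ, hκ⟩ := h'.exact.desc' (i ≫ e) (by
    change i' ≫ i ≫ e = 0
    rw [← Category.assoc]; exact cokernel.condition _)
  obtain ⟨r, hr⟩ := hE.exact.desc' p (by
    change (i' ≫ i) ≫ p = 0
    rw [Category.assoc, w, comp_zero])
  change q ≫ κ = i ≫ e at hκ
  change e ≫ r = p at hr
  have w₂ : κ ≫ r = 0 := by
    rw [← cancel_epi q, comp_zero, ← Category.assoc, hκ, Category.assoc, hr, w]
  have : Epi r := epi_of_epi_fac hr
  have : Mono κ := Preadditive.mono_of_cancel_zero κ fun {T} x hx => by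
    obtain ⟨T', π, _, y, hy⟩ := surjective_up_to_refinements_of_epi q x
    obtain ⟨z, hz⟩ := hE.exact.lift' (y ≫ i) (by
      change (y ≫ i) ≫ e = 0
      rw [Category.assoc, ← hκ, ← Category.assoc, ← hy, Category.assoc, hx, comp_zero])
    change z ≫ i' ≫ i = y ≫ i at hz
    rw [← Category.assoc, cancel_mono] at hz
    rw [← cancel_epi π, comp_zero, hy, ← hz, Category.assoc, w', comp_zero]
  refine ⟨_, e, κ, r, cokernel.condition _, w₂, hE, { exact := ?_ }, hr⟩
  refine ShortComplex.exact_of_g_is_cokernel _ (CokernelCofork.IsColimit.ofπ' r w₂ fun t ht => ?_)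
  have hd := h.exact.desc' (e ≫ t) (by
    change i ≫ e ≫ t = 0
    rw [← Category.assoc, ← hκ, Category.assoc, ht, comp_zero])
  refine ⟨hd.choose, ?_⟩
  rw [← cancel_epi e, ← Category.assoc, hr]
  exact hd.choose_spec

/-- If `X ⊆ V / Q`, the preimage of `X` in `V` is an extension of `X` by `Q`. -/
theorem exists_sub_extension {i : Q ⟶ V} {p : V ⟶ V'} {w : i ≫ p = 0}
    (h : (ShortComplex.mk i p w).ShortExact) {κ : X ⟶ V'} {r : V' ⟶ V''} {w' : κ ≫ r = 0}
    (h' : (ShortComplex.mk κ r w').ShortExact) :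
    ∃ (E : 𝒜) (e : E ⟶ V) (j : Q ⟶ E) (t : E ⟶ X) (w₁ : e ≫ p ≫ r = 0) (w₂ : j ≫ t = 0),
      (ShortComplex.mk e (p ≫ r) w₁).ShortExact ∧ (ShortComplex.mk j t w₂).ShortExact ∧
        j ≫ e = i := by
  have : Mono i := h.mono_f
  have : Epi p := h.epi_g
  have : Mono κ := h'.mono_f
  have : Epi r := h'.epi_g
  let e := kernel.ι (p ≫ r)
  have hE : (ShortComplex.mk e (p ≫ r) (kernel.condition _)).ShortExact :=
    { exact := ShortComplex.exact_of_f_is_kernel _ (kernelIsKernel _) }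
  obtain ⟨t, ht⟩ := h'.exact.lift' (e ≫ p) (by
    change (e ≫ p) ≫ r = 0
    rw [Category.assoc]; exact kernel.condition _)
  obtain ⟨j, hj⟩ := hE.exact.lift' i (by
    change i ≫ p ≫ r = 0
    rw [← Category.assoc, w, zero_comp])
  change t ≫ κ = e ≫ p at ht
  change j ≫ e = i at hj
  have w₂ : j ≫ t = 0 := by
    rw [← cancel_mono κ, zero_comp, Category.assoc, ht, ← Category.assoc, hj, w]
  have : Mono j := mono_of_mono_fac hj
  have : Epi t := (epi_iff_surjective_up_to_refinements t).2 fun {T} y => by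
    obtain ⟨T', π, hπ, x, hx⟩ := surjective_up_to_refinements_of_epi p (y ≫ κ)
    obtain ⟨x', hx'⟩ := hE.exact.lift' x (by
      change x ≫ p ≫ r = 0
      rw [← Category.assoc, ← hx, Category.assoc, Category.assoc, w', comp_zero, comp_zero])
    change x' ≫ e = x at hx'
    refine ⟨T', π, hπ, x', ?_⟩
    rw [← cancel_mono κ, Category.assoc, Category.assoc, ht, hx, ← hx', Category.assoc]
  refine ⟨_, e, j, t, kernel.condition _, w₂, hE, { exact := ?_ }, hj⟩
  refine ShortComplex.exact_of_f_is_kernel _ (KernelFork.IsLimit.ofι' j w₂ fun x hx => ?_)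
  have hd := h.exact.lift' (x ≫ e) (by
    change (x ≫ e) ≫ p = 0
    rw [Category.assoc, ← ht, ← Category.assoc, hx, zero_comp])
  refine ⟨hd.choose, ?_⟩
  rw [← cancel_mono e, Category.assoc, hj]
  exact hd.choose_spec

end Extensions

section Filtrations

variable {J : Type*} (X : J → 𝒜)

/-- `V` is an iterated extension of `n` of the objects `X a`, built by adding quotients. -/
def TopFiltered : ℕ → 𝒜 → Prop
  | 0, V => IsZero V
  | n + 1, V => ∃ (V' : 𝒜) (a : J) (i : V' ⟶ V) (p : V ⟶ X a) (w : i ≫ p = 0),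
      (ShortComplex.mk i p w).ShortExact ∧ TopFiltered n V'

/-- `V` is an iterated extension of `n` of the objects `X a`, built by adding subobjects. -/
def BottomFiltered : ℕ → 𝒜 → Prop
  | 0, V => IsZero V
  | n + 1, V => ∃ (V' : 𝒜) (a : J) (i : X a ⟶ V) (p : V ⟶ V') (w : i ≫ p = 0),
      (ShortComplex.mk i p w).ShortExact ∧ BottomFiltered n V'

variable {X}

theorem topFiltered_one (a : J) : TopFiltered X 1 (X a) :=
  ⟨kernel (𝟙 (X a)), a, kernel.ι _, 𝟙 _, kernel.condition _,
    { exact := ShortComplex.exact_of_f_is_kernel _ (kernelIsKernel _) }, by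
      rw [TopFiltered, IsZero.iff_id_eq_zero, ← cancel_mono (kernel.ι (𝟙 (X a)))]
      simp [kernel.ι_of_mono]⟩

theorem bottomFiltered_one (a : J) : BottomFiltered X 1 (X a) :=
  ⟨cokernel (𝟙 (X a)), a, 𝟙 _, cokernel.π _, cokernel.condition _,
    { exact := ShortComplex.exact_of_g_is_cokernel _ (cokernelIsCokernel _) }, by
      rw [BottomFiltered, IsZero.iff_id_eq_zero, ← cancel_epi (cokernel.π (𝟙 (X a)))]
      simp [cokernel.π_of_epi]⟩

theorem isIso_of_isZero_left {E : ShortComplex 𝒜} (hE : E.ShortExact) (h : IsZero E.X₁) :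
    IsIso E.g := by
  have := hE.epi_g
  have : Mono E.g := (hE.exact.mono_g_iff).2 (h.eq_of_src _ _)
  exact isIso_of_mono_of_epi E.g

theorem isIso_of_isZero_right {E : ShortComplex 𝒜} (hE : E.ShortExact) (h : IsZero E.X₃) :
    IsIso E.f := by
  have := hE.mono_f
  have : Epi E.f := (hE.exact.epi_f_iff).2 (h.eq_of_tgt _ _)
  exact isIso_of_mono_of_epi E.f

theorem TopFiltered.of_iso {n : ℕ} {V W : 𝒜} (h : TopFiltered X n V) (e : V ≅ W) :
    TopFiltered X n W := by
  cases n with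
  | zero => exact IsZero.of_iso h e.symm
  | succ n =>
    obtain ⟨V', a, i, p, w, hE, h⟩ := h
    refine ⟨V', a, i ≫ e.hom, e.inv ≫ p, by simp [w], ?_, h⟩
    let E : ShortComplex.mk i p w ≅ ShortComplex.mk (i ≫ e.hom) (e.inv ≫ p) (by simp [w]) :=
      ShortComplex.isoMk (Iso.refl _) e (Iso.refl _) (by simp) (by simp)
    exact ShortComplex.shortExact_of_iso E hE

/-- The top layer of V' stays on top of V; the new brick is pushed down into the preimage of the
kernel, by induction. -/
theorem TopFiltered.extension {n : ℕ} {a : J} {V V' : 𝒜} (h : TopFiltered X n V') {i : X a ⟶ V}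
    {p : V ⟶ V'} {w : i ≫ p = 0} (hE : (ShortComplex.mk i p w).ShortExact) :
    TopFiltered X (n + 1) V := by
  induction n generalizing V V' with
  | zero =>
    have : IsIso i := isIso_of_isZero_right hE h
    exact (topFiltered_one a).of_iso (asIso i)
  | succ n ih =>
    obtain ⟨V'', b, κ, r, w', hE', h'⟩ := h
    obtain ⟨E, e, j, t, w₁, w₂, h₁, h₂, -⟩ := exists_sub_extension hE hE'
    exact ⟨E, b, e, p ≫ r, w₁, h₁, ih h' h₂⟩

theorem BottomFiltered.topFiltered {n : ℕ} {V : 𝒜} (h : BottomFiltered X n V) :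
    TopFiltered X n V := by
  induction n generalizing V with
  | zero => exact h
  | succ n ih =>
    obtain ⟨V', a, i, p, w, hE, h⟩ := h
    exact (ih h).extension hE

/-- Intersect the filtration with K: simplicity makes each layer of K zero or the whole brick. -/
theorem TopFiltered.exists_of_mono (hX : ∀ a, Simple (X a)) {n : ℕ} {V K : 𝒜}
    (h : TopFiltered X n V) (m : K ⟶ V) [Mono m] : ∃ l, TopFiltered X l K := by
  induction n generalizing V K with
  | zero =>
    refine ⟨0, ?_⟩
    rw [TopFiltered, IsZero.iff_id_eq_zero, ← cancel_mono m]
    exact IsZero.eq_of_tgt h _ _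
  | succ n ih =>
    obtain ⟨V', a, i, p, w, hE, h⟩ := h
    have : Mono i := hE.mono_f
    have := hX a
    by_cases h0 : m ≫ p = 0
    · obtain ⟨m', hm'⟩ := hE.exact.lift' m h0
      change m' ≫ i = m at hm'
      have : Mono m' := mono_of_mono_fac hm'
      exact ih h m'
    · have : Epi (m ≫ p) := epi_of_nonzero_to_simple h0
      obtain ⟨m', hm'⟩ := hE.exact.lift' (kernel.ι (m ≫ p) ≫ m) (by
        rw [Category.assoc]; exact kernel.condition _)
      change m' ≫ i = kernel.ι (m ≫ p) ≫ m at hm'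
      have : Mono m' := mono_of_mono_fac hm'
      obtain ⟨l, hl⟩ := ih h m'
      exact ⟨l + 1, kernel (m ≫ p), a, kernel.ι _, m ≫ p, kernel.condition _,
        { exact := ShortComplex.exact_of_f_is_kernel _ (kernelIsKernel _) }, hl⟩

end Filtrations

section Tubes

theorem isDirectSummand_of_retract {X Y : 𝒜} (i : X ⟶ Y) (r : Y ⟶ X) (h : i ≫ r = 𝟙 X) :
    IsDirectSummand X Y := by
  obtain ⟨W, j, t, hjt, hsum, hj, ht⟩ := exists_complement r i h
  exact ⟨W, ⟨⟨biprod.lift r t, biprod.desc i j, by rw [biprod.lift_desc, hsum],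
    by ext <;> simp [h, hjt, hj, ht]⟩⟩⟩

theorem Splitting.isDirectSummand {Y : 𝒜} (s : Splitting Y) (a : s.J) : IsDirectSummand (s.X a) Y :=
  isDirectSummand_of_retract (s.ι a) (s.π a) (s.ι_π a)

theorem TopFiltered.inTube {Y : 𝒜} (s : Splitting Y) {n : ℕ} {V : 𝒜} (h : TopFiltered s.X n V) :
    InTube Y V := by
  induction n generalizing V with
  | zero => exact .zero V h
  | succ n ih =>
    obtain ⟨V', a, i, p, w, hE, h⟩ := h
    exact .extension _ hE (ih h) (s.isDirectSummand a)

theorem IsDirectSummand.exists_retract {X Y : 𝒜} (h : IsDirectSummand X Y) :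
    ∃ (i : X ⟶ Y) (r : Y ⟶ X), i ≫ r = 𝟙 X := by
  obtain ⟨W, ⟨e⟩⟩ := h
  exact ⟨biprod.inl ≫ e.inv, e.hom ≫ biprod.fst, by simp⟩

theorem InTube.exists_hom_to {Y V : 𝒜} (h : InTube Y V) (hV : ¬ IsZero V) :
    ∃ f : V ⟶ Y, f ≠ 0 := by
  induction h with
  | zero A hA => exact (hV hA).elim
  | extension E hE h₁ h₃ ih =>
    obtain ⟨i, r, hir⟩ := h₃.exists_retract
    have := hE.epi_g
    by_cases h0 : E.g = 0
    · have : IsIso E.f := isIso_of_isZero_right hE (by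
        rw [IsZero.iff_id_eq_zero, ← cancel_epi E.g, h0, zero_comp, zero_comp])
      obtain ⟨f, hf⟩ := ih fun h => hV (h.of_iso (asIso E.f).symm)
      exact ⟨inv E.f ≫ f, fun h => hf (by rw [← cancel_epi (inv E.f), h, comp_zero])⟩
    · exact ⟨E.g ≫ i, fun h => h0 (by
        rw [← Category.comp_id E.g, ← hir, ← Category.assoc, h, zero_comp])⟩

theorem InTube.exists_hom_from {Y V : 𝒜} (h : InTube Y V) (hV : ¬ IsZero V) :
    ∃ f : Y ⟶ V, f ≠ 0 := by
  induction h with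
  | zero A hA => exact (hV hA).elim
  | extension E hE h₁ h₃ ih =>
    obtain ⟨i, r, hir⟩ := h₃.exists_retract
    have := hE.mono_f
    by_cases h0 : IsZero E.X₁
    · have : IsIso E.g := isIso_of_isZero_left hE h0
      refine ⟨r ≫ inv E.g, fun h => hV ?_⟩
      refine IsZero.of_iso ?_ (asIso E.g)
      rw [IsZero.iff_id_eq_zero, ← hir, ← cancel_mono (inv E.g), Category.assoc, h, comp_zero,
        zero_comp]
    · obtain ⟨f, hf⟩ := ih h0
      exact ⟨f ≫ E.f, fun h => hf (zero_of_comp_mono _ h)⟩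

end Tubes

end SphericalTube

/-! ### Extremality of the tube. -/

namespace SphericalTube

variable {k : Type*} [Field k] {𝒜 : Type u} [Category.{v} 𝒜] [Abelian 𝒜]
  {D : Type*} [Category D] [Preadditive D] [Linear k D] [HasZeroObject D] [HasShift D ℤ]
  [∀ n : ℤ, (shiftFunctor D n).Additive] [Pretriangulated D]
  {F : 𝒜 ⥤ D} {S : SerreFunctor k D} {Y : 𝒜}

section Paths

variable {J : Type*} (X : J → 𝒜)

/-- No composite `X c → A → V` is nonzero if `V` is an iterated extension of `n` of the `X a`. -/
def NoPathInto (A : 𝒜) (n : ℕ) : Prop :=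
  ∀ V, BottomFiltered X n V → ∀ (c : J) (g : X c ⟶ A) (f : A ⟶ V), g ≫ f = 0

/-- No composite `W → A → X c` is nonzero if `W` is an iterated extension of `n` of the `X a`. -/
def NoPathFrom (A : 𝒜) (n : ℕ) : Prop :=
  ∀ W, TopFiltered X n W → ∀ (c : J) (g : W ⟶ A) (f : A ⟶ X c), g ≫ f = 0

end Paths

/-- Iterating the relation shows that no power of l ≫ g is zero, and an endomorphism of an
indecomposable that is not nilpotent is invertible. -/
theorem isIso_comp_of_comp_eq [Linear k 𝒜] {A W Z : 𝒜} [Module.Finite k (A ⟶ A)]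
    (hA : Indecomposable A) {g : W ⟶ A} {l : A ⟶ W} {π : W ⟶ Z} (hπ : π ≠ 0)
    (h : g ≫ l ≫ π = π) : IsIso (l ≫ g) := by
  let x : End A := l ≫ g
  refine (isIso_or_isNilpotent (k := k) hA x).resolve_right fun ⟨m, hm⟩ => hπ ?_
  have key : ∀ m : ℕ, g ≫ (show A ⟶ A from x ^ m) ≫ l ≫ π = π := by
    intro m
    induction m with
    | zero =>
      change g ≫ 𝟙 A ≫ l ≫ π = π
      rw [Category.id_comp, h]
    | succ m ih =>
      rw [pow_succ]
      change g ≫ ((l ≫ g) ≫ (show A ⟶ A from x ^ m)) ≫ l ≫ π = π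
      rw [Category.assoc, Category.assoc, ih, h]
  rw [← key m, show (show A ⟶ A from x ^ m) = 0 from hm, zero_comp, comp_zero]

theorem isIso_comp_of_comp_eq' [Linear k 𝒜] {A V Z : 𝒜} [Module.Finite k (A ⟶ A)]
    (hA : Indecomposable A) {f : A ⟶ V} {l : V ⟶ A} {κ : Z ⟶ V} (hκ : κ ≠ 0)
    (h : κ ≫ l ≫ f = κ) : IsIso (f ≫ l) := by
  let x : End A := f ≫ l
  refine (isIso_or_isNilpotent (k := k) hA x).resolve_right fun ⟨m, hm⟩ => hκ ?_
  have key : ∀ m : ℕ, κ ≫ l ≫ (show A ⟶ A from x ^ m) ≫ f = κ := by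
    intro m
    induction m with
    | zero =>
      change κ ≫ l ≫ 𝟙 A ≫ f = κ
      rw [Category.id_comp, h]
    | succ m ih =>
      rw [pow_succ]
      change κ ≫ l ≫ ((f ≫ l) ≫ (show A ⟶ A from x ^ m)) ≫ f = κ
      calc _ = (κ ≫ l ≫ f) ≫ l ≫ (show A ⟶ A from x ^ m) ≫ f := by simp only [Category.assoc]
        _ = κ := by rw [h, ih]
  rw [← key m, show (show A ⟶ A from x ^ m) = 0 from hm, zero_comp, comp_zero, comp_zero]

namespace BrickDecomposition

variable (B : BrickDecomposition F S Y)

theorem exists_iso_next (b : B.J) : ∃ c, Nonempty (B.X (B.next c) ≅ B.X b) := by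
  obtain ⟨m, h⟩ := B.transitive (B.next b) b
  rw [← Function.iterate_succ_apply, Function.iterate_succ_apply'] at h
  exact ⟨_, h⟩

variable [F.Full] [F.Faithful] [F.Additive] (hF : IsHeartEmbedding F)

section Lifting

variable {A V V' Q : 𝒜}

include hF

/-- Lifting along an extension with kernel a brick. -/
theorem exists_lift {b : B.J} {i : B.X b ⟶ V} {p : V ⟶ Q} {w : i ≫ p = 0}
    (hE : (ShortComplex.mk i p w).ShortExact) (f : A ⟶ Q)
    (hf : ∀ (c : B.J) (u : B.X c ⟶ A), u ≫ f = 0) : ∃ f' : A ⟶ V, f' ≫ p = f := by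
  obtain ⟨δ, hT⟩ := hF.exists_triangle _ hE
  -- Serre duality controls Ext¹(-, X_{next c}) by maps out of X_c, so X_b has to be presented in
  -- this form.
  obtain ⟨c, ⟨e⟩⟩ := B.exists_iso_next b
  have h0 : F.map f ≫ δ = 0 := map_comp_eq_zero
    (B.serre c ≪≫ (F ⋙ shiftFunctor D (1 : ℤ)).mapIso e) f δ (hf c)
  obtain ⟨y, hy⟩ := exists_comp_mor₂ hT (F.map f) h0
  obtain ⟨y, rfl⟩ := F.map_surjective y
  exact ⟨y, F.map_injective (by rw [F.map_comp]; exact hy)⟩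

/-- Extending along an extension with cokernel a brick. -/
theorem exists_desc {b : B.J} {i : Q ⟶ V} {p : V ⟶ B.X b} {w : i ≫ p = 0}
    (hE : (ShortComplex.mk i p w).ShortExact) (g : Q ⟶ A)
    (hg : ∀ (c : B.J) (u : A ⟶ B.X c), g ≫ u = 0) : ∃ g' : V ⟶ A, i ≫ g' = g := by
  obtain ⟨δ, hT⟩ := hF.exists_triangle _ hE
  have h0 : δ ≫ (F.map g)⟦(1 : ℤ)⟧' = 0 :=
    comp_shift_eq_zero (B.serre b) δ g (hg (B.next b))
  obtain ⟨y, hy⟩ := exists_mor₁_comp hT (F.map g) h0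
  obtain ⟨y, rfl⟩ := F.map_surjective y
  exact ⟨y, F.map_injective (by rw [F.map_comp]; exact hy)⟩

/-- The kernel is crossed one brick at a time from its top, the quotient already reached growing
from length m to m + n - 1. These are the lengths at which the path condition is needed. -/
theorem exists_lift_of_topFiltered {n m : ℕ} (hV' : TopFiltered B.X n V')
    (hQ : BottomFiltered B.X m Q) {i : V' ⟶ V} {p : V ⟶ Q} {w : i ≫ p = 0}
    (hE : (ShortComplex.mk i p w).ShortExact) (f : A ⟶ Q)
    (hA : ∀ l < m + n, NoPathInto B.X A l) : ∃ f' : A ⟶ V, f' ≫ p = f := by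
  induction n generalizing m V' Q with
  | zero =>
    have : IsIso p := isIso_of_isZero_left hE hV'
    exact ⟨f ≫ inv p, by simp⟩
  | succ n ih =>
    obtain ⟨V'', b, i', q, w', hE', h⟩ := hV'
    obtain ⟨E, e, κ, r, w₁, w₂, h₁, h₂, rfl⟩ := exists_quotient_extension hE' hE
    obtain ⟨f₁, rfl⟩ := B.exists_lift hF h₂ f fun c u => hA m (by omega) Q hQ c u f
    obtain ⟨f', rfl⟩ := ih h (m := m + 1) ⟨Q, b, κ, r, w₂, h₂, hQ⟩ h₁ f₁
      fun l hl => hA l (by omega)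
    exact ⟨f', (Category.assoc _ _ _).symm⟩

theorem exists_desc_of_bottomFiltered {n m : ℕ} (hV' : BottomFiltered B.X n V')
    (hQ : TopFiltered B.X m Q) {i : Q ⟶ V} {p : V ⟶ V'} {w : i ≫ p = 0}
    (hE : (ShortComplex.mk i p w).ShortExact) (g : Q ⟶ A)
    (hA : ∀ l < m + n, NoPathFrom B.X A l) : ∃ g' : V ⟶ A, i ≫ g' = g := by
  induction n generalizing m V' Q with
  | zero =>
    have : IsIso i := isIso_of_isZero_right hE hV'
    exact ⟨inv i ≫ g, by simp⟩
  | succ n ih =>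
    obtain ⟨V'', b, κ, r, w', hE', h⟩ := hV'
    obtain ⟨E, e, j, t, w₁, w₂, h₁, h₂, rfl⟩ := exists_sub_extension hE hE'
    obtain ⟨g₁, rfl⟩ := B.exists_desc hF h₂ g fun c u => hA m (by omega) Q hQ c g u
    obtain ⟨g', rfl⟩ := ih h (m := m + 1) ⟨Q, b, j, t, w₂, h₂, hQ⟩ h₁ g₁
      fun l hl => hA l (by omega)
    exact ⟨g', Category.assoc _ _ _⟩

end Lifting

variable [Linear k 𝒜] [∀ A B : 𝒜, Module.Finite k (A ⟶ B)] (hs : ∀ a, Simple (B.X a))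

include hF

include hs in
-- Both halves are proved together. A shortest path X_c ⟶ A ⟶ V must land isomorphically on the
-- bottom brick of V. The shorter `NoPathFrom` statements extend the brick's map to A over all of V,
-- so A becomes a retract of V and, the bricks being simple, lies in the tube. Dually for paths out
-- of W.
theorem noPath_of_not_inTube {A : 𝒜} (hA : Indecomposable A) (hA' : ¬ InTube Y A) (n : ℕ) :
    NoPathInto B.X A n ∧ NoPathFrom B.X A n := by
  have hmono : ∀ {l : ℕ} {W : 𝒜}, TopFiltered B.X l W → ∀ (x : A ⟶ W) (y : W ⟶ A),
      ¬ IsIso (x ≫ y) := fun hW x y _ => hA' (by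
    have : Mono x := by
      have : Mono (x ≫ y) := inferInstance
      exact mono_of_mono x y
    obtain ⟨l, hl⟩ := hW.exists_of_mono hs x
    exact hl.inTube B.toSplitting)
  induction n using Nat.strong_induction_on with
  | _ n ih =>
    rcases n with _ | n
    · exact ⟨fun V hV c g f => IsZero.eq_of_tgt hV _ _, fun W hW c g f => IsZero.eq_of_src hW _ _⟩
    constructor
    · intro V hV c g f
      by_contra hne
      obtain ⟨V', a, κ, p, w, hE, hV'⟩ := id hV
      have : Mono κ := hE.mono_f
      obtain ⟨h, hh⟩ := hE.exact.lift' (g ≫ f) (by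
        rw [Category.assoc]; exact (ih n (by omega)).1 V' hV' c g (f ≫ p))
      change h ≫ κ = g ≫ f at hh
      have hh0 : h ≠ 0 := fun h0 => hne (by rw [← hh, h0, zero_comp])
      have := B.isIso_of_ne_zero h hh0
      obtain ⟨l, hl⟩ := B.exists_desc_of_bottomFiltered hF hV' (topFiltered_one a) hE (inv h ≫ g)
        fun l hl => (ih l (by omega)).2
      have hκ : κ ≠ 0 := fun h0 => hne (hh.symm.trans ((h ≫= h0).trans comp_zero))
      refine hmono hV.topFiltered f l (isIso_comp_of_comp_eq' (k := k) hA hκ ?_)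
      rw [← Category.assoc, hl, Category.assoc, ← hh, IsIso.inv_hom_id_assoc]
    · intro W hW c g f
      by_contra hne
      obtain ⟨W', a, i, π, w, hE, hW'⟩ := id hW
      have : Epi π := hE.epi_g
      obtain ⟨h, hh⟩ := hE.exact.desc' (g ≫ f) (by
        rw [← Category.assoc]; exact (ih n (by omega)).2 W' hW' c (i ≫ g) f)
      change π ≫ h = g ≫ f at hh
      have hh0 : h ≠ 0 := fun h0 => hne (by rw [← hh, h0, comp_zero])
      have := B.isIso_of_ne_zero h hh0
      obtain ⟨l, hl⟩ := B.exists_lift_of_topFiltered hF hW' (bottomFiltered_one a) hE (f ≫ inv h)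
        fun l hl => (ih l (by omega)).1
      have hπ : π ≠ 0 := fun h0 => hne (by rw [← hh, h0, zero_comp])
      refine hmono hW l g (isIso_comp_of_comp_eq (k := k) hA hπ ?_)
      rw [hl, ← Category.assoc, ← hh, Category.assoc, IsIso.hom_inv_id, Category.comp_id]

/-- `U` is a quotient of `A` and an iterated extension of bricks, receiving a nonzero morphism
from the brick `X a`. -/
structure IsTowerQuotient (A U : 𝒜) (a : B.J) : Prop where
  exists_filtered : ∃ m, BottomFiltered B.X m U
  exists_epi : ∃ q : A ⟶ U, Epi q
  exists_hom : ∃ f : B.X a ⟶ U, f ≠ 0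

include hs

/-- The nonzero map X_a ⟶ U yields a nonsplit extension U' of U by X_{next a}. Absence of paths
lifts A ⟶ U to U' and extends any map X_{next a} ⟶ C to U'; such an extension does not come from U,
hence the strict inequality. -/
theorem IsTowerQuotient.exists_succ {A C U : 𝒜} {a : B.J} (h : B.IsTowerQuotient A U a)
    (hA : ∀ n, NoPathInto B.X A n) (hC : ∀ n, NoPathFrom B.X C n) :
    ∃ U', B.IsTowerQuotient A U' (B.next a) ∧
      Module.finrank k (U ⟶ C) ≤ Module.finrank k (U' ⟶ C) ∧
      ((∃ v : B.X (B.next a) ⟶ C, v ≠ 0) →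
        Module.finrank k (U ⟶ C) < Module.finrank k (U' ⟶ C)) := by
  obtain ⟨⟨m, hU⟩, ⟨q, hq⟩, ⟨f, hf⟩⟩ := h
  obtain ⟨δ, hδ⟩ : ∃ δ : F.obj U ⟶ (F.obj (B.X (B.next a)))⟦(1 : ℤ)⟧, δ ≠ 0 := by
    by_contra! h0
    have := (subsingleton_hom_shift_right_iff (B.serre a) U).1 (subsingleton_hom_iff.2 h0)
    exact hf (Subsingleton.elim _ _)
  obtain ⟨U', κ, p, w, hE, hT⟩ := hF.exists_extension δ
  have : Mono κ := hE.mono_f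
  have : Epi p := hE.epi_g
  have := hs (B.next a)
  obtain ⟨q', rfl⟩ := B.exists_lift hF hE q fun c u => hA m U hU c u q
  have hκ : ¬ ∃ r : U' ⟶ B.X (B.next a), κ ≫ r = 𝟙 _ := fun ⟨r, hr⟩ => hδ (by
    have h0 : δ ≫ (F.map κ)⟦(1 : ℤ)⟧' = 0 := comp_distTriang_mor_zero₃₁ _ hT
    rw [← Category.comp_id δ, ← CategoryTheory.Functor.map_id, ← F.map_id, ← hr, F.map_comp,
      Functor.map_comp, ← Category.assoc, h0, zero_comp])
  have hzero : ∀ {T : 𝒜} (t : U' ⟶ T), q' ≫ t = 0 → κ ≫ t = 0 → t = 0 := fun {T} t h₁ h₂ => by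
    obtain ⟨y, hy⟩ := hE.exact.desc' t h₂
    change p ≫ y = t at hy
    rw [← hy, ← Category.assoc] at h₁
    rw [← hy, zero_of_epi_comp _ h₁, comp_zero]
  -- The simple kernel surjects onto the cokernel of q'. If that cokernel were nonzero it would be
  -- isomorphic to the kernel and split the extension.
  have hepi : Epi q' := Preadditive.epi_of_cokernel_zero (by
    by_cases h0 : κ ≫ cokernel.π q' = 0
    · exact hzero _ (cokernel.condition q') h0
    · have : Mono (κ ≫ cokernel.π q') := mono_of_nonzero_from_simple h0
      have : Epi (κ ≫ cokernel.π q') := Preadditive.epi_of_cancel_zero _ fun t ht =>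
        zero_of_epi_comp (cokernel.π q') (hzero _ (by simp) (by simpa using ht))
      have : IsIso (κ ≫ cokernel.π q') := isIso_of_mono_of_epi _
      exact (hκ ⟨cokernel.π q' ≫ inv (κ ≫ cokernel.π q'), by
        rw [← Category.assoc, IsIso.hom_inv_id]⟩).elim)
  have hinj : Function.Injective (Linear.leftComp k C p) := fun x y hxy => (cancel_epi p).1 hxy
  refine ⟨U', ⟨⟨m + 1, U, _, κ, p, w, hE, hU⟩, ⟨q', hepi⟩, ⟨κ, fun h0 => ?_⟩⟩,
    LinearMap.finrank_le_finrank_of_injective hinj, fun ⟨v, hv⟩ => ?_⟩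
  · exact B.id_ne_zero (B.next a) (by rw [← cancel_mono κ, h0, comp_zero, comp_zero])
  · obtain ⟨y, rfl⟩ := B.exists_desc_of_bottomFiltered hF hU (topFiltered_one (B.next a)) hE v
      fun l _ => hC l
    rw [← LinearMap.finrank_range_of_inj hinj]
    refine Submodule.finrank_lt fun htop => hv ?_
    obtain ⟨z, rfl⟩ := LinearMap.range_eq_top.1 htop y
    change κ ≫ p ≫ z = 0
    rw [← Category.assoc, w, zero_comp]

/-- If the bricks are simple, the tube is extremal. -/
theorem inTube_or_inTube {A C : 𝒜} (hA : Indecomposable A) (hC : Indecomposable C)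
    (hAY : ∃ f : A ⟶ Y, f ≠ 0) (hYC : ∃ f : Y ⟶ C, f ≠ 0) : InTube Y A ∨ InTube Y C := by
  by_contra! hnot
  have hA' := fun n => (B.noPath_of_not_inTube hF hs hA hnot.1 n).1
  have hC' := fun n => (B.noPath_of_not_inTube hF hs hC hnot.2 n).2
  obtain ⟨g, hg⟩ := hYC
  obtain ⟨j, hj⟩ := B.exists_ι_ne_zero hg
  have hiter : ∀ (m : ℕ) (U : 𝒜) (a : B.J), B.IsTowerQuotient A U a →
      (∃ v : B.X (B.next^[m] (B.next a)) ⟶ C, v ≠ 0) →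
      ∃ U' a', B.IsTowerQuotient A U' a' ∧
        Module.finrank k (U ⟶ C) < Module.finrank k (U' ⟶ C) := by
    intro m
    induction m with
    | zero =>
      intro U a h hv
      obtain ⟨U', hU', -, hlt⟩ := h.exists_succ B hF hs hA' hC'
      exact ⟨U', _, hU', hlt hv⟩
    | succ m ih =>
      intro U a h hv
      obtain ⟨U', hU', hle, -⟩ := h.exists_succ B hF hs hA' hC'
      obtain ⟨U'', a'', hU'', hlt⟩ := ih U' _ hU' hv
      exact ⟨U'', a'', hU'', hle.trans_lt hlt⟩
  have hlarge : ∀ N : ℕ, ∃ U a, B.IsTowerQuotient A U a ∧ N ≤ Module.finrank k (U ⟶ C) := by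
    intro N
    induction N with
    | zero =>
      obtain ⟨f, hf⟩ := hAY
      obtain ⟨l, hl⟩ := B.exists_π_ne_zero hf
      have := hs l
      exact ⟨B.X l, l, ⟨⟨1, bottomFiltered_one l⟩, ⟨_, epi_of_nonzero_to_simple hl⟩,
        ⟨𝟙 _, B.id_ne_zero l⟩⟩, Nat.zero_le _⟩
    | succ N ih =>
      obtain ⟨U, a, hU, hN⟩ := ih
      obtain ⟨m, ⟨e⟩⟩ := B.transitive (B.next a) j
      obtain ⟨U', a', hU', hlt⟩ := hiter m U a hU ⟨e.hom ≫ B.ι j ≫ g, fun h0 => hj (by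
        rw [← cancel_epi e.hom, h0, comp_zero])⟩
      exact ⟨U', a', hU', by omega⟩
  -- U is a quotient of A, so dim Hom(U,C) is at most dim Hom(A,C); asking for one more is
  -- contradictory.
  obtain ⟨U, a, ⟨-, ⟨q, hq⟩, -⟩, hN⟩ := hlarge (Module.finrank k (A ⟶ C) + 1)
  have hinj : Function.Injective (Linear.leftComp k C q) := fun x y hxy => (cancel_epi q).1 hxy
  have := LinearMap.finrank_le_finrank_of_injective hinj
  omega

omit hF hs [F.Full] [F.Faithful] [F.Additive] in
/-- If the tube is extremal, the bricks are simple. -/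
theorem simple_of_inTube_or_inTube
    (h : ∀ A C : 𝒜, Indecomposable A → Indecomposable C → (∃ f : A ⟶ Y, f ≠ 0) →
      (∃ f : Y ⟶ C, f ≠ 0) → InTube Y A ∨ InTube Y C) (j : B.J) : Simple (B.X j) := by
  by_contra hj
  obtain ⟨K, κ, _, hκ, hκ'⟩ := B.exists_mono_of_not_simple hj
  have hK := B.subsingleton_hom_of_mono hκ'
  have hQ := B.subsingleton_hom_of_cokernel hκ
  have hp := cokernel_π_ne_zero hκ'
  obtain ⟨s, hs⟩ := exists_splitting_indecomposable (k := k) K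
  obtain ⟨t, ht⟩ := exists_splitting_indecomposable (k := k) (cokernel κ)
  -- A summand of K maps to `Y` but receives nothing from it, and a summand of the cokernel receives
  -- from `Y` but does not map to it. Nonzero tube objects have maps in both directions.
  obtain ⟨a, ha⟩ := s.exists_ι_ne_zero hκ
  obtain ⟨b, hb⟩ := t.exists_π_ne_zero hp
  rcases h (s.X a) (t.X b) (hs a) (ht b) ⟨(s.ι a ≫ κ) ≫ B.ι j, fun h0 => ha (by
    simpa [B.ι_π] using congrArg (· ≫ B.π j) h0)⟩ ⟨B.π j ≫ cokernel.π κ ≫ t.π b, fun h0 => hb (by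
    simpa [reassoc_of% B.ι_π] using congrArg (B.ι j ≫ ·) h0)⟩ with h | h
  · obtain ⟨f, hf⟩ := h.exists_hom_from (hs a).1
    apply hf
    rw [← Category.comp_id f, ← s.ι_π, ← Category.assoc, Subsingleton.elim (f ≫ s.ι a) 0, zero_comp]
  · obtain ⟨f, hf⟩ := h.exists_hom_to (ht b).1
    apply hf
    rw [← Category.id_comp f, ← t.ι_π, Category.assoc, Subsingleton.elim (t.π b ≫ f) 0, comp_zero]

omit hF hs [F.Full] [F.Faithful] [F.Additive] [Linear k 𝒜]
  [∀ A B : 𝒜, Module.Finite k (A ⟶ B)] in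
/-- `Y` is semi-simple if and only if the bricks are simple. -/
theorem isSemisimpleObject_iff : IsSemisimpleObject Y ↔ ∀ a, Simple (B.X a) := by
  have := Abelian.hasFiniteBiproducts (C := 𝒜)
  constructor
  · rintro ⟨n, s, hs, ⟨e⟩⟩ a
    obtain ⟨i, hi⟩ : ∃ i, (B.ι a ≫ e.hom ≫ biproduct.π s i) ≫
        (biproduct.ι s i ≫ e.inv ≫ B.π a) ≠ 0 := by
      by_contra! h0
      apply B.id_ne_zero a
      calc 𝟙 (B.X a) = (B.ι a ≫ e.hom) ≫ 𝟙 _ ≫ e.inv ≫ B.π a := by simp [B.ι_π]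
        _ = 0 := by
          rw [← biproduct.total, Preadditive.sum_comp, Preadditive.comp_sum]
          exact Finset.sum_eq_zero fun i _ => by simpa only [Category.assoc] using h0 i
    generalize B.ι a ≫ e.hom ≫ biproduct.π s i = x at hi
    generalize biproduct.ι s i ≫ e.inv ≫ B.π a = y at hi
    have := hs i
    have hy : y ≠ 0 := fun h0 => hi (by rw [h0, comp_zero])
    have : Mono y := mono_of_nonzero_from_simple hy
    have := B.isIso_of_ne_zero _ hi
    have : IsSplitEpi y := IsSplitEpi.mk' ⟨inv (x ≫ y) ≫ x, by
      rw [Category.assoc, IsIso.inv_hom_id]⟩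
    have : IsIso y := isIso_of_mono_of_isSplitEpi y
    exact Simple.of_iso (asIso y).symm
  · intro hs
    let σ := (Fintype.equivFin B.J).symm
    refine ⟨Fintype.card B.J, fun i => B.X (σ i), fun i => hs _,
      ⟨⟨biproduct.lift fun i => B.π (σ i), biproduct.desc fun i => B.ι (σ i), ?_, ?_⟩⟩⟩
    · rw [biproduct.lift_desc, ← B.total]
      exact Equiv.sum_comp σ fun a => B.π a ≫ B.ι a
    · ext i j
      by_cases h : j = i
      · subst h
        simp [B.ι_π]
      · have h' : σ j ≠ σ i := fun h0 => h (σ.injective h0)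
        simp [B.ι_π_ne _ _ h', biproduct.ι_π_ne _ h]

end BrickDecomposition

end SphericalTube

/-! ### Stalk complexes in the bounded derived category. -/

namespace SphericalTube

variable {k : Type*} [Field k] {𝒜 : Type u} [Category.{v} 𝒜] [Abelian 𝒜]
  [HasDerivedCategory.{w} 𝒜]

/-- The inclusion of the bounded derived category in the derived category. -/
noncomputable abbrev Db.incl (𝒜 : Type u) [Category.{v} 𝒜] [Abelian 𝒜] [HasDerivedCategory.{w} 𝒜] :
    Db 𝒜 ⥤ DerivedCategory 𝒜 :=
  (DerivedCategory.TStructure.t (C := 𝒜)).bounded.ι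

instance : (stalk 𝒜).Faithful where
  map_injective h := (DerivedCategory.singleFunctor 𝒜 0).map_injective
    (congrArg (Db.incl 𝒜).map h)

instance : (stalk 𝒜).Full where
  map_surjective f := by
    obtain ⟨g, hg⟩ := (DerivedCategory.singleFunctor 𝒜 0).map_surjective ((Db.incl 𝒜).map f)
    exact ⟨g, (Db.incl 𝒜).map_injective hg⟩

instance : (stalk 𝒜).Additive where
  map_add {_ _ f g} := (Db.incl 𝒜).map_injective (by
    rw [(Db.incl 𝒜).map_add]
    exact (DerivedCategory.singleFunctor 𝒜 0).map_add)

instance [Linear k 𝒜] : (stalk 𝒜).Linear k where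
  map_smul f r := (Db.incl 𝒜).map_injective
    ((DerivedCategory.singleFunctor 𝒜 0).map_smul r f)

instance [Linear k 𝒜] : (Db.incl 𝒜).Linear k where
  map_smul _ _ := rfl

instance [Linear k 𝒜] (n : ℤ) : (shiftFunctor (Db 𝒜) n).Linear k where
  map_smul {X Z} f r := (Db.incl 𝒜).map_injective (by
    rw [(Db.incl 𝒜).map_smul, ← cancel_mono (((Db.incl 𝒜).commShiftIso n).hom.app Z),
      Functor.commShiftIso_hom_naturality, Linear.smul_comp, Functor.commShiftIso_hom_naturality,
      (Db.incl 𝒜).map_smul, (shiftFunctor (DerivedCategory 𝒜) n).map_smul, Linear.comp_smul])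

theorem isHeartEmbedding_stalk : IsHeartEmbedding (stalk 𝒜) where
  hom_neg A B n hn f := by
    apply (Db.incl 𝒜).map_injective
    rw [Functor.map_zero, ← cancel_mono (((Db.incl 𝒜).commShiftIso n).hom.app _), zero_comp]
    have h₁ : ((stalk 𝒜 ⋙ Db.incl 𝒜).obj A).IsLE 0 :=
      inferInstanceAs (((DerivedCategory.singleFunctor 𝒜 0).obj A).IsLE 0)
    have h₂ : ((stalk 𝒜 ⋙ Db.incl 𝒜).obj B).IsGE 0 :=
      inferInstanceAs (((DerivedCategory.singleFunctor 𝒜 0).obj B).IsGE 0)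
    have h₃ := DerivedCategory.TStructure.t.isGE_shift ((stalk 𝒜 ⋙ Db.incl 𝒜).obj B) 0 n (-n)
    exact DerivedCategory.TStructure.t.zero_of_isLE_of_isGE _ 0 (-n) (by omega) h₁ h₃
  exists_triangle E hE := by
    let δ₀ : (Db.incl 𝒜).obj ((stalk 𝒜).obj E.X₃) ⟶
      ((Db.incl 𝒜).obj ((stalk 𝒜).obj E.X₁))⟦(1 : ℤ)⟧ := hE.singleδ
    obtain ⟨δ, hδ⟩ := (Db.incl 𝒜).map_surjective
      (δ₀ ≫ ((Db.incl 𝒜).commShiftIso (1 : ℤ)).inv.app ((stalk 𝒜).obj E.X₁))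
    have h : (Db.incl 𝒜).map δ ≫
        ((Db.incl 𝒜).commShiftIso (1 : ℤ)).hom.app ((stalk 𝒜).obj E.X₁) = δ₀ := by
      rw [hδ, Category.assoc, Iso.inv_hom_id_app]
      exact Category.comp_id _
    refine ⟨δ, ?_⟩
    change Triangle.mk ((Db.incl 𝒜).map ((stalk 𝒜).map E.f)) ((Db.incl 𝒜).map ((stalk 𝒜).map E.g))
      ((Db.incl 𝒜).map δ ≫ ((Db.incl 𝒜).commShiftIso (1 : ℤ)).hom.app ((stalk 𝒜).obj E.X₁)) ∈
        distTriang (DerivedCategory 𝒜)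
    rw [h]
    exact hE.singleTriangle_distinguished
  exists_obj {A B Z} f g δ h := by
    have h' := (Db.incl 𝒜).map_distinguished _ h
    have hA : ((Db.incl 𝒜).obj Z).IsLE 0 := DerivedCategory.TStructure.t.isLE₂ _ h' 0
      (inferInstanceAs (((DerivedCategory.singleFunctor 𝒜 0).obj A).IsLE 0))
      (inferInstanceAs (((DerivedCategory.singleFunctor 𝒜 0).obj B).IsLE 0))
    have hB : ((Db.incl 𝒜).obj Z).IsGE 0 := DerivedCategory.TStructure.t.isGE₂ _ h' 0
      (inferInstanceAs (((DerivedCategory.singleFunctor 𝒜 0).obj A).IsGE 0))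
      (inferInstanceAs (((DerivedCategory.singleFunctor 𝒜 0).obj B).IsGE 0))
    obtain ⟨C, ⟨e⟩⟩ := DerivedCategory.exists_iso_singleFunctor_obj_of_isGE_of_isLE
      ((Db.incl 𝒜).obj Z) 0
    exact ⟨C, ⟨(Db.incl 𝒜).preimageIso e⟩⟩

section Finiteness

variable [Linear k 𝒜] [HasExt.{w} 𝒜] (hExt : IsExtFinite.{w} 𝒜 k)

include hExt

theorem IsExtFinite.finite_hom (A B : 𝒜) : Module.Finite k (A ⟶ B) :=
  have := hExt A B 0
  Module.Finite.equiv (Abelian.Ext.linearEquiv₀ (R := k) (X := A) (Y := B))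

theorem IsExtFinite.finite_hom_shift (A B : 𝒜) :
    Module.Finite k ((stalk 𝒜).obj A ⟶ ((stalk 𝒜).obj B)⟦(1 : ℤ)⟧) := by
  have := hExt A B 1
  have : Module.Finite k ((DerivedCategory.singleFunctor 𝒜 0).obj A ⟶
      ((DerivedCategory.singleFunctor 𝒜 0).obj B)⟦(1 : ℤ)⟧) :=
    Module.Finite.equiv (Abelian.Ext.homLinearEquiv (R := k) (X := A) (Y := B) (n := 1))
  let T : ((stalk 𝒜).obj A ⟶ ((stalk 𝒜).obj B)⟦(1 : ℤ)⟧) →ₗ[k]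
      ((Db.incl 𝒜).obj ((stalk 𝒜).obj A) ⟶ ((Db.incl 𝒜).obj ((stalk 𝒜).obj B))⟦(1 : ℤ)⟧) :=
    (Linear.rightComp k _ (((Db.incl 𝒜).commShiftIso (1 : ℤ)).hom.app ((stalk 𝒜).obj B))).comp
      ((Db.incl 𝒜).mapLinearMap k)
  have hT : Function.Injective T := fun f g h =>
    (Db.incl 𝒜).map_injective ((cancel_mono _).1 h)
  have : Module.Finite k ((Db.incl 𝒜).obj ((stalk 𝒜).obj A) ⟶
      ((Db.incl 𝒜).obj ((stalk 𝒜).obj B))⟦(1 : ℤ)⟧) := this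
  exact Module.Finite.of_injective T hT

end Finiteness

end SphericalTube

/-! ### Each condition is equivalent to simplicity of the bricks. -/

namespace SphericalTube

variable {k : Type*} [Field k] {𝒜 : Type u} [Category.{v} 𝒜] [Abelian 𝒜] [Linear k 𝒜]
  [HasDerivedCategory.{w} 𝒜]

theorem nontrivial_stalk_iff {A B : 𝒜} :
    Nontrivial ((stalk 𝒜).obj A ⟶ (stalk 𝒜).obj B) ↔ ∃ f : A ⟶ B, f ≠ 0 := by
  rw [← not_subsingleton_iff_nontrivial, subsingleton_map_iff, not_subsingleton_iff_nontrivial,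
    nontrivial_hom_iff]

namespace BrickDecomposition

variable {S : SerreFunctor k (Db 𝒜)} {Y : 𝒜} (B : BrickDecomposition (stalk 𝒜) S Y)
  [∀ A B : 𝒜, Module.Finite k (A ⟶ B)]
  (φ : S.equiv.functor.obj ((stalk 𝒜).obj Y) ≅ ((stalk 𝒜).obj Y)⟦(1 : ℤ)⟧)

include B

theorem tubeIsExtremal_iff : TubeIsExtremal Y ↔ ∀ a, Simple (B.X a) := by
  constructor
  · intro h
    exact B.simple_of_inTube_or_inTube (k := k) fun A C hA hC hAY hYC =>
      h A C hA hC (nontrivial_stalk_iff.2 hAY) (nontrivial_stalk_iff.2 hYC)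
  · intro hs A C hA hC hAY hYC
    exact B.inTube_or_inTube (k := k) isHeartEmbedding_stalk hs hA hC
      (nontrivial_stalk_iff.1 hAY) (nontrivial_stalk_iff.1 hYC)

include φ

theorem simple_of_mapsOnlyInto {A : 𝒜} (hA : MapsOnlyInto A Y) (h : TwistsInDegreeZero Y A) :
    ∀ a, Simple (B.X a) := by
  obtain ⟨Z, hZ, hdeg⟩ := h
  choose N e using hdeg
  refine B.simple_of_isCotwist (k := k) isHeartEmbedding_stalk φ (fun n => N (-n)) ?_ ?_ fun n => ?_
  · obtain ⟨e₀⟩ := hZ.zero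
    obtain ⟨e₁⟩ := e 0
    rw [← subsingleton_map_iff (F := stalk 𝒜)]
    exact ((e₀.symm ≪≫ e₁).homToEquiv (Z := (stalk 𝒜).obj Y)).subsingleton_congr.1 hA.2
  · obtain ⟨e₀⟩ := hZ.zero
    obtain ⟨e₁⟩ := e 0
    rw [← nontrivial_stalk_iff]
    exact ((e₀.symm ≪≫ e₁).homFromEquiv (Z := (stalk 𝒜).obj Y)).nontrivial_congr.1 hA.1
  · have h := hZ.pred n
    rw [show (-(n : ℤ) - 1) = -((n + 1 : ℕ) : ℤ) by push_cast; ring] at h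
    exact h.of_iso (e _).some (e _).some

theorem simple_of_mapsOnlyFrom {A : 𝒜} (hA : MapsOnlyFrom A Y) (h : TwistsInDegreeZero Y A) :
    ∀ a, Simple (B.X a) := by
  obtain ⟨Z, hZ, hdeg⟩ := h
  choose N e using hdeg
  refine B.simple_of_isTwist (k := k) isHeartEmbedding_stalk φ (fun n => N n) ?_ ?_ fun n => ?_
  · obtain ⟨e₀⟩ := hZ.zero
    obtain ⟨e₁⟩ := e 0
    rw [← subsingleton_map_iff (F := stalk 𝒜)]
    exact ((e₀.symm ≪≫ e₁).homFromEquiv (Z := (stalk 𝒜).obj Y)).subsingleton_congr.1 hA.2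
  · obtain ⟨e₀⟩ := hZ.zero
    obtain ⟨e₁⟩ := e 0
    rw [← nontrivial_stalk_iff]
    exact ((e₀.symm ≪≫ e₁).homToEquiv (Z := (stalk 𝒜).obj Y)).nontrivial_congr.1 hA.1
  · have h := hZ.succ n
    rw [← Nat.cast_succ] at h
    exact h.of_iso (e _).some (e _).some

variable [∀ A B : 𝒜, Module.Finite k ((stalk 𝒜).obj A ⟶ ((stalk 𝒜).obj B)⟦(1 : ℤ)⟧)]

theorem forall_mapsOnlyInto_iff :
    (∀ A : 𝒜, MapsOnlyInto A Y → TwistsInDegreeZero Y A) ↔ ∀ a, Simple (B.X a) := by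
  constructor
  · intro h
    by_contra! hs
    obtain ⟨j, hj⟩ := hs
    obtain ⟨K, κ, _, hκ, hκ'⟩ := B.exists_mono_of_not_simple hj
    -- The proper subobject K is itself a test object, so its orbit lies in 𝒜[0] and forces
    -- simplicity.
    have hK : MapsOnlyInto K Y := ⟨nontrivial_stalk_iff.2 ⟨κ ≫ B.ι j, fun h0 => hκ (by
      simpa [B.ι_π] using congrArg (· ≫ B.π j) h0)⟩,
      subsingleton_map_iff.2 (B.subsingleton_hom_of_mono hκ')⟩
    exact hj (B.simple_of_mapsOnlyInto φ hK (h K hK) j)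
  · intro hs A hA
    exact exists_isTwistOrbit (stalk 𝒜) (B.exists_isTwist isHeartEmbedding_stalk φ)
      (B.exists_isCotwist isHeartEmbedding_stalk φ hs) A (subsingleton_map_iff.1 hA.2)

theorem forall_mapsOnlyFrom_iff :
    (∀ A : 𝒜, MapsOnlyFrom A Y → TwistsInDegreeZero Y A) ↔ ∀ a, Simple (B.X a) := by
  constructor
  · intro h
    by_contra! hs
    obtain ⟨j, hj⟩ := hs
    obtain ⟨K, κ, _, hκ, hκ'⟩ := B.exists_mono_of_not_simple hj
    have hQ : MapsOnlyFrom (cokernel κ) Y := ⟨nontrivial_stalk_iff.2 ⟨B.π j ≫ cokernel.π κ,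
      fun h0 => cokernel_π_ne_zero hκ' (by
        simpa [reassoc_of% B.ι_π] using congrArg (B.ι j ≫ ·) h0)⟩,
      subsingleton_map_iff.2 (B.subsingleton_hom_of_cokernel hκ)⟩
    exact hj (B.simple_of_mapsOnlyFrom φ hQ (h _ hQ) j)
  · intro hs A hA
    exact exists_isTwistOrbit (stalk 𝒜) (B.exists_isTwist' isHeartEmbedding_stalk φ hs)
      (B.exists_isCotwist' isHeartEmbedding_stalk φ) A (subsingleton_map_iff.1 hA.2)

end BrickDecomposition

end SphericalTube

theorem mainTheorem7 {k : Type*} [Field k] [IsAlgClosed k]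
    {𝒜 : Type u} [Category.{v} 𝒜] [Abelian 𝒜] [Linear k 𝒜]
    [HasDerivedCategory.{w} 𝒜] [HasExt.{w} 𝒜]
    (hExt : SphericalTube.IsExtFinite.{w} 𝒜 k) (hHer : SphericalTube.IsHereditary.{w} 𝒜)
    (S : SphericalTube.SerreFunctor k (SphericalTube.Db 𝒜))
    (Y : 𝒜) (hY : SphericalTube.IsMinimalSpherical S 1 ((SphericalTube.stalk 𝒜).obj Y)) :
    List.TFAE
      [SphericalTube.IsSemisimpleObject Y,
        SphericalTube.TubeIsExtremal Y,
        ∀ A : 𝒜, SphericalTube.MapsOnlyInto A Y → SphericalTube.TwistsInDegreeZero Y A,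
        ∀ A : 𝒜, SphericalTube.MapsOnlyFrom A Y → SphericalTube.TwistsInDegreeZero Y A] ∧
    (((∃ A : 𝒜, SphericalTube.MapsOnlyInto A Y ∧ SphericalTube.TwistsInDegreeZero Y A) ∨
        (∃ A : 𝒜, SphericalTube.MapsOnlyFrom A Y ∧ SphericalTube.TwistsInDegreeZero Y A)) →
      SphericalTube.IsSemisimpleObject Y ∧
      SphericalTube.TubeIsExtremal Y ∧
      (∀ A : 𝒜, SphericalTube.MapsOnlyInto A Y → SphericalTube.TwistsInDegreeZero Y A) ∧
      (∀ A : 𝒜, SphericalTube.MapsOnlyFrom A Y → SphericalTube.TwistsInDegreeZero Y A)) := by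
  have := hExt.finite_hom
  have := hExt.finite_hom_shift
  obtain ⟨B⟩ := SphericalTube.exists_brickDecomposition hY
  obtain ⟨φ⟩ := hY.spherical.serre_iso
  rw [B.isSemisimpleObject_iff, B.tubeIsExtremal_iff, B.forall_mapsOnlyInto_iff φ,
    B.forall_mapsOnlyFrom_iff φ]
  refine ⟨List.tfae_of_forall (∀ a, Simple (B.X a)) _ (by simp), fun h => ?_⟩
  have hs : ∀ a, Simple (B.X a) := by
    rcases h with ⟨A, hA, h⟩ | ⟨A, hA, h⟩
    exacts [B.simple_of_mapsOnlyInto φ hA h, B.simple_of_mapsOnlyFrom φ hA h]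
  exact ⟨hs, hs, hs, hs⟩
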